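/- Let $T$ be an infinite, locally finite tree (a simple graph: all edge weights are $0$ or $1$) with vertex set $V$ and a fixed root $v$. Put $|x|=d(v,x)$, $S_n=\{x\in V:|x|=n\}$, $B_n=\bigcup_{0\le i\le n}S_i$ and $B_{-1}=\emptyset$. Assume that $T$ is radial, i.e. the degree of a vertex $x$ depends only on $|x|$, and write $\eta(n)$ for the degree of the vertices of $S_n$. For a weight $m:V\to(0,\infty)$ let $\ell^2(V,m)$ be the space of $f:V\to\mathbb C$ with $\sum_x m(x)|f(x)|^2<\infty$, and let $\Delta_m$ be the Friedrichs extension in $\ell^2(V,m)$ of the operator $f\mapsto\bigl(x\mapsto \frac1{m(x)}\sum_{y\sim x}(f(x)-f(y))\bigr)$ on finitely supported functions. $\Delta_\eta$ denotes the case $m(x)=\deg(x)$ and $\Delta_1$ the case $m\equiv1$. The essential spectrum $\sigma_{\rm ess}$ is the spectrum $\sigma$ minus the isolated eigenvalues of finite multiplicity, and $\lambda_1(\Delta_m)\le\lambda_2(\Delta_m)\le\dots$ are the eigenvalues of $\Delta_m$ below $\inf\sigma_{\rm ess}(\Delta_m)$ (with $\inf\emptyset=+\infty$), counted with multiplicity.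 (1) Assume that $\eta(n)$ is non-decreasing and tends to $+\infty$. Then $\sigma_{\rm ess}(\Delta_\eta)=\{1\}$, there are infinitely many eigenvalues $\lambda_i(\Delta_\eta)$, $i\ge1$, below $1$, they converge to $1$, and $$\sigma(\Delta_\eta)=\{1\}\cup\{\lambda_i(\Delta_\eta),\,2-\lambda_i(\Delta_\eta):i\ge1\}.$$ Moreover, for every $\varepsilon>0$ there is $n(\varepsilon)$ such that for all $n\ge n(\varepsilon)$ $$1-2\sqrt{\tfrac1{\eta(n)}}\le\lambda_{\#B_{n-1}+1}(\Delta_\eta)\le\lambda_{\#S_n}(\Delta_\eta)\le1-\frac{1-\varepsilon}{\sqrt{\eta(n+1)}}.$$ (2) Assume that $\eta(n)\bigl(1-2\sqrt{1/\eta(n)}\bigr)$ is non-decreasing and that $\eta(n)$ tends to $+\infty$. Then $\sigma_{\rm ess}(\Delta_1)=\emptyset$, there are infinitely many eigenvalues $\lambda_i(\Delta_1)$, $i\ge1$, they tend to $+\infty$, and $\sigma(\Delta_1)=\{\lambda_i(\Delta_1):i\ge1\}$. Moreover, for all $n\ge0$, $$\eta(n)\Bigl(1-2\sqrt{\tfrac1{\eta(n)}}\Bigr)\le\lambda_{\#B_{n-1}+1}(\Delta_1),$$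 and $\lambda_{\#B_{n-1}+1}(\Delta_1)\le\eta(n)$ for every $n\ge0$ with $\#B_{n-1}+1\le\#S_n$, in particular for all sufficiently large $n$. -/

import Mathlib

open Filter Topology
open scoped ENNReal ComplexConjugate

noncomputable section

namespace RadialTree

/-! ### Unbounded operators: spectrum, essential spectrum, eigenvalues below it -/

section Operators

variable {E : Type*} [NormedAddCommGroup E] [NormedSpace ℂ E]

/-- `z` is in the resolvent set of the (unbounded) operator `T` when `T - z`, from the domain of
`T` to the whole space, has an everywhere defined bounded two-sided inverse `R`. -/
def resolventSet (T : E →ₗ.[ℂ] E) : Set ℂ :=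
  {z | ∃ R : E →L[ℂ] E,
    (∀ u : E, ∃ h : R u ∈ T.domain, T ⟨R u, h⟩ - z • R u = u) ∧
    (∀ f : T.domain, R (T f - z • (f : E)) = f)}

/-- The spectrum of an unbounded operator. -/
def spectrum (T : E →ₗ.[ℂ] E) : Set ℂ := (resolventSet T)ᶜ

/-- The eigenspace `ker (T - z)`, as a subspace of the domain of `T`. -/
def eigenspace (T : E →ₗ.[ℂ] E) (z : ℂ) : Submodule ℂ T.domain :=
  LinearMap.ker (T.toFun - z • T.domain.subtype)

/-- The discrete spectrum: the isolated points of the spectrum that are eigenvalues of finite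
multiplicity. -/
def discreteSpectrum (T : E →ₗ.[ℂ] E) : Set ℂ :=
  {z | z ∈ spectrum T ∧ (∀ᶠ w in 𝓝[≠] z, w ∉ spectrum T) ∧
    eigenspace T z ≠ ⊥ ∧ FiniteDimensional ℂ (eigenspace T z)}

/-- The essential spectrum (of a self-adjoint operator): the spectrum minus the discrete
spectrum. -/
def essSpectrum (T : E →ₗ.[ℂ] E) : Set ℂ := spectrum T \ discreteSpectrum T

/-- The infimum of the (real) essential spectrum, equal to `⊤` when the latter is empty. -/
def infEssSpectrum (T : E →ₗ.[ℂ] E) : EReal :=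
  sInf ((fun z : ℂ => (z.re : EReal)) '' essSpectrum T)

/-- `lam 0 ≤ lam 1 ≤ lam 2 ≤ …` is the (infinite) list of all the eigenvalues of `T` located
below the infimum of its essential spectrum, each repeated according to its multiplicity.
In the usual numbering starting at one, `lam i` is the eigenvalue `λ_{i+1}(T)`. -/
structure IsEigenvalueList (T : E →ₗ.[ℂ] E) (lam : ℕ → ℝ) : Prop where
  mono : Monotone lam
  below : ∀ i, (lam i : EReal) < infEssSpectrum T
  mult : ∀ μ : ℝ, (μ : EReal) < infEssSpectrum T →
    {i | lam i = μ}.encard = Cardinal.toENat (Module.rank ℂ (eigenspace T (μ : ℂ)))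

end Operators

/-! ### The weighted space `ℓ²(V, m)` -/

section WeightedL2

variable {V : Type*}

theorem summable_add {m : V → {r : ℝ // 0 < r}} {f g : V → ℂ}
    (hf : Summable fun x => (m x : ℝ) * ‖f x‖ ^ 2) (hg : Summable fun x => (m x : ℝ) * ‖g x‖ ^ 2) :
    Summable fun x => (m x : ℝ) * ‖f x + g x‖ ^ 2 := by
  refine Summable.of_nonneg_of_le (fun x => mul_nonneg (m x).2.le (sq_nonneg _)) (fun x => ?_)
    ((hf.mul_left 2).add (hg.mul_left 2))
  have h1 : ‖f x + g x‖ ^ 2 ≤ 2 * ‖f x‖ ^ 2 + 2 * ‖g x‖ ^ 2 := by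
    have := norm_add_le (f x) (g x)
    nlinarith [sq_nonneg (‖f x‖ - ‖g x‖), norm_nonneg (f x + g x)]
  have := mul_le_mul_of_nonneg_left h1 (m x).2.le
  linarith

/-- The functions `f : V → ℂ` with `∑ₓ m(x) |f(x)|² < ∞`, as a subspace of all functions. -/
def l2Submodule (m : V → {r : ℝ // 0 < r}) : Submodule ℂ (V → ℂ) where
  carrier := {f | Summable fun x => (m x : ℝ) * ‖f x‖ ^ 2}
  add_mem' := fun hf hg => summable_add hf hg
  zero_mem' := by simp
  smul_mem' := fun c f hf => by
    have := Summable.mul_left (‖c‖ ^ 2) hf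
    refine this.congr (fun x => ?_)
    simp only [Pi.smul_apply, smul_eq_mul, norm_mul]
    ring

/-- The Hilbert space `ℓ²(V, m)`. -/
def L2 (m : V → {r : ℝ // 0 < r}) : Type _ := l2Submodule m

variable {m : V → {r : ℝ // 0 < r}}

instance : AddCommGroup (L2 m) := inferInstanceAs (AddCommGroup (l2Submodule m))
instance : Module ℂ (L2 m) := inferInstanceAs (Module ℂ (l2Submodule m))
instance : CoeFun (L2 m) (fun _ => V → ℂ) := ⟨fun f => f.1⟩

@[simp] theorem add_apply (f g : L2 m) (x : V) : (f + g) x = f x + g x := rfl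
@[simp] theorem sub_apply (f g : L2 m) (x : V) : (f - g) x = f x - g x := rfl
@[simp] theorem zero_apply (x : V) : (0 : L2 m) x = 0 := rfl
@[simp] theorem smul_apply (c : ℂ) (f : L2 m) (x : V) : (c • f) x = c * f x := rfl

theorem summable_inner (f g : L2 m) :
    Summable fun x => ((m x : ℝ) : ℂ) * (conj (f x) * g x) := by
  refine Summable.of_norm_bounded (Summable.add f.2 g.2) (fun x => ?_)
  have hm : (0 : ℝ) < m x := (m x).2
  rw [norm_mul, norm_mul, RCLike.norm_conj, Complex.norm_real, Real.norm_of_nonneg hm.le]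
  have : ‖f x‖ * ‖g x‖ ≤ ‖f x‖ ^ 2 + ‖g x‖ ^ 2 := by
    nlinarith [sq_nonneg (‖f x‖ - ‖g x‖), sq_nonneg ‖f x‖, sq_nonneg ‖g x‖]
  have := mul_le_mul_of_nonneg_left this hm.le
  linarith

theorem inner_self_eq (f : L2 m) :
    (∑' x, ((m x : ℝ) : ℂ) * (conj (f x) * f x)) = ((∑' x, (m x : ℝ) * ‖f x‖ ^ 2 : ℝ) : ℂ) := by
  rw [Complex.ofReal_tsum]
  refine tsum_congr (fun x => ?_)
  rw [Complex.conj_mul']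
  push_cast
  ring

/-- The scalar product `⟨f, g⟩ₘ = ∑ₓ m(x) conj(f(x)) g(x)`. -/
@[reducible] def l2Core (m : V → {r : ℝ // 0 < r}) : InnerProductSpace.Core ℂ (L2 m) where
  inner f g := ∑' x, ((m x : ℝ) : ℂ) * (conj (f x) * g x)
  conj_inner_symm f g := by
    simp only [Complex.conj_tsum, map_mul, Complex.conj_ofReal, Complex.conj_conj]
    exact tsum_congr (fun x => by ring)
  re_inner_nonneg f := by
    rw [inner_self_eq]
    exact tsum_nonneg (fun x => mul_nonneg (m x).2.le (sq_nonneg _))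
  add_left f g h := by
    rw [← (summable_inner f h).tsum_add (summable_inner g h)]
    refine tsum_congr (fun x => ?_)
    simp only [add_apply, map_add]
    ring
  smul_left f g c := by
    rw [← tsum_mul_left]
    refine tsum_congr (fun x => ?_)
    simp only [smul_apply, map_mul]
    ring
  definite f hf := by
    rw [inner_self_eq, Complex.ofReal_eq_zero] at hf
    have h0 : ∀ x, 0 ≤ (m x : ℝ) * ‖f x‖ ^ 2 := fun x => mul_nonneg (m x).2.le (sq_nonneg _)
    have h1 := (hasSum_zero_iff_of_nonneg h0).1 (hf ▸ (Summable.hasSum f.2))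
    refine Subtype.ext (funext fun x => ?_)
    have h2 := congrFun h1 x
    have hm : (m x : ℝ) ≠ 0 := (m x).2.ne'
    simpa [hm] using h2

instance : NormedAddCommGroup (L2 m) := (l2Core m).toNormedAddCommGroup
instance : InnerProductSpace ℂ (L2 m) := InnerProductSpace.ofCore (l2Core m).toCore

end WeightedL2

/-! ### The Laplacian of a simple graph with vertex weight `m` -/

section Laplacian

variable {V : Type*} (G : SimpleGraph V) [G.LocallyFinite]

/-- The algebraic Laplacian, `f ↦ (x ↦ (1 / m x) ∑_{y ∼ x} (f x - f y))`, on all functions. -/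
def algLaplacian (m : V → {r : ℝ // 0 < r}) : (V → ℂ) →ₗ[ℂ] (V → ℂ) where
  toFun f x := ((m x : ℝ) : ℂ)⁻¹ * ∑ y ∈ G.neighborFinset x, (f x - f y)
  map_add' f g := by
    funext x
    simp only [Pi.add_apply]
    rw [← mul_add, ← Finset.sum_add_distrib]
    congr 1
    exact Finset.sum_congr rfl (fun y _ => by ring)
  map_smul' c f := by
    funext x
    simp only [Pi.smul_apply, smul_eq_mul, RingHom.id_apply]
    rw [mul_left_comm c]
    congr 1
    rw [Finset.mul_sum]
    exact Finset.sum_congr rfl (fun y _ => by ring)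

/-- The quadratic form `Q(f, f) = (1/2) ∑ₓ ∑_{y ∼ x} |f(x) - f(y)|²`, with values in `[0, ∞]`. -/
def energy (f : V → ℂ) : ℝ≥0∞ :=
  2⁻¹ * ∑' x, ∑ y ∈ G.neighborFinset x, ‖f x - f y‖ₑ ^ 2

theorem energy_add_le (f g : V → ℂ) :
    energy G (fun x => f x + g x) ≤ 2 * energy G f + 2 * energy G g := by
  have key : ∀ a b : ℂ, ‖a + b‖ₑ ^ 2 ≤ 2 * ‖a‖ₑ ^ 2 + 2 * ‖b‖ₑ ^ 2 := by
    intro a b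
    simp only [enorm_eq_nnnorm]
    norm_cast
    rw [← NNReal.coe_le_coe]
    push_cast
    have := norm_add_le a b
    nlinarith [sq_nonneg (‖a‖ - ‖b‖), norm_nonneg (a + b)]
  unfold energy
  rw [mul_left_comm 2, mul_left_comm 2, ← mul_add,
    ← ENNReal.tsum_mul_left (a := 2) (f := fun x => ∑ y ∈ G.neighborFinset x, ‖f x - f y‖ₑ ^ 2),
    ← ENNReal.tsum_mul_left (a := 2) (f := fun x => ∑ y ∈ G.neighborFinset x, ‖g x - g y‖ₑ ^ 2),
    ← ENNReal.tsum_add]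
  refine mul_le_mul_right (ENNReal.tsum_le_tsum fun x => ?_) _
  rw [Finset.mul_sum, Finset.mul_sum, ← Finset.sum_add_distrib]
  refine Finset.sum_le_sum (fun y _ => ?_)
  have := key (f x - f y) (g x - g y)
  rwa [show f x + g x - (f y + g y) = (f x - f y) + (g x - g y) by ring]

theorem energy_smul (c : ℂ) (f : V → ℂ) :
    energy G (fun x => c * f x) = ‖c‖ₑ ^ 2 * energy G f := by
  unfold energy
  rw [mul_left_comm,
    ← ENNReal.tsum_mul_left (a := ‖c‖ₑ ^ 2) (f := fun x => ∑ y ∈ G.neighborFinset x, ‖f x - f y‖ₑ ^ 2)]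
  congr 1
  refine tsum_congr (fun x => ?_)
  rw [Finset.mul_sum]
  refine Finset.sum_congr rfl (fun y _ => ?_)
  rw [← mul_sub, enorm_mul, mul_pow]

/-- The form domain `D(Δ^{1/2})`: the completion, realised inside `ℓ²(V, m)`, of the finitely
supported functions for the norm `(‖f‖² + Q(f, f))^{1/2}`. -/
def formDomain (m : V → {r : ℝ // 0 < r}) : Submodule ℂ (L2 m) where
  carrier := {f | ∃ u : ℕ → L2 m, (∀ n, (Function.support (u n)).Finite) ∧
    Tendsto u atTop (𝓝 f) ∧ Tendsto (fun n => energy G (fun x => u n x - f x)) atTop (𝓝 0)}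
  zero_mem' := by
    refine ⟨fun _ => 0, fun _ => ?_, tendsto_const_nhds, ?_⟩
    · have : Function.support (fun x => (0 : L2 m) x) = ∅ := by simp
      rw [this]
      exact Set.finite_empty
    · have : energy G (fun x => (0 : L2 m) x - (0 : L2 m) x) = 0 := by simp [energy]
      exact this ▸ tendsto_const_nhds
  add_mem' := by
    rintro f g ⟨u, hu, huf, hue⟩ ⟨v, hv, hvg, hve⟩
    refine ⟨fun n => u n + v n, fun n => ?_, huf.add hvg, ?_⟩
    · exact ((hu n).union (hv n)).subset (Function.support_add _ _)
    · have h := (ENNReal.Tendsto.const_mul hue (a := 2) (Or.inr (by simp))).add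
        (ENNReal.Tendsto.const_mul hve (a := 2) (Or.inr (by simp)))
      simp only [mul_zero, add_zero] at h
      refine tendsto_of_tendsto_of_tendsto_of_le_of_le tendsto_const_nhds h
        (fun _ => zero_le) (fun n => ?_)
      have := energy_add_le G (fun x => u n x - f x) (fun x => v n x - g x)
      refine le_trans (le_of_eq ?_) this
      congr 1
      funext x
      rw [add_apply, add_apply]
      ring
  smul_mem' := by
    rintro c f ⟨u, hu, huf, hue⟩
    refine ⟨fun n => c • u n, fun n => ?_, huf.const_smul c, ?_⟩
    · refine (hu n).subset (fun x hx => ?_)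
      intro h0
      exact hx (by simp [h0])
    · have h := ENNReal.Tendsto.const_mul hue (a := ‖c‖ₑ ^ 2) (Or.inr (by simp))
      simp only [mul_zero] at h
      refine h.congr (fun n => ?_)
      rw [← energy_smul]
      congr 1
      funext x
      rw [smul_apply, smul_apply]
      ring

/-- The Laplacian `Δₘ` on `ℓ²(V, m)`: the Friedrichs extension of the restriction of the algebraic
Laplacian to the finitely supported functions. Its domain is the intersection of the form domain
with the domain `{f ∈ ℓ²(V, m) | algLaplacian f ∈ ℓ²(V, m)}` of the adjoint of that
restriction, and it acts as the algebraic Laplacian. -/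
def laplacian (m : V → {r : ℝ // 0 < r}) : L2 m →ₗ.[ℂ] L2 m where
  domain :=
    { carrier := {f | f ∈ formDomain G m ∧ algLaplacian G m f ∈ l2Submodule m}
      zero_mem' := ⟨Submodule.zero_mem _, by
        have : algLaplacian G m (fun x => (0 : L2 m) x) = 0 := map_zero _
        rw [this]; exact Submodule.zero_mem _⟩
      add_mem' := fun {f g} hf hg => ⟨Submodule.add_mem _ hf.1 hg.1, by
        have : algLaplacian G m (fun x => (f + g) x) = algLaplacian G m f + algLaplacian G m g :=
          map_add (algLaplacian G m) f.1 g.1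
        rw [this]; exact Submodule.add_mem _ hf.2 hg.2⟩
      smul_mem' := fun c f hf => ⟨Submodule.smul_mem _ c hf.1, by
        have : algLaplacian G m (fun x => (c • f) x) = c • algLaplacian G m f :=
          map_smul (algLaplacian G m) c f.1
        rw [this]; exact Submodule.smul_mem _ c hf.2⟩ }
  toFun :=
    { toFun := fun f => ⟨algLaplacian G m (f : L2 m), f.2.2⟩
      map_add' := fun f g => Subtype.ext (map_add (algLaplacian G m) f.1.1 g.1.1)
      map_smul' := fun c f => Subtype.ext (map_smul (algLaplacian G m) c f.1.1) }

/-- The weight `m = 1`; `laplacian G oneWeight` is the combinatorial Laplacian `Δ₁`. -/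
def oneWeight : V → {r : ℝ // 0 < r} := fun _ => ⟨1, one_pos⟩

/-- The weight `m(x) = η(x) = deg(x)` of a tree with infinitely many vertices; the corresponding
Laplacian is the normalized Laplacian `Δ_η`. -/
def degreeWeight [Infinite V] (hG : G.IsTree) : V → {r : ℝ // 0 < r} := fun x =>
  ⟨G.degree x, Nat.cast_pos.2 (hG.connected.preconnected.degree_pos_of_nontrivial x)⟩

end Laplacian

/-! ### Spheres and balls -/

/-- The sphere `S_n` of radius `n` around `v`. -/
def sphere {V : Type*} (G : SimpleGraph V) (v : V) (n : ℕ) : Set V := {x | G.dist v x = n}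

/-- The set `B_{n-1} = S_0 ∪ … ∪ S_{n-1}` (empty for `n = 0`). -/
def ballBefore {V : Type*} (G : SimpleGraph V) (v : V) (n : ℕ) : Set V := {x | G.dist v x < n}

end RadialTree

end

-- Both Laplacians turn out to be diagonal in a Hilbert basis, because the resolvent at -1 is a
-- compact perturbation of a multiple s of the identity: s = 0 for the weight 1 and s = 1/2 for the
-- weight `deg`. All spectral assertions then become statements about the real family of diagonal
-- entries: the spectrum is its closure, points near which only finitely many indices occur are
-- discrete, and the min-max principle compares the ordered entries with test spaces.
--
-- The resolvent comes from the form. The gradient on finitely supported functions has a closed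
-- graph closure K, and (Δ + 1)⁻¹u is the first component of the orthogonal projection of (u, 0)
-- onto K (`exists_resolvent`). Compactness amounts to uniformly small tails outside finite balls
-- (`isCompactOperator_of_tail`).
--
-- The lower bounds rest on |a|² + |b|² ≤ |a - b|² + s|a|² + t|b|² for st = 1, summed over the
-- edges. With coefficient η(|x|)^(-1/2) at a parent x and η(|x|)^(1/2) at its child, the total
-- coefficient at each vertex is at most 2√η, so the energy dominates ∑ (η - 2√η)|f|² when f has
-- finite support (`tsum_degree_le_energy_add`). For weight 1 this potential tends to infinity,
-- which gives compactness; for weight `deg`, a Schur-type estimate shows that the averaging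
-- operator 1 - Δ has small tails (`tail_average_le`). Restricting the energy bound to functions
-- vanishing on a ball, a space of codimension #B_{n-1}, gives the lower eigenvalue bounds.
--
-- The upper bounds use test spaces of dimension #S_n. Functions on one sphere see Δ_1 as
-- multiplication by η(n), since a sphere has no inner edges. Functions on S_n, copied with a
-- suitable ratio to the children, satisfy the eigenvalue equation of Δ_η on their support
-- (`algLaplacian_twoSpheres`). Eventually #B_{n-1} < #S_n, as the spheres grow at least by the
-- factor 3.
--
-- Finally, multiplication by (-1)^|x| changes the sign of 1 - Δ_η, hence the symmetry λ ↦ 2 - λ;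
-- and 1 is essential because infinitely many entries below 1 can accumulate only there.

universe u

namespace RadialTree

/-! ### Compact symmetric operators and diagonal operators in a Hilbert basis -/

section Spectral

variable {H : Type*} [NormedAddCommGroup H] [InnerProductSpace ℂ H]

local notation "⟪" x ", " y "⟫" => inner ℂ x y

theorem norm_sub_sq_of_orthogonal {x y : H} (h : ⟪x, y⟫ = 0) :
    ‖x - y‖ ^ 2 = ‖x‖ ^ 2 + ‖y‖ ^ 2 := by
  rw [@norm_sub_sq ℂ, h]
  simp

/-- Orthonormal eigenvectors of a compact operator have eigenvalues accumulating only at zero. -/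
theorem finite_setOf_le_abs_of_isCompactOperator {ι : Type*} {A : H →L[ℂ] H}
    (hA : IsCompactOperator A) {v : ι → H} (hv : Orthonormal ℂ v) {κ : ι → ℝ}
    (hκ : ∀ i, A (v i) = (κ i : ℂ) • v i) {ε : ℝ} (hε : 0 < ε) : {i | ε ≤ |κ i|}.Finite := by
  by_contra hinf
  have hinf : {i | ε ≤ |κ i|}.Infinite := hinf
  let s : ℕ → ι := fun n => (hinf.natEmbedding _ n : ι)
  have hs : ∀ n, ε ≤ |κ (s n)| := fun n => (hinf.natEmbedding _ n).2
  have hinj : Function.Injective s := fun a b h =>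
    (hinf.natEmbedding _).injective (Subtype.ext h)
  have hK := hA.isCompact_closure_image_closedBall (𝕜₁ := ℂ) 1
  have hmem : ∀ n, A (v (s n)) ∈ closure (A '' Metric.closedBall 0 1) := fun n =>
    subset_closure ⟨v (s n), by simp [hv.1], rfl⟩
  obtain ⟨a, -, φ, hφ, ha⟩ := hK.tendsto_subseq hmem
  have hc := ha.cauchySeq
  rw [Metric.cauchySeq_iff] at hc
  obtain ⟨N, hN⟩ := hc ε hε
  have h1 := hN N le_rfl (N + 1) (by omega)
  have hne : s (φ N) ≠ s (φ (N + 1)) := fun h => by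
    have := hφ.injective (hinj h)
    omega
  -- By orthogonality the images of distinct eigenvectors stay at distance at least ε, so no
  -- subsequence of them is Cauchy.
  have h2 : ‖A (v (s (φ N))) - A (v (s (φ (N + 1))))‖ ^ 2 =
      κ (s (φ N)) ^ 2 + κ (s (φ (N + 1))) ^ 2 := by
    rw [norm_sub_sq_of_orthogonal]
    · simp [hκ, norm_smul, hv.1]
    · rw [hκ, hκ, inner_smul_left, inner_smul_right, hv.2 hne]
      simp
  rw [Function.comp_apply, Function.comp_apply, dist_eq_norm] at h1
  have h3 : ε ^ 2 ≤ κ (s (φ N)) ^ 2 := by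
    rw [← sq_abs (κ _)]
    exact pow_le_pow_left₀ hε.le (hs _) 2
  have h4 := pow_lt_pow_left₀ h1 (norm_nonneg _) two_ne_zero
  nlinarith [sq_nonneg (κ (s (φ (N + 1))))]

/-- A compact symmetric operator has a Hilbert basis of eigenvectors. -/
theorem exists_hilbertBasis_of_isCompactOperator {H : Type u} [NormedAddCommGroup H]
    [InnerProductSpace ℂ H] [CompleteSpace H] {A : H →L[ℂ] H}
    (hA : IsCompactOperator A) (hs : A.IsSymmetric) :
    ∃ (ι : Type u) (b : HilbertBasis ι ℂ H) (κ : ι → ℝ), (∀ i, A (b i) = (κ i : ℂ) • b i) ∧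
      ∀ ε : ℝ, 0 < ε → {i | ε ≤ |κ i|}.Finite := by
  classical
  have key : ∃ (ι : Type u) (b : HilbertBasis ι ℂ H) (κ : ι → ℂ),
      ∀ i, A (b i) = κ i • b i := by
    have hcl : ∀ μ : ℂ, CompleteSpace (Module.End.eigenspace (A : Module.End ℂ H) μ) := fun μ => by
      have : IsClosed ((Module.End.eigenspace (A : Module.End ℂ H) μ : Submodule ℂ H) : Set H) := by
        have : ((Module.End.eigenspace (A : Module.End ℂ H) μ : Submodule ℂ H) : Set H) =
            {x | A x = μ • x} := by
          ext x; simp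
        rw [this]
        exact isClosed_eq A.continuous (continuous_const_smul μ)
      exact this.completeSpace_coe
    choose w b hb using fun μ : ℂ => exists_hilbertBasis ℂ
      (Module.End.eigenspace (A : Module.End ℂ H) μ)
    have hon := hs.orthogonalFamily_eigenspaces.orthonormal_sigma_orthonormal
      (fun μ => (b μ).orthonormal)
    refine ⟨_, HilbertBasis.mkOfOrthogonalEqBot hon ?_, fun i => i.1, fun i => ?_⟩
    -- The spectral theorem says that only 0 is orthogonal to all eigenspaces; orthogonality to the
    -- chosen bases is the same condition, by density of their spans.
    · rw [← ContinuousLinearMap.orthogonalComplement_iSup_eigenspaces_eq_bot hA hs,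
        ← Submodule.iInf_orthogonal]
      refine le_antisymm (le_iInf fun μ => ?_) ?_
      · intro x hx
        rw [Submodule.mem_orthogonal] at hx ⊢
        intro u hu
        have hd := (b μ).dense_span
        have h0 : (innerSL ℂ x ∘L (Module.End.eigenspace (A : Module.End ℂ H) μ).subtypeL) = 0 := by
          refine ContinuousLinearMap.ext_on (s := Set.range (b μ)) ?_ ?_
          · exact Submodule.dense_iff_topologicalClosure_eq_top.2 hd
          · rintro _ ⟨i, rfl⟩
            have := hx (b μ i : H) (Submodule.subset_span ⟨⟨μ, i⟩, rfl⟩)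
            simpa using inner_eq_zero_symm.1 this
        have := DFunLike.congr_fun h0 ⟨u, hu⟩
        exact inner_eq_zero_symm.1 (by simpa using this)
      · rw [Submodule.iInf_orthogonal]
        refine Submodule.orthogonal_le (Submodule.span_le.2 ?_)
        rintro _ ⟨i, rfl⟩
        exact Submodule.mem_iSup_of_mem i.1 (b i.1 i.2).2
    · rw [HilbertBasis.coe_mkOfOrthogonalEqBot]
      exact Module.End.mem_eigenspace_iff.1 (b i.1 i.2).2
  obtain ⟨ι, b, κ, hκ⟩ := key
  have hre : ∀ i, (((κ i).re : ℝ) : ℂ) = κ i := fun i => by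
    have h1 : Module.End.HasEigenvalue (A : Module.End ℂ H) (κ i) :=
      Module.End.hasEigenvalue_of_hasEigenvector (x := b i)
        ⟨Module.End.mem_eigenspace_iff.2 (hκ i), b.orthonormal.ne_zero i⟩
    exact Complex.conj_eq_iff_re.1 (hs.conj_eigenvalue_eq_self h1)
  have hA' : ∀ i, A (b i) = ((κ i).re : ℂ) • b i := fun i => by rw [hre, hκ]
  exact ⟨ι, b, fun i => (κ i).re, hA', fun ε hε =>
    finite_setOf_le_abs_of_isCompactOperator hA b.orthonormal hA' hε⟩

/-- The bounded operator which is diagonal in a given Hilbert basis, with given bounded entries. -/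
theorem exists_diagonal_operator {ι : Type*} (b : HilbertBasis ι ℂ H) {c : ι → ℂ} {C : ℝ}
    (hc : ∀ i, ‖c i‖ ≤ C) : ∃ S : H →L[ℂ] H, ∀ u i, ⟪b i, S u⟫ = c i * ⟪b i, u⟫ := by
  -- The bound forces 0 ≤ C only when there is at least one entry.
  by_cases hι : IsEmpty ι
  · exact ⟨0, fun u i => (hι.false i).elim⟩
  rw [not_isEmpty_iff] at hι
  have hC : 0 ≤ C := (norm_nonneg _).trans (hc hι.some)
  have hle : ∀ (x : ℂ) i, ‖c i * x‖ ^ 2 ≤ C ^ 2 * ‖x‖ ^ 2 := fun x i => by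
    rw [norm_mul, mul_pow]
    exact mul_le_mul_of_nonneg_right (pow_le_pow_left₀ (norm_nonneg _) (hc i) 2) (sq_nonneg _)
  have hsum : ∀ f : lp (fun _ : ι => ℂ) 2, Summable fun i => ‖f i‖ ^ 2 := fun f => by
    have := (lp.memℓp f).summable (by simp)
    simpa using this
  have hmem : ∀ f : lp (fun _ : ι => ℂ) 2, Memℓp (fun i => c i * f i) 2 := fun f => by
    rw [memℓp_gen_iff (by simp)]
    have : Summable fun i => ‖c i * f i‖ ^ 2 :=
      Summable.of_nonneg_of_le (fun i => sq_nonneg _) (fun i => hle _ i) ((hsum f).mul_left (C ^ 2))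
    simpa using this
  let M : lp (fun _ : ι => ℂ) 2 →ₗ[ℂ] lp (fun _ : ι => ℂ) 2 :=
    { toFun := fun f => ⟨fun i => c i * f i, hmem f⟩
      map_add' := fun f g => by
        ext i
        change c i * (f i + g i) = c i * f i + c i * g i
        ring
      map_smul' := fun a f => by
        ext i
        change c i * (a * f i) = a * (c i * f i)
        ring }
  have hn : ∀ f : lp (fun _ : ι => ℂ) 2, ‖f‖ ^ 2 = ∑' i, ‖f i‖ ^ 2 := fun f => by
    have := lp.norm_rpow_eq_tsum (p := 2) (by simp) f
    simpa using this
  let M' : lp (fun _ : ι => ℂ) 2 →L[ℂ] lp (fun _ : ι => ℂ) 2 := M.mkContinuous C fun f => by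
    refine (sq_le_sq₀ (norm_nonneg _) (by positivity)).1 ?_
    rw [mul_pow, hn, hn, ← tsum_mul_left]
    exact Summable.tsum_le_tsum (fun i => hle (f i) i) (hsum _) ((hsum f).mul_left _)
  refine ⟨b.repr.symm.toContinuousLinearEquiv.toContinuousLinearMap ∘L M' ∘L
    b.repr.toContinuousLinearEquiv.toContinuousLinearMap, fun u i => ?_⟩
  rw [← b.repr_apply_apply, ← b.repr_apply_apply]
  simp only [ContinuousLinearMap.comp_apply]
  change (b.repr (b.repr.symm (M' (b.repr u)))) i = _
  rw [LinearIsometryEquiv.apply_symm_apply]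
  rfl

end Spectral
end RadialTree

namespace RadialTree

/-! ### Spectrum, eigenspaces and min-max principle of a diagonalized operator -/

section Diagonal

variable {H : Type*} [NormedAddCommGroup H] [InnerProductSpace ℂ H] {ι : Type*}

local notation "⟪" x ", " y "⟫" => inner ℂ x y

/-- `T` is the maximal operator which is diagonal in the Hilbert basis `b`, with real
entries `μ`. -/
structure IsDiagonalizedBy (T : H →ₗ.[ℂ] H) (b : HilbertBasis ι ℂ H) (μ : ι → ℝ) : Prop where
  inner_apply : ∀ (f : T.domain) i, ⟪b i, T f⟫ = (μ i : ℂ) * ⟪b i, (f : H)⟫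
  mem_domain : ∀ f g : H, (∀ i, ⟪b i, g⟫ = (μ i : ℂ) * ⟪b i, f⟫) → f ∈ T.domain

theorem hilbertBasis_ext (b : HilbertBasis ι ℂ H) {f g : H} (h : ∀ i, ⟪b i, f⟫ = ⟪b i, g⟫) :
    f = g := by
  apply b.repr.injective
  ext i
  rw [b.repr_apply_apply, b.repr_apply_apply, h]

theorem hasSum_norm_inner_sq (b : HilbertBasis ι ℂ H) (f : H) :
    HasSum (fun i => ‖⟪b i, f⟫‖ ^ 2) (‖f‖ ^ 2) := by
  have h := b.hasSum_inner_mul_inner f f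
  rw [inner_self_eq_norm_sq_to_K] at h
  have h2 : ∀ i, ⟪f, b i⟫ * ⟪b i, f⟫ = ((‖⟪b i, f⟫‖ ^ 2 : ℝ) : ℂ) := fun i => by
    rw [← inner_conj_symm, Complex.conj_mul']
    push_cast
    rfl
  simp only [h2] at h
  exact Complex.hasSum_ofReal.1 (by simpa using h)

namespace IsDiagonalizedBy

variable {T : H →ₗ.[ℂ] H} {b : HilbertBasis ι ℂ H} {μ : ι → ℝ} (hT : IsDiagonalizedBy T b μ)

include hT

theorem apply_eq {f g : H} (h : ∀ i, ⟪b i, g⟫ = (μ i : ℂ) * ⟪b i, f⟫) :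
    ∃ hf : f ∈ T.domain, T ⟨f, hf⟩ = g :=
  ⟨hT.mem_domain f g h, hilbertBasis_ext b fun i => by rw [hT.inner_apply, h]⟩

theorem apply_basis (i : ι) : ∃ hi : b i ∈ T.domain, T ⟨b i, hi⟩ = (μ i : ℂ) • b i := by
  classical
  refine hT.apply_eq fun j => ?_
  rw [inner_smul_right, orthonormal_iff_ite.1 b.orthonormal]
  split_ifs with h
  · rw [h]
  · simp

theorem mem_resolventSet {z : ℂ} {δ : ℝ} (hδ : 0 < δ) (hz : ∀ i, δ ≤ ‖(μ i : ℂ) - z‖) :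
    z ∈ resolventSet T := by
  have hne : ∀ i, (μ i : ℂ) - z ≠ 0 := fun i => norm_pos_iff.1 (hδ.trans_le (hz i))
  obtain ⟨S, hS⟩ := exists_diagonal_operator b (c := fun i => ((μ i : ℂ) - z)⁻¹) (C := δ⁻¹)
    fun i => by
      rw [norm_inv]
      exact inv_anti₀ hδ (hz i)
  refine ⟨S, fun u => ?_, fun f => hilbertBasis_ext b fun i => ?_⟩
  -- Since μ(μ - z)⁻¹ = 1 + z(μ - z)⁻¹, the vector u + zSu has the coordinates that T(Su) must have,
  -- and maximality of the domain applies.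
  · obtain ⟨h, h'⟩ := hT.apply_eq (f := S u) (g := u + z • S u) fun i => by
      rw [inner_add_right, inner_smul_right, hS]
      have := hne i
      field_simp
      ring
    exact ⟨h, by rw [h']; simp⟩
  · rw [hS, inner_sub_right, inner_smul_right, hT.inner_apply]
    have := hne i
    field_simp

theorem exists_of_mem_resolventSet {z : ℂ} (hz : z ∈ resolventSet T) :
    ∃ δ : ℝ, 0 < δ ∧ ∀ i, δ ≤ ‖(μ i : ℂ) - z‖ := by
  obtain ⟨S, -, hS⟩ := hz
  -- Applying the inverse S to (T - z)bᵢ = (μᵢ - z)bᵢ gives 1 = |μᵢ - z|·‖S bᵢ‖ ≤ |μᵢ - z|·‖S‖; the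
  -- added 1 avoids a division by zero.
  refine ⟨(‖S‖ + 1)⁻¹, by positivity, fun i => ?_⟩
  obtain ⟨hi, h⟩ := hT.apply_basis i
  have h1 := hS ⟨b i, hi⟩
  rw [h, ← sub_smul, map_smul] at h1
  have h2 := congrArg norm h1
  rw [norm_smul, b.orthonormal.1] at h2
  have h3 := S.le_opNorm (b i)
  rw [b.orthonormal.1, mul_one] at h3
  rw [inv_le_iff_one_le_mul₀ (by positivity)]
  nlinarith [norm_nonneg ((μ i : ℂ) - z), norm_nonneg (S (b i))]

theorem mem_spectrum_iff {z : ℂ} :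
    z ∈ spectrum T ↔ ∀ δ : ℝ, 0 < δ → ∃ i, ‖(μ i : ℂ) - z‖ < δ := by
  rw [spectrum, Set.mem_compl_iff, iff_comm, ← not_iff_not, not_not]
  push Not
  exact ⟨fun ⟨δ, hδ, h⟩ => hT.mem_resolventSet hδ h, hT.exists_of_mem_resolventSet⟩

theorem mem_spectrum (i : ι) : (μ i : ℂ) ∈ spectrum T :=
  hT.mem_spectrum_iff.2 fun δ hδ => ⟨i, by simpa⟩

omit hT in
theorem mem_eigenspace_iff {z : ℂ} {f : T.domain} : f ∈ eigenspace T z ↔ T f = z • (f : H) := by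
  rw [eigenspace, LinearMap.mem_ker, LinearMap.sub_apply, sub_eq_zero]
  rfl

theorem mem_eigenspace_iff_inner {z : ℂ} {f : T.domain} :
    f ∈ eigenspace T z ↔ ∀ i, (μ i : ℂ) ≠ z → ⟪b i, (f : H)⟫ = 0 := by
  rw [mem_eigenspace_iff]
  constructor
  · intro h i hi
    have h1 := hT.inner_apply f i
    rw [h, inner_smul_right] at h1
    have h2 : ((μ i : ℂ) - z) * ⟪b i, (f : H)⟫ = 0 := by linear_combination -h1
    exact (mul_eq_zero.1 h2).resolve_left (sub_ne_zero.2 hi)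
  · intro h
    refine hilbertBasis_ext b fun i => ?_
    rw [hT.inner_apply, inner_smul_right]
    by_cases hi : (μ i : ℂ) = z
    · rw [hi]
    · rw [h i hi]
      simp

/-- A nonzero eigenvector belongs to one of the diagonal entries. -/
theorem exists_eq_of_apply_eq_smul {z : ℂ} {f : T.domain} (hf : (f : H) ≠ 0)
    (h : T f = z • (f : H)) : ∃ i, (μ i : ℂ) = z := by
  by_contra! hne
  refine hf (hilbertBasis_ext b fun i => ?_)
  rw [hT.mem_eigenspace_iff_inner.1 (mem_eigenspace_iff.2 h) i (hne i), inner_zero_right]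

/-- The coordinates of an eigenvector along the basis vectors with the same eigenvalue. -/
theorem nonempty_eigenspace_equiv {z : ℂ} (hfin : {i | (μ i : ℂ) = z}.Finite) :
    Nonempty (eigenspace T z ≃ₗ[ℂ] ({i | (μ i : ℂ) = z} → ℂ)) := by
  classical
  have := hfin.fintype
  let L : eigenspace T z →ₗ[ℂ] ({i | (μ i : ℂ) = z} → ℂ) :=
    { toFun := fun f i => ⟪b i, ((f : T.domain) : H)⟫
      map_add' := fun f g => by
        ext i
        simp
      map_smul' := fun c f => by
        ext i
        simp }
  refine ⟨LinearEquiv.ofBijective L ⟨?_, fun a => ?_⟩⟩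
  · intro f g hfg
    refine Subtype.ext (Subtype.ext (hilbertBasis_ext b fun i => ?_))
    by_cases hi : (μ i : ℂ) = z
    · exact congrFun hfg ⟨i, hi⟩
    · rw [hT.mem_eigenspace_iff_inner.1 f.2 i hi, hT.mem_eigenspace_iff_inner.1 g.2 i hi]
  · let f : H := ∑ i, a i • b i
    have hfi : ∀ j, ⟪b j, f⟫ = if h : (μ j : ℂ) = z then a ⟨j, h⟩ else 0 := fun j => by
      simp only [f, inner_sum, inner_smul_right, orthonormal_iff_ite.1 b.orthonormal]
      split_ifs with h
      · rw [Finset.sum_eq_single ⟨j, h⟩]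
        · simp
        · intro i _ hi
          rw [if_neg, mul_zero]
          exact fun h => hi (Subtype.ext h.symm)
        · simp
      · refine Finset.sum_eq_zero fun i _ => ?_
        rw [if_neg, mul_zero]
        rintro rfl
        exact h i.2
    obtain ⟨h1, h2⟩ := hT.apply_eq (f := f) (g := z • f) fun i => by
      rw [inner_smul_right, hfi]
      split_ifs with h
      · rw [h]
      · simp
    refine ⟨⟨⟨f, h1⟩, mem_eigenspace_iff.2 h2⟩, ?_⟩
    ext i
    change ⟪b i, f⟫ = _
    exact (hfi i).trans (dif_pos i.2)

theorem toENat_rank_eigenspace {z : ℂ} (hfin : {i | (μ i : ℂ) = z}.Finite) :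
    Cardinal.toENat (Module.rank ℂ (eigenspace T z)) = {i | (μ i : ℂ) = z}.encard := by
  have := hfin.fintype
  obtain ⟨e⟩ := hT.nonempty_eigenspace_equiv hfin
  have := e.symm.finiteDimensional
  rw [← Module.finrank_eq_rank, e.finrank_eq, Module.finrank_fintype_fun_eq_card,
    Set.encard_eq_coe_toFinset_card]
  simp

theorem finiteDimensional_eigenspace {z : ℂ} (hfin : {i | (μ i : ℂ) = z}.Finite) :
    FiniteDimensional ℂ (eigenspace T z) := by
  have := hfin.fintype
  obtain ⟨e⟩ := hT.nonempty_eigenspace_equiv hfin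
  exact e.symm.finiteDimensional

/-- A point of the spectrum near which there are only finitely many diagonal entries is one of
these entries. -/
theorem exists_eq_of_mem_spectrum {z : ℂ} (hz : z ∈ spectrum T) {r : ℝ} (hr : 0 < r)
    (hfin : {i | ‖(μ i : ℂ) - z‖ < r}.Finite) : ∃ i, (μ i : ℂ) = z := by
  by_contra! hne
  rw [hT.mem_spectrum_iff] at hz
  obtain ⟨i₀, hi₀⟩ := hz r hr
  -- The nearest of the finitely many entries would be at positive distance from z, contradicting
  -- that z is a limit of entries.
  obtain ⟨i, hir, hi⟩ := Set.exists_min_image _ (fun i => ‖(μ i : ℂ) - z‖) hfin ⟨i₀, hi₀⟩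
  obtain ⟨j, hj⟩ := hz ‖(μ i : ℂ) - z‖ (norm_pos_iff.2 (sub_ne_zero.2 (hne i)))
  exact hj.not_ge (hi j (hj.trans hir))

/-- The finiteness counts indices, not values, so it controls both isolation and multiplicity:
nearby spectral points are among finitely many entries, and only finitely many of these equal z. -/
theorem mem_discreteSpectrum {z : ℂ} (hz : z ∈ spectrum T) {r : ℝ} (hr : 0 < r)
    (hfin : {i | ‖(μ i : ℂ) - z‖ < r}.Finite) : z ∈ discreteSpectrum T := by
  obtain ⟨i, hi⟩ := hT.exists_eq_of_mem_spectrum hz hr hfin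
  refine ⟨hz, ?_, ?_, hT.finiteDimensional_eigenspace (hfin.subset fun i hi => ?_)⟩
  · have hfin' : ((fun i => (μ i : ℂ)) '' {i | ‖(μ i : ℂ) - z‖ < r} \ {z}).Finite :=
      (hfin.image _).subset Set.sdiff_subset
    have h1 : ∀ᶠ w in 𝓝 z, w ∉ (fun i => (μ i : ℂ)) '' {i | ‖(μ i : ℂ) - z‖ < r} \ {z} :=
      hfin'.isClosed.isOpen_compl.mem_nhds (by simp)
    have h2 : ∀ᶠ w in 𝓝 z, ‖w - z‖ < r / 2 := by
      filter_upwards [Metric.ball_mem_nhds z (half_pos hr)] with w hw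
      rwa [Metric.mem_ball, dist_eq_norm] at hw
    filter_upwards [nhdsWithin_le_nhds h1, nhdsWithin_le_nhds h2, self_mem_nhdsWithin]
      with w hw1 hw2 hw3 hw4
    -- The halved radius transfers the finiteness from z to the nearby point w, so w is itself an
    -- entry.
    have hsub : ∀ i, ‖(μ i : ℂ) - w‖ < r / 2 → ‖(μ i : ℂ) - z‖ < r := fun i hi => by
      have := norm_add_le ((μ i : ℂ) - w) (w - z)
      rw [sub_add_sub_cancel] at this
      linarith
    obtain ⟨j, hj⟩ := hT.exists_eq_of_mem_spectrum hw4 (half_pos hr)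
      (hfin.subset fun i hi => hsub i hi)
    refine hw1 ⟨⟨j, hsub j ?_, hj⟩, hw3⟩
    rw [hj]
    simpa using half_pos hr
  · obtain ⟨h1, h2⟩ := hT.apply_basis i
    intro hbot
    have h3 : (⟨b i, h1⟩ : T.domain) ∈ eigenspace T z := mem_eigenspace_iff.2 (by rw [h2, hi])
    rw [hbot, Submodule.mem_bot] at h3
    exact b.orthonormal.ne_zero i (congrArg Subtype.val h3)
  · change ‖(μ i : ℂ) - z‖ < r
    rw [Set.mem_ofPred_eq] at hi
    rw [hi]
    simpa

theorem hasSum_inner_apply (f : T.domain) :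
    HasSum (fun i => μ i * ‖⟪b i, (f : H)⟫‖ ^ 2) (⟪(f : H), T f⟫).re := by
  have h := b.hasSum_inner_mul_inner (f : H) (T f)
  have h2 : ∀ i, (⟪(f : H), b i⟫ * ⟪b i, T f⟫).re = μ i * ‖⟪b i, (f : H)⟫‖ ^ 2 := fun i => by
    rw [hT.inner_apply, mul_left_comm, ← inner_conj_symm, Complex.conj_mul', ← Complex.ofReal_pow,
      ← Complex.ofReal_mul, Complex.ofReal_re]
  simpa only [h2] using Complex.hasSum_re h

/-- Upper bound in the min-max principle: if the form of `T` is at most `c` on a space of dimension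
more than the cardinality of `F`, then some diagonal entry outside of `F` is at most `c`. -/
theorem exists_notMem_le {W : Type*} [AddCommGroup W] [Module ℂ W] (Φ : W →ₗ[ℂ] H)
    (hΦ : Function.Injective Φ) (F : Finset ι) (hF : F.card < Module.finrank ℂ W) {c : ℝ}
    (hc : ∀ w, ∃ h : Φ w ∈ T.domain, (⟪Φ w, T ⟨Φ w, h⟩⟫).re ≤ c * ‖Φ w‖ ^ 2) :
    ∃ i ∉ F, μ i ≤ c := by
  by_contra! hlt
  have : FiniteDimensional ℂ W := FiniteDimensional.of_finrank_pos (by omega)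
  let L : W →ₗ[ℂ] (F → ℂ) := LinearMap.pi fun i => (innerₛₗ ℂ (b i)).comp Φ
  -- The orthogonality conditions indexed by F are fewer than the dimension of W.
  have hker : L.ker ≠ ⊥ := by
    apply LinearMap.ker_ne_bot_of_finrank_lt
    simpa using hF
  obtain ⟨w, hw, hw0⟩ := Submodule.exists_mem_ne_zero_of_ne_bot hker
  have hwi : ∀ i ∈ F, ⟪b i, Φ w⟫ = 0 := fun i hi => congrFun (LinearMap.mem_ker.1 hw) ⟨i, hi⟩
  obtain ⟨hd, hle⟩ := hc w
  have h1 := (hT.hasSum_inner_apply ⟨Φ w, hd⟩).sub ((hasSum_norm_inner_sq b (Φ w)).mul_left c)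
  have h2 : ∀ i, 0 ≤ μ i * ‖⟪b i, Φ w⟫‖ ^ 2 - c * ‖⟪b i, Φ w⟫‖ ^ 2 := fun i => by
    rw [← sub_mul]
    by_cases hi : i ∈ F
    · rw [hwi i hi]
      simp
    · exact mul_nonneg (sub_nonneg.2 (hlt i hi).le) (sq_nonneg _)
  -- The sum of (μᵢ - c)|⟨bᵢ, Φw⟩|² has non-negative terms and a non-positive total, so each term is
  -- zero; as μᵢ > c off F, all coordinates vanish.
  have h3 := le_antisymm (sub_nonpos.2 hle) (h1.nonneg h2)
  rw [h3] at h1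
  have h4 := (hasSum_zero_iff_of_nonneg h2).1 h1
  refine hw0 (hΦ ?_)
  rw [map_zero]
  refine hilbertBasis_ext b fun i => ?_
  rw [inner_zero_right]
  by_cases hi : i ∈ F
  · exact hwi i hi
  · have h5 := congrFun h4 i
    simp only [Pi.zero_apply] at h5
    rw [← sub_mul] at h5
    have := (mul_eq_zero.1 h5).resolve_left (sub_pos.2 (hlt i hi)).ne'
    simpa using this

/-- Lower bound in the min-max principle: if the form of `T` is at least `c` on the kernel of a
map `L` to a space of dimension less than the cardinality of `F`, then some diagonal entry indexed
by `F` is at least `c`. -/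
theorem exists_mem_ge {W : Type*} [AddCommGroup W] [Module ℂ W] [FiniteDimensional ℂ W]
    (L : H →ₗ[ℂ] W) (F : Finset ι) (hF : Module.finrank ℂ W < F.card) {c : ℝ}
    (hc : ∀ f : T.domain, L f = 0 → c * ‖(f : H)‖ ^ 2 ≤ (⟪(f : H), T f⟫).re) :
    ∃ i ∈ F, c ≤ μ i := by
  classical
  by_contra! hlt
  -- Dual count: the span of the basis vectors indexed by F is too large for L to be injective on
  -- it.
  let Ψ : (F → ℂ) →ₗ[ℂ] H := Fintype.linearCombination ℂ (fun i : F => b i)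
  have hker : (L.comp Ψ).ker ≠ ⊥ := by
    apply LinearMap.ker_ne_bot_of_finrank_lt
    simpa using hF
  obtain ⟨a, ha, ha0⟩ := Submodule.exists_mem_ne_zero_of_ne_bot hker
  have hin : ∀ j, ⟪b j, Ψ a⟫ = if h : j ∈ F then a ⟨j, h⟩ else 0 := fun j => by
    simp only [Ψ, Fintype.linearCombination_apply, inner_sum, inner_smul_right,
      orthonormal_iff_ite.1 b.orthonormal]
    split_ifs with h
    · rw [Finset.sum_eq_single ⟨j, h⟩]
      · simp
      · intro i _ hi
        rw [if_neg, mul_zero]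
        exact fun h => hi (Subtype.ext h.symm)
      · simp
    · refine Finset.sum_eq_zero fun i _ => ?_
      rw [if_neg, mul_zero]
      rintro rfl
      exact h i.2
  have hd : Ψ a ∈ T.domain := by
    simp only [Ψ, Fintype.linearCombination_apply]
    exact Submodule.sum_mem _ fun i _ => Submodule.smul_mem _ _ (hT.apply_basis i).1
  have hle := hc ⟨Ψ a, hd⟩ ha
  have h1 := ((hasSum_norm_inner_sq b (Ψ a)).mul_left c).sub (hT.hasSum_inner_apply ⟨Ψ a, hd⟩)
  have h2 : ∀ i, 0 ≤ c * ‖⟪b i, Ψ a⟫‖ ^ 2 - μ i * ‖⟪b i, Ψ a⟫‖ ^ 2 := fun i => by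
    rw [← sub_mul]
    by_cases hi : i ∈ F
    · exact mul_nonneg (sub_nonneg.2 (hlt i hi).le) (sq_nonneg _)
    · rw [hin, dif_neg hi]
      simp
  have h3 := le_antisymm (sub_nonpos.2 hle) (h1.nonneg h2)
  rw [h3] at h1
  have h4 := (hasSum_zero_iff_of_nonneg h2).1 h1
  refine ha0 (funext fun i => ?_)
  have h5 := congrFun h4 i
  simp only [Pi.zero_apply] at h5
  rw [← sub_mul] at h5
  have h6 := (mul_eq_zero.1 h5).resolve_left (sub_pos.2 (hlt i i.2)).ne'
  rw [hin, dif_pos i.2] at h6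
  simpa using h6

end IsDiagonalizedBy

end Diagonal
end RadialTree

namespace RadialTree

/-! ### Monotone enumeration of a family of real numbers with repetitions -/

section Enumeration

/-- An infinite linear order with finite initial segments is isomorphic to `ℕ`. -/
theorem nonempty_orderIso_nat {α : Type*} [LinearOrder α] [Infinite α]
    (h : ∀ a : α, (Set.Iic a).Finite) : Nonempty (α ≃o ℕ) := by
  let : LocallyFiniteOrder α :=
    LocallyFiniteOrder.ofFiniteIcc fun a b => (h b).subset Set.Icc_subset_Iic_self
  let : SuccOrder α := LinearLocallyFiniteOrder.succOrder α
  let : PredOrder α := LinearLocallyFiniteOrder.predOrder α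
  obtain ⟨a⟩ : Nonempty α := inferInstance
  obtain ⟨m, hm, hmin⟩ := Set.exists_min_image _ id (h a) ⟨a, le_rfl⟩
  let : OrderBot α :=
    { bot := m
      bot_le := fun x => (le_total x a).elim (hmin x) fun hx => (hmin a le_rfl).trans hx }
  have : NoMaxOrder α := ⟨fun x => by
    by_contra! hx
    exact Set.infinite_univ ((h x).subset fun y _ => hx y)⟩
  exact ⟨orderIsoNatOfLinearSuccPredArch⟩

/-- Indices rather than values are ordered, so that multiplicities survive. Ties are broken by an
injection into the cardinals, which makes the lexicographic order linear; its initial segments are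
finite, hence it has the order type of ℕ. -/
theorem exists_monotone_enumeration {ι : Type*} {μ : ι → ℝ} {S : Set ι} (hS : S.Infinite)
    (hfin : ∀ i ∈ S, {j | j ∈ S ∧ μ j ≤ μ i}.Finite) :
    ∃ e : ℕ ≃ S, Monotone fun n => μ (e n) := by
  have : Infinite S := hS.to_subtype
  let : LinearOrder S := LinearOrder.lift' 
    (fun i : S => toLex (μ i, embeddingToCardinal i)) fun i j h =>
      embeddingToCardinal.injective (congrArg (fun p => (ofLex p).2) h)
  have hle : ∀ i j : S, i ≤ j → μ i ≤ μ j := fun i j h => by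
    have h' : toLex (μ i, embeddingToCardinal i) ≤ toLex (μ j, embeddingToCardinal j) := h
    rw [Prod.Lex.toLex_le_toLex] at h'
    exact h'.elim le_of_lt fun h => h.1.le
  obtain ⟨e⟩ := nonempty_orderIso_nat (α := S) fun i =>
    Set.Finite.of_finite_image ((hfin i i.2).subset (by
      rintro _ ⟨j, hj, rfl⟩
      exact ⟨j.2, hle _ _ hj⟩)) Subtype.val_injective.injOn
  exact ⟨e.symm.toEquiv, fun m n hmn => hle _ _ (e.symm.monotone hmn)⟩

end Enumeration

/-! ### Diagonalization from the resolvent, and eigenvalue lists -/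

section Diagonal

variable {H : Type*} [NormedAddCommGroup H] [InnerProductSpace ℂ H] {ι : Type*}

local notation "⟪" x ", " y "⟫" => inner ℂ x y

namespace IsDiagonalizedBy

variable {T : H →ₗ.[ℂ] H} {b : HilbertBasis ι ℂ H} {μ : ι → ℝ}

/-- An operator is diagonal as soon as its resolvent at `-1` is. -/
theorem of_inverse {R : H →L[ℂ] H} (hR : R.IsSymmetric)
    (h1 : ∀ u, ∃ h : R u ∈ T.domain, T ⟨R u, h⟩ + R u = u)
    (h2 : ∀ f : T.domain, R (T f + f) = f) {ρ : ι → ℝ} (hb : ∀ i, R (b i) = (ρ i : ℂ) • b i) :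
    (∀ i, ρ i ≠ 0) ∧ IsDiagonalizedBy T b fun i => (ρ i)⁻¹ - 1 := by
  -- A zero entry would give R bᵢ = 0 and then bᵢ = T0 + 0 = 0.
  have hρ : ∀ i, ρ i ≠ 0 := fun i hi => by
    obtain ⟨hd, h⟩ := h1 (b i)
    have h0 : R (b i) = 0 := by rw [hb, hi]; simp
    have h3 : (⟨R (b i), hd⟩ : T.domain) = 0 := Subtype.ext h0
    rw [h3, T.map_zero, h0, add_zero] at h
    exact b.orthonormal.ne_zero i h.symm
  have hin : ∀ i g, ⟪b i, R g⟫ = ρ i * ⟪b i, g⟫ := fun i g => by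
    have := hR (b i) g
    simp only [ContinuousLinearMap.coe_coe] at this
    rw [← this, hb, inner_smul_left, Complex.conj_ofReal]
  refine ⟨hρ, fun f i => ?_, fun f g h => ?_⟩
  · have h3 := hin i (T f + f)
    rw [h2, inner_add_right] at h3
    have : (ρ i : ℂ) ≠ 0 := Complex.ofReal_ne_zero.2 (hρ i)
    push_cast
    field_simp
    linear_combination -h3
  -- Maximality of the domain: f is exhibited in the range of R, which lies in the domain.
  · have h3 : R (g + f) = f := hilbertBasis_ext b fun i => by
      rw [hin, inner_add_right, h]
      have : (ρ i : ℂ) ≠ 0 := Complex.ofReal_ne_zero.2 (hρ i)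
      push_cast
      field_simp
      ring
    rw [← h3]
    exact (h1 _).1

theorem exists_isEigenvalueList (hT : IsDiagonalizedBy T b μ)
    (hfin : ∀ c : ℝ, (c : EReal) < infEssSpectrum T → {i | μ i ≤ c}.Finite)
    (hinf : {i | (μ i : EReal) < infEssSpectrum T}.Infinite) :
    ∃ e : ℕ ≃ {i | (μ i : EReal) < infEssSpectrum T},
      IsEigenvalueList T fun n => μ (e n) := by
  obtain ⟨e, he⟩ := exists_monotone_enumeration hinf fun i hi =>
    (hfin (μ i) hi).subset fun j hj => hj.2
  refine ⟨e, he, fun i => (e i).2, fun x hx => ?_⟩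
  have hset : {i | (μ i : ℂ) = (x : ℂ)} = {i | μ i = x} := by
    ext i
    exact Complex.ofReal_inj
  rw [hT.toENat_rank_eigenspace, hset]
  -- Every index with entry x is enumerated, since x is below the essential spectrum; thus positions
  -- and indices are equally many.
  · have hinj : Function.Injective fun n => (e n : ι) := Subtype.val_injective.comp e.injective
    rw [← hinj.encard_image]
    congr 1
    ext i
    constructor
    · rintro ⟨n, hn, rfl⟩
      exact hn
    · intro hi
      have hi' : μ i = x := hi
      refine ⟨e.symm ⟨i, ?_⟩, ?_, ?_⟩
      · change (μ i : EReal) < _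
        rwa [hi']
      · simpa using hi'
      · simp
  · rw [hset]
    exact (hfin x hx).subset fun i hi => le_of_eq hi

variable {s : EReal} {e : ℕ ≃ {i | (μ i : EReal) < s}}

theorem finite_setOf_enumeration_le {c : ℝ} (hfin : {i | μ i ≤ c}.Finite) :
    {n | μ (e n) ≤ c}.Finite :=
  Set.Finite.preimage (f := fun n => (e n : ι))
    (Subtype.val_injective.comp e.injective).injOn hfin

theorem eventually_lt_enumeration {c : ℝ} (hfin : {i | μ i ≤ c}.Finite) :
    ∀ᶠ n in atTop, c < μ (e n) := by
  rw [← Nat.cofinite_eq_atTop]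
  filter_upwards [(finite_setOf_enumeration_le (e := e) hfin).compl_mem_cofinite] with n hn
  exact not_le.1 hn

/-- Apply the min-max bound with the first k indices excluded. The entry found is below s, so it is
enumerated, necessarily at a position at least k. Positions start at zero, so position k carries the
(k+1)-st eigenvalue. -/
theorem enumeration_le (hT : IsDiagonalizedBy T b μ) (he : Monotone fun n => μ (e n))
    {W : Type*} [AddCommGroup W] [Module ℂ W] (Φ : W →ₗ[ℂ] H) (hΦ : Function.Injective Φ)
    {k : ℕ} (hk : k < Module.finrank ℂ W) {c : ℝ} (hcs : (c : EReal) < s)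
    (hc : ∀ w, ∃ h : Φ w ∈ T.domain, (⟪Φ w, T ⟨Φ w, h⟩⟫).re ≤ c * ‖Φ w‖ ^ 2) :
    μ (e k) ≤ c := by
  classical
  obtain ⟨i, hi, hic⟩ := hT.exists_notMem_le Φ hΦ
    ((Finset.range k).image fun n => (e n : ι))
    (lt_of_le_of_lt Finset.card_image_le (by simpa using hk)) hc
  have his : (μ i : EReal) < s := lt_of_le_of_lt (by exact_mod_cast hic) hcs
  obtain ⟨n, hn⟩ := e.surjective ⟨i, his⟩
  have hn' : (e n : ι) = i := congrArg Subtype.val hn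
  have hkn : k ≤ n := by
    by_contra! hlt
    exact hi (Finset.mem_image.2 ⟨n, Finset.mem_range.2 hlt, hn'⟩)
  refine (he hkn).trans ?_
  simpa only [hn'] using hic

/-- At most k linear constraints cannot eliminate the span of the first k + 1 basis vectors, so one
of their entries is at least c, and the one at position k is the largest of them. -/
theorem le_enumeration (hT : IsDiagonalizedBy T b μ) (he : Monotone fun n => μ (e n))
    {W : Type*} [AddCommGroup W] [Module ℂ W] [FiniteDimensional ℂ W] (L : H →ₗ[ℂ] W)
    {k : ℕ} (hk : Module.finrank ℂ W ≤ k) {c : ℝ}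
    (hc : ∀ f : T.domain, L f = 0 → c * ‖(f : H)‖ ^ 2 ≤ (⟪(f : H), T f⟫).re) :
    c ≤ μ (e k) := by
  classical
  have hinj : Function.Injective fun n => (e n : ι) := Subtype.val_injective.comp e.injective
  obtain ⟨i, hi, hci⟩ := hT.exists_mem_ge L ((Finset.range (k + 1)).image fun n => (e n : ι))
    (by rw [Finset.card_image_of_injective _ hinj, Finset.card_range]; omega) hc
  obtain ⟨n, hn, rfl⟩ := Finset.mem_image.1 hi
  exact hci.trans (he (Nat.lt_succ_iff.1 (Finset.mem_range.1 hn)))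

/-- There are infinitely many diagonal entries below `s` if there are test spaces of arbitrarily
large dimension on which the form of `T` is below `s`. -/
theorem infinite_setOf_lt (hT : IsDiagonalizedBy T b μ)
    (h : ∀ k : ℕ, ∃ (W : Type u) (_ : AddCommGroup W) (_ : Module ℂ W) (Φ : W →ₗ[ℂ] H) (c : ℝ),
      k < Module.finrank ℂ W ∧ Function.Injective Φ ∧ (c : EReal) < s ∧
      ∀ w, ∃ h : Φ w ∈ T.domain, (⟪Φ w, T ⟨Φ w, h⟩⟫).re ≤ c * ‖Φ w‖ ^ 2) :
    {i | (μ i : EReal) < s}.Infinite := by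
  intro hfin
  obtain ⟨W, _, _, Φ, c, hn, hΦ, hcs, hc⟩ := h hfin.toFinset.card
  obtain ⟨i, hi, hic⟩ := hT.exists_notMem_le Φ hΦ hfin.toFinset hn hc
  refine hi (hfin.mem_toFinset.2 ?_)
  exact lt_of_le_of_lt (by exact_mod_cast hic) hcs

end IsDiagonalizedBy

end Diagonal
end RadialTree

namespace RadialTree

/-! ### The Hilbert space ℓ²(V, m): evaluation, truncation, completeness -/

section WeightedL2

variable {V : Type*} {m : V → {r : ℝ // 0 < r}}

local notation "⟪" x ", " y "⟫" => inner ℂ x y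

theorem inner_eq_tsum (f g : L2 m) : ⟪f, g⟫ = ∑' x, ((m x : ℝ) : ℂ) * (conj (f x) * g x) := rfl

theorem hasSum_inner (f g : L2 m) :
    HasSum (fun x => ((m x : ℝ) : ℂ) * (conj (f x) * g x)) ⟪f, g⟫ :=
  (summable_inner f g).hasSum

theorem hasSum_norm_sq (f : L2 m) : HasSum (fun x => (m x : ℝ) * ‖f x‖ ^ 2) (‖f‖ ^ 2) := by
  have h1 : ((‖f‖ ^ 2 : ℝ) : ℂ) = ((∑' x, (m x : ℝ) * ‖f x‖ ^ 2 : ℝ) : ℂ) := by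
    rw [← inner_self_eq f, ← inner_eq_tsum, inner_self_eq_norm_sq_to_K]
    simp
  rw [Complex.ofReal_inj.1 h1]
  exact Summable.hasSum f.2

@[ext] theorem L2.ext {f g : L2 m} (h : ∀ x, f x = g x) : f = g := Subtype.ext (funext h)

/-- The square of the norm of `ℓ²(V, m)`, for all functions. -/
noncomputable def normSq (m : V → {r : ℝ // 0 < r}) (f : V → ℂ) : ℝ≥0∞ :=
  ∑' x, ENNReal.ofReal (m x) * ‖f x‖ₑ ^ 2

theorem ofReal_mul_norm_sq (r : ℝ) (hr : 0 ≤ r) (z : ℂ) :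
    ENNReal.ofReal (r * ‖z‖ ^ 2) = ENNReal.ofReal r * ‖z‖ₑ ^ 2 := by
  rw [ENNReal.ofReal_mul hr, ENNReal.ofReal_pow (norm_nonneg _), ofReal_norm]

theorem normSq_eq_tsum_ofReal (f : V → ℂ) :
    normSq m f = ∑' x, ENNReal.ofReal ((m x : ℝ) * ‖f x‖ ^ 2) :=
  tsum_congr fun x => (ofReal_mul_norm_sq _ (m x).2.le _).symm

theorem normSq_coe (f : L2 m) : normSq m f = ENNReal.ofReal (‖f‖ ^ 2) := by
  rw [normSq_eq_tsum_ofReal, ← (hasSum_norm_sq f).tsum_eq, ENNReal.ofReal_tsum_of_nonneg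
    (fun x => mul_nonneg (m x).2.le (sq_nonneg _)) (hasSum_norm_sq f).summable]

theorem mem_l2Submodule_iff {f : V → ℂ} : f ∈ l2Submodule m ↔ normSq m f ≠ ∞ := by
  rw [normSq_eq_tsum_ofReal]
  constructor
  · intro h
    rw [← ENNReal.ofReal_tsum_of_nonneg
      (fun x => mul_nonneg (m x).2.le (sq_nonneg _)) h]
    exact ENNReal.ofReal_ne_top
  · intro h
    have := ENNReal.summable_toReal h
    refine this.congr fun x => ?_
    rw [ENNReal.toReal_ofReal (mul_nonneg (m x).2.le (sq_nonneg _))]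

theorem mul_norm_apply_sq_le (f : L2 m) (x : V) : (m x : ℝ) * ‖f x‖ ^ 2 ≤ ‖f‖ ^ 2 :=
  le_hasSum (hasSum_norm_sq f) x fun y _ => mul_nonneg (m y).2.le (sq_nonneg _)

/-- Evaluation at a vertex. -/
noncomputable def evalCLM (m : V → {r : ℝ // 0 < r}) (x : V) : L2 m →L[ℂ] ℂ :=
  LinearMap.mkContinuous
    { toFun := fun f => f x
      map_add' := fun _ _ => rfl
      map_smul' := fun _ _ => rfl } (√(m x : ℝ))⁻¹ fun f => by
    have h := mul_norm_apply_sq_le f x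
    have hm : 0 < √(m x : ℝ) := Real.sqrt_pos.2 (m x).2
    change ‖f x‖ ≤ _
    rw [← div_eq_inv_mul, le_div_iff₀ hm, ← sq_le_sq₀ (by positivity) (norm_nonneg _), mul_pow,
      Real.sq_sqrt (m x).2.le, mul_comm]
    exact h

@[simp] theorem evalCLM_apply (f : L2 m) (x : V) : evalCLM m x f = f x := rfl

theorem continuous_eval (x : V) : Continuous fun f : L2 m => f x := (evalCLM m x).continuous

theorem mem_l2Submodule_of_finite {f : V → ℂ} (hf : (Function.support f).Finite) :
    f ∈ l2Submodule m :=
  summable_of_hasFiniteSupport (hf.subset fun x hx => by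
    intro h
    exact hx (by simp [h]))

/-- A finitely supported function as an element of `ℓ²(V, m)`. -/
noncomputable def finL2 (m : V → {r : ℝ // 0 < r}) (f : V → ℂ) (hf : (Function.support f).Finite) :
    L2 m := ⟨f, mem_l2Submodule_of_finite hf⟩

@[simp] theorem finL2_apply (f : V → ℂ) (hf : (Function.support f).Finite) (x : V) :
    finL2 m f hf x = f x := rfl

open Classical in
/-- The indicator function of a vertex. -/
noncomputable def delta (m : V → {r : ℝ // 0 < r}) (x : V) : L2 m :=
  finL2 m (Pi.single x 1) ((Set.finite_singleton x).subset Pi.support_single_subset)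

open Classical in
theorem delta_apply (x y : V) : delta m x y = if y = x then 1 else 0 := by
  rw [delta, finL2_apply, Pi.single_apply]

/-- The truncation of a function to a finite set. -/
noncomputable def truncCLM (m : V → {r : ℝ // 0 < r}) (F : Finset V) : L2 m →L[ℂ] L2 m :=
  ∑ x ∈ F, (evalCLM m x).smulRight (delta m x)

theorem sum_apply {ι : Type*} (F : Finset ι) (f : ι → L2 m) (y : V) :
    (∑ i ∈ F, f i) y = ∑ i ∈ F, f i y := map_sum (evalCLM m y) f F

open Classical in
theorem truncCLM_apply (F : Finset V) (f : L2 m) (y : V) :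
    truncCLM m F f y = if y ∈ F then f y else 0 := by
  rw [truncCLM, _root_.sum_apply, sum_apply]
  simp [delta_apply]

theorem support_truncCLM_finite (F : Finset V) (f : L2 m) :
    (Function.support (truncCLM m F f)).Finite :=
  F.finite_toSet.subset fun y hy => by
    classical
    by_contra h
    exact hy ((truncCLM_apply F f y).trans (if_neg h))

theorem isCompactOperator_truncCLM (F : Finset V) : IsCompactOperator (truncCLM m F) := by
  refine (compactOperator (RingHom.id ℂ) (L2 m) (L2 m)).sum_mem fun x _ => ?_
  have h1 : IsCompactOperator (id : ℂ → ℂ) :=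
    (isCompactOperator_id_iff_finiteDimensional (𝕜 := ℂ)).2 inferInstance
  exact (h1.comp_clm (evalCLM m x)).clm_comp (ContinuousLinearMap.toSpanSingleton ℂ (delta m x))

open Classical in
theorem sub_truncCLM_apply (F : Finset V) (f : L2 m) (x : V) :
    (f - truncCLM m F f) x = if x ∈ F then 0 else f x := by
  rw [sub_apply, truncCLM_apply]
  split_ifs <;> simp

open Classical in
theorem ofReal_norm_sub_truncCLM_sq (F : Finset V) (f : L2 m) :
    ENNReal.ofReal (‖f - truncCLM m F f‖ ^ 2) =
      ∑' x, if x ∈ F then 0 else ENNReal.ofReal (m x) * ‖f x‖ₑ ^ 2 := by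
  rw [← normSq_coe, normSq]
  refine tsum_congr fun x => ?_
  rw [sub_truncCLM_apply]
  split_ifs <;> simp

theorem norm_sub_truncCLM_sq (F : Finset V) (f : L2 m) :
    ‖f - truncCLM m F f‖ ^ 2 = ‖f‖ ^ 2 - ∑ x ∈ F, (m x : ℝ) * ‖f x‖ ^ 2 := by
  classical
  have h1 := hasSum_norm_sq (f - truncCLM m F f)
  have h2 := (hasSum_norm_sq f).sub (hasSum_sum_of_ne_finset_zero
    (f := fun x => if x ∈ F then (m x : ℝ) * ‖f x‖ ^ 2 else 0) (s := F) fun x hx => if_neg hx)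
  rw [Finset.sum_congr rfl fun x hx => if_pos hx] at h2
  refine h1.unique (h2.congr_fun fun x => ?_)
  rw [sub_truncCLM_apply]
  split_ifs <;> simp

theorem tendsto_truncCLM (f : L2 m) : Tendsto (fun F => truncCLM m F f) atTop (𝓝 f) := by
  rw [tendsto_iff_norm_sub_tendsto_zero]
  have h1 : Tendsto (fun F : Finset V => ‖f‖ ^ 2 - ∑ x ∈ F, (m x : ℝ) * ‖f x‖ ^ 2) atTop (𝓝 0) := by
    have : Tendsto (fun F : Finset V => ∑ x ∈ F, (m x : ℝ) * ‖f x‖ ^ 2) atTop (𝓝 (‖f‖ ^ 2)) :=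
      hasSum_norm_sq f
    have h0 := this.const_sub (‖f‖ ^ 2)
    rwa [sub_self] at h0
  have h2 : ∀ F, ‖truncCLM m F f - f‖ = √(‖f‖ ^ 2 - ∑ x ∈ F, (m x : ℝ) * ‖f x‖ ^ 2) := fun F => by
    rw [← norm_sub_truncCLM_sq, Real.sqrt_sq (norm_nonneg _), norm_sub_rev]
  simp only [h2]
  simpa using h1.sqrt

/-- Multiplication by √m is an isometry onto the unweighted space `lp`, which is complete. -/
instance : CompleteSpace (L2 m) := by
  have hs : ∀ x, √(m x : ℝ) ≠ 0 := fun x => (Real.sqrt_pos.2 (m x).2).ne'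
  have hsc : ∀ x, ((√(m x : ℝ) : ℝ) : ℂ) ≠ 0 := fun x => Complex.ofReal_ne_zero.2 (hs x)
  have hmul : ∀ x (z : ℂ), ‖((√(m x : ℝ) : ℝ) : ℂ) * z‖ ^ 2 = (m x : ℝ) * ‖z‖ ^ 2 := fun x z => by
    rw [norm_mul, mul_pow, Complex.norm_real, Real.norm_of_nonneg (Real.sqrt_nonneg _),
      Real.sq_sqrt (m x).2.le]
  have hmem : ∀ g : V → ℂ, Memℓp g 2 ↔ Summable fun x => ‖g x‖ ^ 2 := fun g => by
    rw [memℓp_gen_iff (by simp)]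
    simp
  let e : L2 m ≃ₗᵢ[ℂ] lp (fun _ : V => ℂ) 2 :=
    { toFun := fun f => ⟨fun x => ((√(m x : ℝ) : ℝ) : ℂ) * f x, (hmem _).2 (by
        simp only [hmul]
        exact Summable.congr f.2 fun _ => rfl)⟩
      map_add' := fun f g => by
        ext x
        exact mul_add _ _ _
      map_smul' := fun c f => by
        ext x
        exact mul_left_comm _ _ _
      invFun := fun g => ⟨fun x => ((√(m x : ℝ) : ℝ) : ℂ)⁻¹ * g x, by
        refine ((hmem _).1 (lp.memℓp g)).congr fun x => ?_
        rw [← hmul, mul_inv_cancel_left₀ (hsc x)]⟩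
      left_inv := fun f => L2.ext fun x => inv_mul_cancel_left₀ (hsc x) _
      right_inv := fun g => by
        ext x
        exact mul_inv_cancel_left₀ (hsc x) _
      norm_map' := fun f => by
        rw [← sq_eq_sq₀ (norm_nonneg _) (norm_nonneg _), ← (hasSum_norm_sq f).tsum_eq]
        have := lp.norm_rpow_eq_tsum (p := 2) (by simp)
          (⟨fun x => ((√(m x : ℝ) : ℝ) : ℂ) * f x, (hmem _).2 (by
            simp only [hmul]
            exact Summable.congr f.2 fun _ => rfl)⟩ : lp (fun _ : V => ℂ) 2)
        simp only [ENNReal.toReal_ofNat, Real.rpow_ofNat, hmul] at this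
        exact this }
  exact (completeSpace_congr (e := e.toLinearEquiv.toEquiv)
    e.isometry.isUniformEmbedding).2 inferInstance

/-- An operator whose range has uniformly small tails is compact. -/
theorem isCompactOperator_of_tail {A : L2 m →L[ℂ] L2 m}
    (h : ∀ ε : ℝ, 0 < ε → ∃ F : Finset V, ∀ g, ‖A g - truncCLM m F (A g)‖ ≤ ε * ‖g‖) :
    IsCompactOperator A := by
  have hc := isClosed_setOfPred_isCompactOperator (σ₁₂ := RingHom.id ℂ) (M₁ := L2 m) (M₂ := L2 m)
  rw [← Set.mem_ofPred_eq (p := fun A : L2 m →L[ℂ] L2 m => IsCompactOperator A), ← hc.closure_eq,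
    Metric.mem_closure_iff]
  intro ε hε
  obtain ⟨F, hF⟩ := h (ε / 2) (half_pos hε)
  -- The finite rank operators obtained by truncating the output converge to A in norm.
  refine ⟨truncCLM m F ∘L A, (isCompactOperator_truncCLM F).comp_clm A, ?_⟩
  rw [dist_eq_norm]
  refine lt_of_le_of_lt (ContinuousLinearMap.opNorm_le_bound _ (half_pos hε).le hF) (half_lt_self hε)

end WeightedL2
end RadialTree

namespace RadialTree

/-! ### The energy form, the closed gradient and Green's formula -/

section Form

variable {V : Type*} (G : SimpleGraph V) [G.LocallyFinite] {m : V → {r : ℝ // 0 < r}}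

local notation "⟪" x ", " y "⟫" => inner ℂ x y

theorem tsum_sum_neighborFinset {α : Type*} [AddCommMonoid α] [TopologicalSpace α]
    (F : V → α) (x : V) [DecidablePred (G.Adj x)] :
    ∑ y ∈ G.neighborFinset x, F y = ∑' y, if G.Adj x y then F y else 0 := by
  rw [tsum_eq_sum (s := G.neighborFinset x) fun y hy => if_neg (by simpa using hy)]
  exact Finset.sum_congr rfl fun y hy => (if_pos (by simpa using hy)).symm

/-- Summing over the oriented edges, one may reverse the edges. -/
theorem tsum_sum_neighborFinset_comm (F : V → V → ℝ≥0∞) :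
    ∑' x, ∑ y ∈ G.neighborFinset x, F x y = ∑' x, ∑ y ∈ G.neighborFinset x, F y x := by
  classical
  simp only [tsum_sum_neighborFinset]
  rw [ENNReal.tsum_comm]
  simp only [G.adj_comm]

theorem tsum_sum_neighborFinset_const (F : V → ℝ≥0∞) :
    ∑' x, ∑ _y ∈ G.neighborFinset x, F x = ∑' x, (G.degree x : ℝ≥0∞) * F x :=
  tsum_congr fun x => by simp

theorem enorm_sub_sq_le (a b : ℂ) : ‖a - b‖ₑ ^ 2 ≤ 2 * ‖a‖ₑ ^ 2 + 2 * ‖b‖ₑ ^ 2 := by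
  simp only [enorm_eq_nnnorm]
  norm_cast
  rw [← NNReal.coe_le_coe]
  push_cast
  have := norm_sub_le a b
  nlinarith [sq_nonneg (‖a‖ - ‖b‖), norm_nonneg (a - b)]

/-- By |a - b|² ≤ 2|a|² + 2|b|² on each edge, a vertex being counted once for each of its edges.
This makes the form bounded as soon as the degree is at most the weight. -/
theorem energy_le (f : V → ℂ) :
    energy G f ≤ 2 * ∑' x, (G.degree x : ℝ≥0∞) * ‖f x‖ₑ ^ 2 := by
  have h1 : ∑' x, ∑ y ∈ G.neighborFinset x, ‖f x - f y‖ₑ ^ 2 ≤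
      2 * (2 * ∑' x, (G.degree x : ℝ≥0∞) * ‖f x‖ₑ ^ 2) := by
    calc _ ≤ ∑' x, ∑ y ∈ G.neighborFinset x, (2 * ‖f x‖ₑ ^ 2 + 2 * ‖f y‖ₑ ^ 2) :=
          ENNReal.tsum_le_tsum fun x => Finset.sum_le_sum fun y _ => enorm_sub_sq_le _ _
      _ = 2 * (∑' x, ∑ y ∈ G.neighborFinset x, ‖f x‖ₑ ^ 2) +
          2 * (∑' x, ∑ y ∈ G.neighborFinset x, ‖f y‖ₑ ^ 2) := by
          simp only [Finset.sum_add_distrib, ENNReal.tsum_add, ← Finset.mul_sum,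
            ENNReal.tsum_mul_left]
      _ = _ := by
          rw [tsum_sum_neighborFinset_comm G fun _ y => ‖f y‖ₑ ^ 2,
            tsum_sum_neighborFinset_const]
          ring
  calc energy G f ≤ 2⁻¹ * (2 * (2 * ∑' x, (G.degree x : ℝ≥0∞) * ‖f x‖ₑ ^ 2)) :=
        mul_le_mul_right h1 _
    _ = _ := by
      rw [← mul_assoc, ENNReal.inv_mul_cancel two_ne_zero ENNReal.ofNat_ne_top, one_mul]

theorem energy_ne_top_of_finite {f : V → ℂ} (hf : (Function.support f).Finite) :
    energy G f ≠ ∞ := by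
  refine ne_top_of_le_ne_top ?_ (energy_le G f)
  refine ENNReal.mul_ne_top ENNReal.ofNat_ne_top ?_
  rw [tsum_eq_sum (s := hf.toFinset) fun x hx => by
    have : f x = 0 := by simpa using hx
    simp [this]]
  exact ENNReal.sum_ne_top.2 fun x _ => ENNReal.mul_ne_top (ENNReal.natCast_ne_top _)
    (ENNReal.pow_ne_top enorm_ne_top)

open Classical in
/-- The gradient of a function, on the pairs of vertices; its squared norm is the energy. -/
noncomputable def grad (f : V → ℂ) (p : V × V) : ℂ :=
  -- Each edge is met as two ordered pairs, which the factor 1/√2 compensates.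
  if G.Adj p.1 p.2 then ((√2 : ℝ) : ℂ)⁻¹ * (f p.1 - f p.2) else 0

omit [G.LocallyFinite] in
theorem grad_sub (f g : V → ℂ) (p : V × V) :
    grad G (fun x => f x - g x) p = grad G f p - grad G g p := by
  unfold grad
  split_ifs
  · ring
  · simp

theorem energy_eq_normSq_grad (f : V → ℂ) : energy G f = normSq oneWeight (grad G f) := by
  classical
  have h2 : ‖((√2 : ℝ) : ℂ)⁻¹‖ₑ ^ 2 = 2⁻¹ := by
    rw [← ofReal_norm, ← ENNReal.ofReal_pow (norm_nonneg _), norm_inv, Complex.norm_real,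
      Real.norm_of_nonneg (Real.sqrt_nonneg _), inv_pow, Real.sq_sqrt (by norm_num),
      ENNReal.ofReal_inv_of_pos (by norm_num)]
    simp
  rw [energy, normSq, ENNReal.tsum_prod', ← ENNReal.tsum_mul_left]
  refine tsum_congr fun x => ?_
  rw [tsum_sum_neighborFinset, ← ENNReal.tsum_mul_left]
  refine tsum_congr fun y => ?_
  simp only [grad, oneWeight, ENNReal.ofReal_one, one_mul]
  split_ifs with h
  · rw [enorm_mul, mul_pow, h2]
  · simp

/-- The graph of the gradient on the finitely supported functions. -/
noncomputable def gradGraph (m : V → {r : ℝ // 0 < r}) :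
    Submodule ℂ (WithLp 2 (L2 m × L2 (oneWeight : V × V → {r : ℝ // 0 < r}))) where
  carrier := {p | (Function.support p.fst).Finite ∧ ∀ q, p.snd q = grad G p.fst q}
  zero_mem' := by
    refine ⟨Set.finite_empty.subset fun x hx => hx rfl, fun q => ?_⟩
    simp [grad]
  add_mem' := by
    rintro p p' ⟨h1, h2⟩ ⟨h1', h2'⟩
    refine ⟨(h1.union h1').subset (Function.support_add _ _), fun q => ?_⟩
    rw [WithLp.add_snd, add_apply, h2, h2']
    simp only [grad, WithLp.add_fst, add_apply]
    split_ifs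
    · ring
    · simp
  smul_mem' := by
    rintro c p ⟨h1, h2⟩
    refine ⟨h1.subset fun x hx h0 => hx ?_, fun q => ?_⟩
    · rw [WithLp.smul_fst, smul_apply, h0, mul_zero]
    · rw [WithLp.smul_snd, smul_apply, h2]
      simp only [grad, WithLp.smul_fst, smul_apply]
      split_ifs
      · ring
      · simp

/-- The graph of the closure of the gradient. -/
noncomputable def closedGradGraph (m : V → {r : ℝ // 0 < r}) :
    Submodule ℂ (WithLp 2 (L2 m × L2 (oneWeight : V × V → {r : ℝ // 0 < r}))) :=
  (gradGraph G m).topologicalClosure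

instance : CompleteSpace (closedGradGraph G m) :=
  (gradGraph G m).isClosed_topologicalClosure.completeSpace_coe

/-- A finitely supported function together with its gradient. -/
noncomputable def finGraph (f : L2 m) (hf : (Function.support f).Finite) :
    WithLp 2 (L2 m × L2 (oneWeight : V × V → {r : ℝ // 0 < r})) :=
  WithLp.toLp 2 (f, ⟨grad G f, mem_l2Submodule_iff.2 (by
    rw [← energy_eq_normSq_grad]
    exact energy_ne_top_of_finite G hf)⟩)

theorem finGraph_mem (f : L2 m) (hf : (Function.support f).Finite) :
    finGraph G f hf ∈ gradGraph G m := ⟨hf, fun _ => rfl⟩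

omit [G.LocallyFinite] in
theorem gradGraph_le : gradGraph G m ≤ closedGradGraph G m :=
  Submodule.le_topologicalClosure _

variable {G}

omit [G.LocallyFinite] in
/-- An inequality between continuous functions, or an equality, extends from the graph of the
gradient on finitely supported functions to its closure. -/
theorem closedGradGraph_induction
    {P : WithLp 2 (L2 m × L2 (oneWeight : V × V → {r : ℝ // 0 < r})) → Prop}
    (hP : IsClosed {p | P p}) (h : ∀ p ∈ gradGraph G m, P p) {p} (hp : p ∈ closedGradGraph G m) :
    P p :=
  (closure_minimal (show (gradGraph G m : Set _) ⊆ {p | P p} from h) hP) hp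

theorem continuous_fst_apply (x : V) : Continuous
    fun p : WithLp 2 (L2 m × L2 (oneWeight : V × V → {r : ℝ // 0 < r})) => p.fst x :=
  (continuous_eval x).comp (WithLp.fstL 2 ℂ _ _).continuous

theorem continuous_snd_apply (q : V × V) : Continuous
    fun p : WithLp 2 (L2 m × L2 (oneWeight : V × V → {r : ℝ // 0 < r})) => p.snd q :=
  (continuous_eval q).comp (WithLp.sndL 2 ℂ _ _).continuous

omit [G.LocallyFinite] in
-- The gradient is closable: evaluations are continuous and each gradient entry involves two of
-- them, so the relation survives limits.
theorem snd_apply_eq_grad {p : WithLp 2 (L2 m × L2 (oneWeight : V × V → {r : ℝ // 0 < r}))}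
    (hp : p ∈ closedGradGraph G m) (q : V × V) : p.snd q = grad G p.fst q := by
  refine closedGradGraph_induction (P := fun p => p.snd q = grad G p.fst q)
    (isClosed_eq (continuous_snd_apply q) ?_) (fun p hp => hp.2 q) hp
  unfold grad
  split_ifs
  · exact continuous_const.mul ((continuous_fst_apply _).sub (continuous_fst_apply _))
  · exact continuous_const

theorem energy_fst {p : WithLp 2 (L2 m × L2 (oneWeight : V × V → {r : ℝ // 0 < r}))}
    (hp : p ∈ closedGradGraph G m) : energy G p.fst = ENNReal.ofReal (‖p.snd‖ ^ 2) := by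
  rw [energy_eq_normSq_grad, ← normSq_coe]
  exact congrArg _ (funext fun q => (snd_apply_eq_grad hp q).symm)

/-- Convergence in the graph is convergence in ℓ² together with convergence in energy. With the
converse `exists_mem_closedGradGraph`, the form domain is exactly the projection of the closed
graph. -/
theorem fst_mem_formDomain {p : WithLp 2 (L2 m × L2 (oneWeight : V × V → {r : ℝ // 0 < r}))}
    (hp : p ∈ closedGradGraph G m) : p.fst ∈ formDomain G m := by
  obtain ⟨s, hs, hlim⟩ := mem_closure_iff_seq_limit.1
    (show p ∈ closure (gradGraph G m : Set _) from hp)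
  refine ⟨fun n => (s n).fst, fun n => (hs n).1,
    ((WithLp.fstL 2 ℂ _ _).continuous.tendsto p).comp hlim, ?_⟩
  have h1 : ∀ n, energy G (fun x => (s n).fst x - p.fst x) =
      ENNReal.ofReal (‖(s n).snd - p.snd‖ ^ 2) := fun n => by
    have := energy_fst ((closedGradGraph G m).sub_mem (gradGraph_le G (hs n)) hp)
    rw [WithLp.sub_snd] at this
    exact this
  simp only [h1]
  have h2 := ((WithLp.sndL 2 ℂ _ _).continuous.tendsto p).comp hlim
  have h3 := ((tendsto_iff_norm_sub_tendsto_zero.1 h2).pow 2)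
  have h4 := ENNReal.tendsto_ofReal h3
  simpa using h4

theorem energy_ne_top_of_mem_formDomain {f : L2 m} (hf : f ∈ formDomain G m) :
    energy G f ≠ ∞ := by
  obtain ⟨u, hu, -, he⟩ := hf
  obtain ⟨n, hn⟩ := (he.eventually (gt_mem_nhds (zero_lt_one' ℝ≥0∞))).exists
  have h1 := energy_add_le G (u n) (fun x => (-1) * (u n x - f x))
  rw [energy_smul] at h1
  have h2 : (fun x => u n x + (-1) * (u n x - f x)) = f := by
    funext x
    ring
  rw [h2] at h1
  refine ne_top_of_le_ne_top ?_ h1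
  refine ENNReal.add_ne_top.2 ⟨ENNReal.mul_ne_top ENNReal.ofNat_ne_top
    (energy_ne_top_of_finite G (hu n)), ENNReal.mul_ne_top ENNReal.ofNat_ne_top
    (ENNReal.mul_ne_top (ENNReal.pow_ne_top enorm_ne_top) (hn.trans ENNReal.one_lt_top).ne)⟩

theorem exists_mem_closedGradGraph {f : L2 m} (hf : f ∈ formDomain G m) :
    ∃ p ∈ closedGradGraph G m, p.fst = f := by
  have hE := energy_ne_top_of_mem_formDomain hf
  rw [energy_eq_normSq_grad, ← mem_l2Submodule_iff] at hE
  obtain ⟨u, hu, hlim, he⟩ := hf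
  let D : L2 (oneWeight : V × V → {r : ℝ // 0 < r}) := ⟨grad G f, hE⟩
  refine ⟨WithLp.toLp 2 (f, D), ?_, rfl⟩
  refine mem_closure_of_tendsto (b := atTop) (f := fun n => finGraph G (u n) (hu n)) ?_
    (Eventually.of_forall fun n => finGraph_mem G _ _)
  have h1 : Tendsto (fun n => (finGraph G (u n) (hu n)).snd) atTop (𝓝 D) := by
    rw [tendsto_iff_norm_sub_tendsto_zero]
    have h2 : ∀ n, energy G (fun x => u n x - f x) =
        ENNReal.ofReal (‖(finGraph G (u n) (hu n)).snd - D‖ ^ 2) := fun n => by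
      rw [energy_eq_normSq_grad, ← normSq_coe]
      exact congrArg _ (funext fun q => grad_sub G _ _ q)
    simp only [h2] at he
    have h3 := ((ENNReal.tendsto_toReal ENNReal.zero_ne_top).comp he).sqrt
    refine Tendsto.congr (fun n => ?_) (by simpa using h3)
    simp
  exact ((WithLp.prodContinuousLinearEquiv 2 ℂ _ _).symm.continuous.tendsto (f, D)).comp
    (hlim.prodMk_nhds h1)

/-- Green's formula. -/
theorem inner_snd_eq {p p' : WithLp 2 (L2 m × L2 (oneWeight : V × V → {r : ℝ // 0 < r}))}
    (hp : p ∈ gradGraph G m) (hp' : p' ∈ closedGradGraph G m) :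
    ⟪p.snd, p'.snd⟫ =
      ∑' x, ((m x : ℝ) : ℂ) * (conj (p.fst x) * algLaplacian G m p'.fst x) := by
  classical
  set φ := p.fst with hφ
  set f := p'.fst with hf
  -- The product of the gradients at a pair q is h(q) + h(q.swap). Finite support of φ makes h
  -- finitely supported, so both halves have the same sum, which can be grouped by the first vertex.
  let h : V × V → ℂ := fun q => if G.Adj q.1 q.2 then conj (φ q.1) * (f q.1 - f q.2) / 2 else 0
  have hfs : (Function.support h).Finite := by
    refine ((hp.1.toFinset.biUnion fun x =>
      (G.neighborFinset x).image fun y => (x, y)).finite_toSet).subset fun q hq => ?_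
    simp only [h, Function.mem_support, ne_eq, ite_eq_right_iff, Classical.not_imp] at hq
    have : φ q.1 ≠ 0 := fun h0 => hq.2 (by rw [h0]; simp)
    simp only [Finset.coe_biUnion, Set.mem_iUnion, Finset.coe_image]
    exact ⟨q.1, by simpa using this, q.2, by simpa using hq.1, rfl⟩
  have h1 : Summable h := summable_of_hasFiniteSupport hfs
  have h2 : HasSum (fun q : V × V => h q.swap) (∑' q, h q) :=
    (Equiv.prodComm V V).hasSum_iff.2 h1.hasSum
  have h3 := h1.hasSum.add h2
  have hsq : ((√2 : ℝ) : ℂ)⁻¹ * ((√2 : ℝ) : ℂ)⁻¹ = 2⁻¹ := by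
    rw [← mul_inv, ← Complex.ofReal_mul, Real.mul_self_sqrt (by norm_num)]
    simp
  have h4 : HasSum (fun q => h q + h q.swap) ⟪p.snd, p'.snd⟫ := by
    refine (hasSum_inner p.snd p'.snd).congr_fun fun q => ?_
    rw [hp.2, snd_apply_eq_grad hp']
    simp only [h, grad, oneWeight, Prod.fst_swap, Prod.snd_swap, G.adj_comm q.2 q.1]
    split_ifs
    · rw [map_mul, map_inv₀, Complex.conj_ofReal, map_sub]
      push_cast
      linear_combination (conj (φ q.1) - conj (φ q.2)) * (f q.1 - f q.2) * (-hsq)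
    · simp
  rw [h4.unique h3, h1.tsum_prod, ← two_mul, ← tsum_mul_left]
  refine tsum_congr fun x => ?_
  simp only [h, algLaplacian, LinearMap.coe_mk, AddHom.coe_mk]
  rw [← tsum_sum_neighborFinset]
  have hm : ((m x : ℝ) : ℂ) ≠ 0 := Complex.ofReal_ne_zero.2 (m x).2.ne'
  rw [← Finset.sum_div, ← Finset.mul_sum]
  field_simp

/-- Once the Laplacian of the second function is in ℓ², both sides of Green's formula are continuous
in p, and finite support of the first function is no longer needed. -/
theorem inner_snd_eq_inner_fst
    {p p' : WithLp 2 (L2 m × L2 (oneWeight : V × V → {r : ℝ // 0 < r}))}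
    (hp : p ∈ closedGradGraph G m) (hp' : p' ∈ closedGradGraph G m) {g : L2 m}
    (hg : ∀ x, algLaplacian G m p'.fst x = g x) : ⟪p.snd, p'.snd⟫ = ⟪p.fst, g⟫ := by
  refine closedGradGraph_induction (P := fun p => ⟪p.snd, p'.snd⟫ = ⟪p.fst, g⟫)
    (isClosed_eq ((WithLp.sndL 2 ℂ _ _).continuous.inner continuous_const)
      ((WithLp.fstL 2 ℂ _ _).continuous.inner continuous_const)) (fun p hp => ?_) hp
  rw [inner_snd_eq hp hp', inner_eq_tsum]
  simp only [hg]

/-- The quadratic form of the Laplacian is the energy. -/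
theorem energy_eq_inner (f : (laplacian G m).domain) :
    energy G (f : L2 m) = ENNReal.ofReal (⟪(f : L2 m), laplacian G m f⟫).re := by
  obtain ⟨p, hp, hpf⟩ := exists_mem_closedGradGraph f.2.1
  have h := inner_snd_eq_inner_fst hp hp (g := laplacian G m f) fun x => by rw [hpf]; rfl
  rw [← hpf, ← h, energy_fst hp, inner_self_eq_norm_sq_to_K]
  congr 1
  norm_cast

theorem inner_laplacian_nonneg (f : (laplacian G m).domain) :
    0 ≤ (⟪(f : L2 m), laplacian G m f⟫).re := by
  obtain ⟨p, hp, hpf⟩ := exists_mem_closedGradGraph f.2.1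
  have h := inner_snd_eq_inner_fst hp hp (g := laplacian G m f) fun x => by rw [hpf]; rfl
  rw [← hpf, ← h, inner_self_eq_norm_sq_to_K]
  norm_cast
  exact sq_nonneg _

end Form
end RadialTree

namespace RadialTree

/-! ### The resolvent at -1 as a projection, and the diagonalization criterion -/

section Resolvent

variable {V : Type u} {G : SimpleGraph V} [G.LocallyFinite] {m : V → {r : ℝ // 0 < r}}

local notation "⟪" x ", " y "⟫" => inner ℂ x y

theorem support_delta_finite (x : V) : (Function.support (delta m x)).Finite := by
  classical
  exact (Set.finite_singleton x).subset fun y hy => by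
    by_contra h
    exact hy ((delta_apply x y).trans (if_neg h))

theorem inner_delta (x : V) (f : L2 m) : ⟪delta m x, f⟫ = ((m x : ℝ) : ℂ) * f x := by
  classical
  rw [inner_eq_tsum, tsum_eq_single x]
  · simp [delta_apply]
  · intro y hy
    simp [delta_apply, hy]

variable (G m) in
/-- The bounded inverse of `Δ + 1`. -/
theorem exists_resolvent : ∃ R : L2 m →L[ℂ] L2 m, R.IsSymmetric ∧
    (∀ u, ∃ h : R u ∈ (laplacian G m).domain, laplacian G m ⟨R u, h⟩ + R u = u) ∧
    ∀ f : (laplacian G m).domain, R (laplacian G m f + f) = f := by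
  let E := WithLp 2 (L2 m × L2 (oneWeight : V × V → {r : ℝ // 0 < r}))
  let K : Submodule ℂ E := closedGradGraph G m
  -- J sends u to (u, 0). The inner product of E restricted to the graph is the form of Δ + 1, so
  -- projecting (u, 0) solves (Δ + 1)f = u weakly.
  let J : L2 m →L[ℂ] E := (WithLp.prodContinuousLinearEquiv 2 ℂ (L2 m)
    (L2 (oneWeight : V × V → {r : ℝ // 0 < r}))).symm.toContinuousLinearMap ∘L
      ContinuousLinearMap.inl ℂ _ _
  have hJ1 : ∀ u, (J u).fst = u := fun u => rfl
  have hJ2 : ∀ u, (J u).snd = 0 := fun u => rfl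
  let R : L2 m →L[ℂ] L2 m := WithLp.fstL 2 ℂ _ _ ∘L K.starProjection ∘L J
  have hR : ∀ u, R u = (K.starProjection (J u)).fst := fun u => rfl
  have hin : ∀ (a : L2 m) (p : E), ⟪J a, p⟫ = ⟪a, p.fst⟫ := fun a p => by
    rw [WithLp.prod_inner_apply]
    change ⟪(J a).fst, p.fst⟫ + ⟪(J a).snd, p.snd⟫ = _
    rw [hJ1, hJ2, inner_zero_left, add_zero]
  refine ⟨R, fun a c => ?_, fun u => ?_, fun f => ?_⟩
  · simp only [ContinuousLinearMap.coe_coe, hR]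
    rw [← hin, ← inner_conj_symm, ← hin, inner_conj_symm]
    exact K.starProjection_isSymmetric (J a) (J c)
  · have hp : K.starProjection (J u) ∈ closedGradGraph G m := K.starProjection_apply_mem _
    -- Orthogonality of the projection error to the graph point of the indicator of x is the
    -- equation at x, by Green's formula.
    have hlap : algLaplacian G m (R u) = fun x => (u - R u) x := by
      funext x
      have hfin := support_delta_finite (m := m) x
      have h1 := K.starProjection_inner_eq_zero (J u) (finGraph G (delta m x) hfin)
        (gradGraph_le G (finGraph_mem G _ hfin))
      rw [WithLp.prod_inner_apply] at h1
      have h2 : ⟪u - R u, delta m x⟫ -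
          ⟪(K.starProjection (J u)).snd, (finGraph G (delta m x) hfin).snd⟫ = 0 := by
        have h3 : ⟪u - R u, delta m x⟫ + ⟪(0 : L2 (oneWeight : V × V → {r : ℝ // 0 < r})) -
            (K.starProjection (J u)).snd, (finGraph G (delta m x) hfin).snd⟫ = 0 := h1
        rwa [zero_sub, inner_neg_left, ← sub_eq_add_neg] at h3
      have h4 : ⟪delta m x, u - R u⟫ =
          ⟪(finGraph G (delta m x) hfin).snd, (K.starProjection (J u)).snd⟫ := by
        rw [← inner_conj_symm, sub_eq_zero.1 h2, inner_conj_symm]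
      rw [inner_delta, inner_snd_eq (finGraph_mem G _ hfin) hp, tsum_eq_single x] at h4
      · have h5 : (finGraph G (delta m x) hfin).fst x = 1 := by
          classical
          exact (delta_apply x x).trans (if_pos rfl)
        rw [h5, map_one, one_mul] at h4
        exact (mul_left_cancel₀ (Complex.ofReal_ne_zero.2 (m x).2.ne') h4).symm
      · intro y hy
        have h5 : (finGraph G (delta m x) hfin).fst y = 0 := by
          classical
          exact (delta_apply x y).trans (if_neg hy)
        rw [h5]
        simp
    refine ⟨⟨fst_mem_formDomain hp, ?_⟩, ?_⟩
    · rw [hlap]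
      exact (u - R u).2
    · ext x
      rw [add_apply]
      have := congrFun hlap x
      change algLaplacian G m (R u) x + R u x = u x
      rw [this, sub_apply, sub_add_cancel]
  · obtain ⟨p, hp, hpf⟩ := exists_mem_closedGradGraph f.2.1
    -- Here the error is (Δf, -∇f), which is orthogonal to K by Green's formula, so (f, ∇f) is the
    -- projection.
    have h1 : K.starProjection (J (laplacian G m f + f)) = p := by
      refine Submodule.eq_starProjection_of_mem_orthogonal hp ?_
      rw [Submodule.mem_orthogonal]
      intro q hq
      rw [WithLp.prod_inner_apply]
      change ⟪q.fst, (laplacian G m f + (f : L2 m)) - p.fst⟫ +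
        ⟪q.snd, (0 : L2 (oneWeight : V × V → {r : ℝ // 0 < r})) - p.snd⟫ = 0
      rw [hpf, add_sub_cancel_right, zero_sub, inner_neg_right,
        inner_snd_eq_inner_fst hq hp (g := laplacian G m f) fun x => by rw [hpf]; rfl]
      ring
    rw [hR, h1, hpf]

/-- Expand the square and use that the form is non-negative. Tail estimates in terms of the form
norm thereby become estimates for the resolvent. -/
theorem norm_le_norm_laplacian_add (f : (laplacian G m).domain) :
    ‖(f : L2 m)‖ ^ 2 + (⟪(f : L2 m), laplacian G m f⟫).re ≤ ‖laplacian G m f + f‖ ^ 2 := by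
  have h := inner_laplacian_nonneg f
  have h1 : (⟪laplacian G m f, (f : L2 m)⟫).re = (⟪(f : L2 m), laplacian G m f⟫).re := by
    rw [← inner_conj_symm, Complex.conj_re]
  rw [@norm_add_sq ℂ]
  simp only [RCLike.re_to_complex, h1]
  nlinarith [sq_nonneg ‖laplacian G m f‖]

/-- If the resolvent of the Laplacian is a compact perturbation of a multiple of the identity, then
the Laplacian is diagonal in a Hilbert basis. -/
theorem exists_isDiagonalizedBy (s : ℝ)
    (h : ∀ ε : ℝ, 0 < ε → ∃ F : Finset V, ∀ f : (laplacian G m).domain,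
      ‖((f : L2 m) - (s : ℂ) • (laplacian G m f + f)) -
        truncCLM m F ((f : L2 m) - (s : ℂ) • (laplacian G m f + f))‖ ≤
      ε * ‖laplacian G m f + f‖) :
    ∃ (ι : Type u) (b : HilbertBasis ι ℂ (L2 m)) (μ : ι → ℝ),
      IsDiagonalizedBy (laplacian G m) b μ ∧ (∀ i, 0 ≤ μ i) ∧
      ∀ ε : ℝ, 0 < ε → {i | ε ≤ |(μ i + 1)⁻¹ - s|}.Finite := by
  obtain ⟨R, hRs, hR1, hR2⟩ := exists_resolvent G m
  -- With f = Rg one has Δf + f = g, so the hypothesis is the tail condition for A.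
  let A : L2 m →L[ℂ] L2 m := R - (s : ℂ) • ContinuousLinearMap.id ℂ (L2 m)
  have hA : ∀ u, A u = R u - (s : ℂ) • u := fun u => rfl
  have hAs : A.IsSymmetric := fun a c => by
    have := hRs a c
    simp only [ContinuousLinearMap.coe_coe] at this ⊢
    rw [hA, hA, inner_sub_left, inner_sub_right, inner_smul_left, inner_smul_right, this,
      Complex.conj_ofReal]
  have hAc : IsCompactOperator A := isCompactOperator_of_tail fun ε hε => by
    obtain ⟨F, hF⟩ := h ε hε
    refine ⟨F, fun g => ?_⟩
    obtain ⟨hd, hg⟩ := hR1 g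
    have := hF ⟨R g, hd⟩
    rwa [hg] at this
  obtain ⟨ι, b, κ, hκ, hfin⟩ := exists_hilbertBasis_of_isCompactOperator hAc hAs
  have hb : ∀ i, R (b i) = ((κ i + s : ℝ) : ℂ) • b i := fun i => by
    have := hκ i
    rw [hA, sub_eq_iff_eq_add] at this
    rw [this, ← add_smul]
    push_cast
    rfl
  obtain ⟨h0, hT⟩ := IsDiagonalizedBy.of_inverse hRs hR1 hR2 hb
  refine ⟨ι, b, _, hT, fun i => ?_, fun ε hε => ?_⟩
  · obtain ⟨hd, hi⟩ := hT.apply_basis i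
    have := inner_laplacian_nonneg (G := G) (m := m) ⟨b i, hd⟩
    rw [hi, inner_smul_right, inner_self_eq_norm_sq_to_K, b.orthonormal.1] at this
    rwa [RCLike.ofReal_one, one_pow, mul_one, Complex.ofReal_re] at this
  · refine (hfin ε hε).subset fun i hi => ?_
    have hi' : ε ≤ |((κ i + s)⁻¹ - 1 + 1)⁻¹ - s| := hi
    simpa using hi'

theorem hasFiniteSupport_algLaplacian {f : V → ℂ} (hf : (Function.support f).Finite) :
    (Function.support (algLaplacian G m f)).Finite := by
  classical
  refine (hf.toFinset ∪ hf.toFinset.biUnion fun x => G.neighborFinset x).finite_toSet.subset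
    fun x hx => ?_
  by_contra hn
  simp only [Finset.coe_union, Finset.coe_biUnion, Set.mem_union, Set.mem_iUnion, not_or,
    not_exists, SetLike.mem_coe, Set.Finite.mem_toFinset, Function.mem_support, not_not] at hn
  refine hx ?_
  simp only [algLaplacian, LinearMap.coe_mk, AddHom.coe_mk]
  rw [Finset.sum_eq_zero, mul_zero]
  intro y hy
  have hy0 : f y = 0 := by
    by_contra hy0
    refine hn.2 y hy0 ?_
    simpa [G.adj_comm y x] using hy
  rw [hn.1, hy0, sub_zero]

theorem mem_domain_of_finite (f : L2 m) (hf : (Function.support f).Finite) :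
    f ∈ (laplacian G m).domain := by
  refine ⟨⟨fun _ => f, fun _ => hf, tendsto_const_nhds, ?_⟩,
    mem_l2Submodule_of_finite (hasFiniteSupport_algLaplacian hf)⟩
  have : energy G (fun x => f x - f x) = 0 := by simp [energy]
  exact this ▸ tendsto_const_nhds

/-- A weighted norm which is bounded by the form norm on the finitely supported functions is so on
the form domain. -/
theorem weighted_le_of_mem_formDomain {w : V → ℝ≥0∞} (hw : ∀ x, w x ≠ ∞)
    (h : ∀ φ : V → ℂ, (Function.support φ).Finite →
      ∑' x, w x * ‖φ x‖ₑ ^ 2 ≤ energy G φ + normSq m φ) {f : L2 m} (hf : f ∈ formDomain G m) :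
    ∑' x, w x * ‖f x‖ₑ ^ 2 ≤ energy G f + normSq m f := by
  obtain ⟨p, hp, rfl⟩ := exists_mem_closedGradGraph hf
  -- A sum over a finite set is continuous on the graph because the weights are finite; the
  -- inequality passes to the closure for each such sum, and then to the supremum.
  rw [ENNReal.tsum_eq_iSup_sum]
  refine iSup_le fun F => ?_
  rw [energy_fst hp, normSq_coe]
  refine closedGradGraph_induction (G := G) (P := fun p => ∑ x ∈ F, w x * ‖p.fst x‖ₑ ^ 2 ≤
    ENNReal.ofReal (‖p.snd‖ ^ 2) + ENNReal.ofReal (‖p.fst‖ ^ 2)) (isClosed_le ?_ ?_)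
    (fun p hp => ?_) hp
  · refine continuous_finsetSum F fun x _ => ?_
    refine (ENNReal.continuous_const_mul (hw x)).comp ?_
    exact (ENNReal.continuous_pow 2).comp (continuous_enorm.comp (continuous_fst_apply x))
  · exact (ENNReal.continuous_ofReal.comp ((WithLp.sndL 2 ℂ _ _).continuous.norm.pow 2)).add
      (ENNReal.continuous_ofReal.comp ((WithLp.fstL 2 ℂ _ _).continuous.norm.pow 2))
  · rw [← energy_fst (gradGraph_le G hp), ← normSq_coe]
    exact (ENNReal.sum_le_tsum F).trans (h _ hp.1)

/-- The form domain is the whole space when the degree is bounded by the weight. -/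
theorem formDomain_eq_top (h : ∀ x, (G.degree x : ℝ) ≤ m x) : formDomain G m = ⊤ := by
  rw [eq_top_iff]
  intro f _
  have hcl : f ∈ closure {u : L2 m | (Function.support u).Finite} :=
    mem_closure_of_tendsto (tendsto_truncCLM f)
      (Eventually.of_forall fun F => support_truncCLM_finite F f)
  obtain ⟨u, hu, hlim⟩ := mem_closure_iff_seq_limit.1 hcl
  refine ⟨u, hu, hlim, ?_⟩
  have h1 : Tendsto (fun n => 2 * ENNReal.ofReal (‖u n - f‖ ^ 2)) atTop (𝓝 0) := by
    have h3 := ((tendsto_iff_norm_sub_tendsto_zero.1 hlim).pow 2)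
    have h4 := ENNReal.Tendsto.const_mul (ENNReal.tendsto_ofReal h3) (a := 2) (Or.inr (by simp))
    simpa using h4
  refine tendsto_of_tendsto_of_tendsto_of_le_of_le tendsto_const_nhds h1 (fun _ => zero_le)
    fun n => (energy_le G _).trans ?_
  rw [← normSq_coe]
  refine mul_le_mul_right (ENNReal.tsum_le_tsum fun x => mul_le_mul_left ?_ _) _
  rw [← ENNReal.ofReal_natCast]
  exact ENNReal.ofReal_le_ofReal (h x)

end Resolvent
end RadialTree

namespace RadialTree

/-! ### Parents, children and growth of spheres in a tree -/

section Tree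

variable {V : Type u} {G : SimpleGraph V}

/-- Uniqueness of the parent: a neighbour w closer to v has a geodesic from v avoiding x, so by
acyclicity w must be the penultimate vertex of the path from v to x. -/
theorem eq_of_adj_of_dist_lt (hG : G.IsTree) {v x y z : V} (hxy : G.Adj x y) (hxz : G.Adj x z)
    (hy : G.dist v y < G.dist v x) (hz : G.dist v z < G.dist v x) : y = z := by
  classical
  obtain ⟨p, hp, hp'⟩ := (hG.connected v x).exists_path_of_dist
  have key : ∀ w, G.Adj x w → G.dist v w < G.dist v x → w = p.penultimate := fun w hxw hw => by
    obtain ⟨q, hq, hq'⟩ := (hG.connected v w).exists_path_of_dist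
    refine hG.isAcyclic.eq_penultimate_of_adj_end hp hxw
      (hG.isAcyclic.mem_support_of_ne_mem_support_of_adj_of_isPath hp hq hxw fun hx => ?_)
    have h1 := SimpleGraph.dist_le (q.takeUntil x hx)
    have h2 := q.length_takeUntil_le_length hx
    omega
  rw [key y hxy hy, key z hxz hz]

theorem exists_adj_dist_add_one (hG : G.IsTree) {v x : V} {n : ℕ} (hx : G.dist v x = n + 1) :
    ∃ y, G.Adj x y ∧ G.dist v y = n := by
  obtain ⟨p, hp⟩ := (hG.connected x v).exists_walk_length_eq_dist
  rw [SimpleGraph.dist_comm, hx] at hp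
  cases p with
  | nil => simp at hp
  | @cons _ y _ h q =>
    refine ⟨y, h, ?_⟩
    have h1 := SimpleGraph.dist_le q
    rw [SimpleGraph.Walk.length_cons] at hp
    rw [SimpleGraph.dist_comm] at h1
    rcases hG.dist_eq_dist_add_one_of_adj v h with h2 | h2 <;> omega

theorem dist_eq_of_adj (hG : G.IsTree) (v : V) {x y : V} (hxy : G.Adj x y) :
    G.dist v y = G.dist v x + 1 ∨ G.dist v x = G.dist v y + 1 :=
  (hG.dist_eq_dist_add_one_of_adj v hxy).symm

variable [G.LocallyFinite]

theorem card_filter_not_child_le (hG : G.IsTree) (v x : V) :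
    ((G.neighborFinset x).filter fun y => ¬ G.dist v y = G.dist v x + 1).card ≤ 1 := by
  rw [Finset.card_le_one]
  intro y hy z hz
  rw [Finset.mem_filter, SimpleGraph.mem_neighborFinset] at hy hz
  have h1 := (dist_eq_of_adj hG v hy.1).resolve_left hy.2
  have h2 := (dist_eq_of_adj hG v hz.1).resolve_left hz.2
  exact eq_of_adj_of_dist_lt hG hy.1 hz.1 (v := v) (by omega) (by omega)

theorem degree_le_card_children_add_one (hG : G.IsTree) (v x : V) :
    G.degree x ≤ ((G.neighborFinset x).filter fun y => G.dist v y = G.dist v x + 1).card + 1 := by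
  rw [← G.card_neighborFinset_eq_degree, ← Finset.card_filter_add_card_filter_not
    (s := G.neighborFinset x) (fun y => G.dist v y = G.dist v x + 1)]
  exact Nat.add_le_add_left (card_filter_not_child_le hG v x) _

/-- The root alone has no parent; away from it the bound by at most one parent is attained. -/
theorem card_children_add_one (hG : G.IsTree) {v x : V} (hx : G.dist v x ≠ 0) :
    ((G.neighborFinset x).filter fun y => G.dist v y = G.dist v x + 1).card + 1 = G.degree x := by
  refine le_antisymm ?_ (degree_le_card_children_add_one hG v x)
  rw [← G.card_neighborFinset_eq_degree, ← Finset.card_filter_add_card_filter_not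
    (s := G.neighborFinset x) (fun y => G.dist v y = G.dist v x + 1)]
  refine Nat.add_le_add_left (Finset.card_pos.2 ?_) _
  obtain ⟨n, hn⟩ := Nat.exists_eq_succ_of_ne_zero hx
  obtain ⟨y, hy, hyn⟩ := exists_adj_dist_add_one hG hn
  exact ⟨y, Finset.mem_filter.2 ⟨by simpa using hy, by omega⟩⟩

/-- A sum over the neighbours of a vertex is the sum over its children, and at most one more
term. -/
theorem sum_neighborFinset_le (hG : G.IsTree) (v x : V) {g : V → ℝ} {a c : ℝ} (ha : 0 ≤ a)
    (hc : 0 ≤ c) (h1 : ∀ y, G.Adj x y → G.dist v y = G.dist v x + 1 → g y ≤ a)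
    (h2 : ∀ y, G.Adj x y → G.dist v x = G.dist v y + 1 → g y ≤ c) :
    ∑ y ∈ G.neighborFinset x, g y ≤ G.degree x * a + c := by
  rw [← Finset.sum_filter_add_sum_filter_not _ fun y => G.dist v y = G.dist v x + 1]
  refine add_le_add ?_ ?_
  · refine (Finset.sum_le_card_nsmul _ _ a fun y hy => ?_).trans ?_
    · rw [Finset.mem_filter, SimpleGraph.mem_neighborFinset] at hy
      exact h1 y hy.1 hy.2
    · rw [nsmul_eq_mul]
      refine mul_le_mul_of_nonneg_right (Nat.cast_le.2 ?_) ha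
      rw [← G.card_neighborFinset_eq_degree]
      exact Finset.card_filter_le _ _
  · refine (Finset.sum_le_card_nsmul _ _ c fun y hy => ?_).trans ?_
    · rw [Finset.mem_filter, SimpleGraph.mem_neighborFinset] at hy
      exact h2 y hy.1 ((dist_eq_of_adj hG v hy.1).resolve_left hy.2)
    · rw [nsmul_eq_mul]
      refine mul_le_of_le_one_left hc ?_
      exact_mod_cast card_filter_not_child_le hG v x

/-! ### Spheres -/

omit [G.LocallyFinite] in
theorem sphere_zero (hG : G.IsTree) (v : V) : sphere G v 0 = {v} := by
  ext x
  simp only [sphere, Set.mem_ofPred_eq, Set.mem_singleton_iff]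
  rw [(hG.connected v x).dist_eq_zero_iff, eq_comm]

theorem sphere_finite (hG : G.IsTree) (v : V) (n : ℕ) : (sphere G v n).Finite := by
  induction n with
  | zero => rw [sphere_zero hG]; exact Set.finite_singleton v
  | succ n ih =>
    refine (ih.biUnion fun x _ => (G.neighborFinset x).finite_toSet).subset fun x hx => ?_
    obtain ⟨y, hxy, hy⟩ := exists_adj_dist_add_one hG (show G.dist v x = n + 1 from hx)
    exact Set.mem_biUnion (show y ∈ sphere G v n from hy) (by simpa using hxy.symm)

omit [G.LocallyFinite] in
theorem ballBefore_succ (v : V) (n : ℕ) :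
    ballBefore G v (n + 1) = ballBefore G v n ∪ sphere G v n := by
  ext x
  simp only [ballBefore, sphere, Set.mem_ofPred_eq, Set.mem_union]
  omega

theorem ballBefore_finite (hG : G.IsTree) (v : V) (n : ℕ) : (ballBefore G v n).Finite := by
  induction n with
  | zero => exact Set.finite_empty.subset fun x hx => absurd hx (Nat.not_lt_zero _)
  | succ n ih => rw [ballBefore_succ]; exact ih.union (sphere_finite hG v n)

theorem ncard_ballBefore_succ (hG : G.IsTree) (v : V) (n : ℕ) :
    (ballBefore G v (n + 1)).ncard = (ballBefore G v n).ncard + (sphere G v n).ncard := by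
  rw [ballBefore_succ, Set.ncard_union_eq _ (ballBefore_finite hG v n) (sphere_finite hG v n)]
  rw [Set.disjoint_left]
  intro x (hx : G.dist v x < n) (hx' : G.dist v x = n)
  omega

/-- Every vertex but the root has a parent, so an empty sphere makes all later ones empty and V
would be a finite ball. -/
theorem sphere_nonempty [Infinite V] (hG : G.IsTree) (v : V) (n : ℕ) :
    (sphere G v n).Nonempty := by
  by_contra h
  rw [Set.not_nonempty_iff_eq_empty] at h
  have hempty : ∀ k, sphere G v (n + k) = ∅ := fun k => by
    induction k with
    | zero => exact h
    | succ k ih =>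
      rw [Set.eq_empty_iff_forall_notMem] at ih ⊢
      intro x hx
      obtain ⟨y, -, hy⟩ := exists_adj_dist_add_one hG (show G.dist v x = (n + k) + 1 from hx)
      exact ih y hy
  refine Set.infinite_univ ((ballBefore_finite hG v n).subset fun x _ => ?_)
  by_contra hx
  have hle : n ≤ G.dist v x := not_lt.1 hx
  obtain ⟨k, hk⟩ := Nat.exists_eq_add_of_le hle
  exact (Set.eq_empty_iff_forall_notMem.1 (hempty k)) x hk

/-- Double counting of the edges between consecutive spheres: at least d children above, at most one
parent below. -/
theorem mul_ncard_sphere_le (hG : G.IsTree) (v : V) (n d : ℕ)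
    (hd : ∀ x, G.dist v x = n → d + 1 ≤ G.degree x) :
    d * (sphere G v n).ncard ≤ (sphere G v (n + 1)).ncard := by
  classical
  rw [Set.ncard_eq_toFinset_card _ (sphere_finite hG v n),
    Set.ncard_eq_toFinset_card _ (sphere_finite hG v (n + 1)), mul_comm]
  have h := Finset.card_mul_le_card_mul (s := (sphere_finite hG v n).toFinset)
    (t := (sphere_finite hG v (n + 1)).toFinset) (m := d) (n := 1) G.Adj (fun x hx => ?_)
    (fun y hy => ?_)
  · simpa using h
  · have hx' : G.dist v x = n := (sphere_finite hG v n).mem_toFinset.1 hx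
    have h1 := degree_le_card_children_add_one hG v x
    have h2 := hd x hx'
    refine (Nat.le_of_succ_le_succ (h2.trans h1)).trans (Finset.card_le_card fun y hy => ?_)
    rw [Finset.mem_filter, SimpleGraph.mem_neighborFinset] at hy
    rw [Finset.mem_bipartiteAbove]
    exact ⟨by simp only [Set.Finite.mem_toFinset]; exact hy.2.trans (by rw [hx']), hy.1⟩
  · have hy' : G.dist v y = n + 1 := (sphere_finite hG v (n + 1)).mem_toFinset.1 hy
    rw [Finset.card_le_one]
    intro x hx z hz
    rw [Finset.mem_bipartiteBelow] at hx hz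
    have hx' : G.dist v x = n := (sphere_finite hG v n).mem_toFinset.1 hx.1
    have hz' : G.dist v z = n := (sphere_finite hG v n).mem_toFinset.1 hz.1
    exact eq_of_adj_of_dist_lt hG hx.2.symm hz.2.symm (v := v) (by omega) (by omega)

variable [Infinite V] {η : ℕ → ℕ} {v : V}

theorem eventually_ncard_ballBefore_lt (hG : G.IsTree) (hη : ∀ x, G.degree x = η (G.dist v x))
    (ht : Tendsto η atTop atTop) :
    ∀ᶠ n in atTop, (ballBefore G v n).ncard + 1 ≤ (sphere G v n).ncard := by
  obtain ⟨N, hN⟩ := eventually_atTop.1 (ht.eventually_ge_atTop 4)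
  have h1 : ∀ n, 1 ≤ (sphere G v n).ncard := fun n =>
    (Set.ncard_pos (sphere_finite hG v n)).2 (sphere_nonempty hG v n)
  -- Degrees at least 4 give #S_{n+1} ≥ 3#S_n, so #S_n - #B_{n-1} grows by at least #S_n ≥ 1 at each
  -- step. A factor 2 would not suffice for this induction.
  have key : ∀ k, (ballBefore G v (N + k)).ncard + k ≤
      (sphere G v (N + k)).ncard + (ballBefore G v N).ncard := fun k => by
    induction k with
    | zero => simp
    | succ k ih =>
      have h2 := mul_ncard_sphere_le hG v (N + k) 3 fun x hx => by
        rw [hη, hx]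
        exact hN _ (by omega)
      have h3 := ncard_ballBefore_succ hG v (N + k)
      have h4 := h1 (N + k)
      rw [show N + (k + 1) = N + k + 1 from rfl]
      omega
  refine eventually_atTop.2 ⟨N + ((ballBefore G v N).ncard + 1), fun n hn => ?_⟩
  obtain ⟨k, rfl⟩ := Nat.exists_eq_add_of_le (show N ≤ n by omega)
  have := key k
  omega

theorem exists_dist_eq (hG : G.IsTree) (v : V) (n : ℕ) : ∃ x, G.dist v x = n :=
  sphere_nonempty hG v n

theorem one_le_radialDegree (hG : G.IsTree) (hη : ∀ x, G.degree x = η (G.dist v x)) (n : ℕ) :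
    1 ≤ η n := by
  obtain ⟨x, rfl⟩ := exists_dist_eq hG v n
  rw [← hη]
  exact hG.connected.preconnected.degree_pos_of_nontrivial x

end Tree
end RadialTree

namespace RadialTree

/-! ### The lower bound for the energy on a radial tree -/

section Estimates

variable {V : Type u} {G : SimpleGraph V} [G.LocallyFinite] [Infinite V] {η : ℕ → ℕ} {v : V}

/-- This is 2|a||b| ≤ s|a|² + t|b|², the arithmetic-geometric mean inequality with free weights. -/
theorem add_norm_sq_le {s t : ℝ} (ht : 0 < t) (hst : s * t = 1) (a b : ℂ) :
    ‖a‖ ^ 2 + ‖b‖ ^ 2 ≤ ‖a - b‖ ^ 2 + (s * ‖a‖ ^ 2 + t * ‖b‖ ^ 2) := by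
  have h1 : (‖a‖ - ‖b‖) ^ 2 ≤ ‖a - b‖ ^ 2 := sq_le_sq' (by
    have := norm_sub_norm_le b a
    rw [norm_sub_rev] at this
    linarith) (norm_sub_norm_le a b)
  have h2 : 0 ≤ (s * ‖a‖ - ‖b‖) ^ 2 := sq_nonneg _
  have h3 : 0 ≤ t * (s * ‖a‖ - ‖b‖) ^ 2 := by positivity
  have h4 : t * (s * ‖a‖ - ‖b‖) ^ 2 = s * ‖a‖ ^ 2 - 2 * (‖a‖ * ‖b‖) + t * ‖b‖ ^ 2 := by
    linear_combination (s * ‖a‖ ^ 2 - 2 * ‖a‖ * ‖b‖) * hst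
  nlinarith

theorem add_enorm_sq_le {s t : ℝ} (hs : 0 < s) (ht : 0 < t) (hst : s * t = 1) (a b : ℂ) :
    ‖a‖ₑ ^ 2 + ‖b‖ₑ ^ 2 ≤
      ‖a - b‖ₑ ^ 2 + (ENNReal.ofReal s * ‖a‖ₑ ^ 2 + ENNReal.ofReal t * ‖b‖ₑ ^ 2) := by
  have h := ENNReal.ofReal_le_ofReal (add_norm_sq_le ht hst a b)
  rw [ENNReal.ofReal_add (by positivity) (by positivity),
    ENNReal.ofReal_add (by positivity) (by positivity),
    ENNReal.ofReal_add (by positivity) (by positivity), ofReal_mul_norm_sq _ hs.le,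
    ofReal_mul_norm_sq _ ht.le] at h
  simpa [ENNReal.ofReal_pow (norm_nonneg _), ofReal_norm] using h

/-- The main lower bound for the energy on a radial tree with non-decreasing degrees. -/
theorem tsum_degree_le_energy_add (hG : G.IsTree) (hη : ∀ x, G.degree x = η (G.dist v x))
    (hmono : Monotone η) (f : V → ℂ) :
    ∑' x, (η (G.dist v x) : ℝ≥0∞) * ‖f x‖ₑ ^ 2 ≤
      energy G f + ∑' x, ENNReal.ofReal (2 * √(η (G.dist v x) : ℝ)) * ‖f x‖ₑ ^ 2 := by
  have h1 : ∀ n, (1 : ℝ) ≤ η n := fun n => by exact_mod_cast one_le_radialDegree hG hη n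
  have hs : ∀ n, 0 < √(η n : ℝ) := fun n => Real.sqrt_pos.2 (by linarith [h1 n])
  -- The coefficient is η^(-1/2) towards a child and η^(1/2) towards the parent, with η taken at the
  -- parent's end of the edge. The two are inverse, and the children of x together weigh at most
  -- √η(|x|), like its parent by monotonicity.
  let t : V → V → ℝ := fun x y =>
    if G.dist v y = G.dist v x + 1 then (√(η (G.dist v x) : ℝ))⁻¹ else √(η (G.dist v y) : ℝ)
  have ht : ∀ x y, 0 < t x y := fun x y => by
    simp only [t]
    split_ifs
    · exact inv_pos.2 (hs _)
    · exact hs _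
  have htt : ∀ x y, G.Adj x y → t x y * t y x = 1 := fun x y hxy => by
    simp only [t]
    rcases dist_eq_of_adj hG v hxy with h | h
    · rw [if_pos h, if_neg (by omega), inv_mul_cancel₀ (hs _).ne']
    · rw [if_neg (by omega), if_pos h, mul_inv_cancel₀ (hs _).ne']
  have hsum : ∀ x, ∑ y ∈ G.neighborFinset x, ENNReal.ofReal (t x y) ≤
      ENNReal.ofReal (2 * √(η (G.dist v x) : ℝ)) := fun x => by
    rw [← ENNReal.ofReal_sum_of_nonneg fun y _ => (ht x y).le]
    refine ENNReal.ofReal_le_ofReal ?_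
    refine (sum_neighborFinset_le hG v x (g := t x) (inv_pos.2 (hs (G.dist v x))).le
      (hs (G.dist v x)).le (fun y _ hy => ?_) fun y _ hy => ?_).trans (le_of_eq ?_)
    · simp only [t, if_pos hy, le_refl]
    · simp only [t]
      rw [if_neg (by omega)]
      exact Real.sqrt_le_sqrt (by exact_mod_cast hmono (by omega))
    · rw [hη, ← div_eq_mul_inv, Real.div_sqrt]
      ring
  have key : 2 * ∑' x, (η (G.dist v x) : ℝ≥0∞) * ‖f x‖ₑ ^ 2 ≤ 2 * (energy G f +
      ∑' x, ENNReal.ofReal (2 * √(η (G.dist v x) : ℝ)) * ‖f x‖ₑ ^ 2) := by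
    calc 2 * ∑' x, (η (G.dist v x) : ℝ≥0∞) * ‖f x‖ₑ ^ 2
        = ∑' x, ∑ y ∈ G.neighborFinset x, (‖f x‖ₑ ^ 2 + ‖f y‖ₑ ^ 2) := by
          simp only [Finset.sum_add_distrib, ENNReal.tsum_add]
          rw [tsum_sum_neighborFinset_comm G fun _ y => ‖f y‖ₑ ^ 2,
            tsum_sum_neighborFinset_const]
          simp only [hη, two_mul]
      _ ≤ ∑' x, ∑ y ∈ G.neighborFinset x, (‖f x - f y‖ₑ ^ 2 +
            (ENNReal.ofReal (t x y) * ‖f x‖ₑ ^ 2 + ENNReal.ofReal (t y x) * ‖f y‖ₑ ^ 2)) := by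
          refine ENNReal.tsum_le_tsum fun x => Finset.sum_le_sum fun y hy => ?_
          exact add_enorm_sq_le (ht x y) (ht y x) (htt x y (by simpa using hy)) _ _
      _ = ∑' x, ∑ y ∈ G.neighborFinset x, ‖f x - f y‖ₑ ^ 2 +
            2 * ∑' x, (∑ y ∈ G.neighborFinset x, ENNReal.ofReal (t x y)) * ‖f x‖ₑ ^ 2 := by
          simp only [Finset.sum_add_distrib, ENNReal.tsum_add]
          rw [tsum_sum_neighborFinset_comm G fun x y => ENNReal.ofReal (t y x) * ‖f y‖ₑ ^ 2]
          simp only [two_mul, Finset.sum_mul]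
      _ ≤ 2 * energy G f +
            2 * ∑' x, ENNReal.ofReal (2 * √(η (G.dist v x) : ℝ)) * ‖f x‖ₑ ^ 2 := by
          refine add_le_add (le_of_eq ?_) (mul_le_mul_right
            (ENNReal.tsum_le_tsum fun x => mul_le_mul_left (hsum x) _) _)
          rw [energy, ← mul_assoc, ENNReal.mul_inv_cancel two_ne_zero ENNReal.ofNat_ne_top,
            one_mul]
      _ = _ := by rw [mul_add]
  exact (ENNReal.mul_le_mul_iff_right two_ne_zero ENNReal.ofNat_ne_top).1 key

/-- A form of the lower bound with non-negative coefficients. -/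
theorem tsum_sqrt_sub_one_sq_le (hG : G.IsTree) (hη : ∀ x, G.degree x = η (G.dist v x))
    (hmono : Monotone η) {f : V → ℂ} (hf : (Function.support f).Finite) :
    ∑' x, ENNReal.ofReal ((√(η (G.dist v x) : ℝ) - 1) ^ 2) * ‖f x‖ₑ ^ 2 ≤
      energy G f + normSq oneWeight f := by
  -- Finite support makes this sum finite, so that it can be cancelled using η + 1 = (√η - 1)² +
  -- 2√η.
  have hfin : ∑' x, ENNReal.ofReal (2 * √(η (G.dist v x) : ℝ)) * ‖f x‖ₑ ^ 2 ≠ ∞ := by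
    rw [tsum_eq_sum (s := hf.toFinset) fun x hx => by
      have : f x = 0 := by simpa using hx
      simp [this]]
    exact ENNReal.sum_ne_top.2 fun x _ => ENNReal.mul_ne_top ENNReal.ofReal_ne_top
      (ENNReal.pow_ne_top enorm_ne_top)
  have h := add_le_add_left (tsum_degree_le_energy_add hG hη hmono f) (normSq oneWeight f)
  refine (ENNReal.add_le_add_iff_right hfin).1 ?_
  refine le_trans (le_of_eq ?_) (h.trans (le_of_eq ?_))
  · rw [normSq, ← ENNReal.tsum_add, ← ENNReal.tsum_add]
    refine tsum_congr fun x => ?_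
    rw [← add_mul, ← add_mul, ← ENNReal.ofReal_add (sq_nonneg _) (by positivity),
      ← ENNReal.ofReal_natCast, ← ENNReal.ofReal_add (Nat.cast_nonneg _) (oneWeight x).2.le]
    congr 2
    have := Real.sq_sqrt (Nat.cast_nonneg (α := ℝ) (η (G.dist v x)))
    simp only [oneWeight]
    linear_combination this
  · ring

end Estimates
end RadialTree

namespace RadialTree

/-! ### Finite-dimensional test spaces and restriction maps -/

section TestSpaces

variable {V : Type u} {G : SimpleGraph V} [G.LocallyFinite] {m : V → {r : ℝ // 0 < r}}

local notation "⟪" x ", " y "⟫" => inner ℂ x y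

/-- A linear family of finitely supported functions, as elements of `ℓ²(V, m)`. -/
noncomputable def toL2 {W : Type*} [AddCommGroup W] [Module ℂ W] (m : V → {r : ℝ // 0 < r})
    (Ψ : W →ₗ[ℂ] V → ℂ) (hΨ : ∀ w, (Function.support (Ψ w)).Finite) : W →ₗ[ℂ] L2 m where
  toFun w := finL2 m (Ψ w) (hΨ w)
  map_add' w w' := L2.ext fun x => congrFun (map_add Ψ w w') x
  map_smul' c w := L2.ext fun x => congrFun (map_smul Ψ c w) x

theorem toL2_injective {W : Type*} [AddCommGroup W] [Module ℂ W] {Ψ : W →ₗ[ℂ] V → ℂ}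
    {hΨ : ∀ w, (Function.support (Ψ w)).Finite} (h : Function.Injective Ψ) :
    Function.Injective (toL2 m Ψ hΨ) := fun _ _ hw => h (congrArg Subtype.val hw)

/-- Finitely supported functions which satisfy the eigenvalue equation on their support. -/
theorem inner_laplacian_toL2_le {W : Type*} [AddCommGroup W] [Module ℂ W] {Ψ : W →ₗ[ℂ] V → ℂ}
    (hΨ : ∀ w, (Function.support (Ψ w)).Finite) {c : ℝ}
    (h : ∀ w x, Ψ w x ≠ 0 → algLaplacian G m (Ψ w) x = c * Ψ w x) (w : W) :
    ∃ hw : toL2 m Ψ hΨ w ∈ (laplacian G m).domain,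
      (⟪toL2 m Ψ hΨ w, laplacian G m ⟨toL2 m Ψ hΨ w, hw⟩⟫).re ≤ c * ‖toL2 m Ψ hΨ w‖ ^ 2 := by
  refine ⟨mem_domain_of_finite _ (hΨ w), le_of_eq ?_⟩
  have h1 : ⟪toL2 m Ψ hΨ w, laplacian G m ⟨toL2 m Ψ hΨ w, mem_domain_of_finite _ (hΨ w)⟩⟫ =
      ⟪toL2 m Ψ hΨ w, (c : ℂ) • toL2 m Ψ hΨ w⟫ := by
    rw [inner_eq_tsum, inner_eq_tsum]
    refine tsum_congr fun x => ?_
    change ((m x : ℝ) : ℂ) * (conj (Ψ w x) * algLaplacian G m (Ψ w) x) =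
      ((m x : ℝ) : ℂ) * (conj (Ψ w x) * (c * Ψ w x))
    -- Values of the Laplacian off the support are irrelevant: they are multiplied by zero.
    by_cases hx : Ψ w x = 0
    · rw [hx]
      simp
    · rw [h w x hx]
  rw [h1, inner_smul_right, inner_self_eq_norm_sq_to_K, Complex.re_ofReal_mul]
  norm_cast

/-- The functions on a finite set, extended by zero. -/
noncomputable def extendZero (S : Finset V) : (S → ℂ) →ₗ[ℂ] V → ℂ :=
  Function.ExtendByZero.linearMap ℂ ((↑) : S → V)

theorem extendZero_apply_mem {S : Finset V} (α : S → ℂ) {x : V} (hx : x ∈ S) :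
    extendZero S α x = α ⟨x, hx⟩ :=
  Subtype.val_injective.extend_apply α (0 : V → ℂ) (⟨x, hx⟩ : S)

theorem extendZero_apply_notMem {S : Finset V} (α : S → ℂ) {x : V} (hx : x ∉ S) :
    extendZero S α x = 0 :=
  Function.extend_apply' α (0 : V → ℂ) x fun ⟨y, hy⟩ => hx (hy ▸ y.2)

theorem support_extendZero_finite {S : Finset V} (α : S → ℂ) :
    (Function.support (extendZero S α)).Finite :=
  S.finite_toSet.subset fun _ hx => by
    by_contra h
    exact hx (extendZero_apply_notMem α h)

theorem extendZero_injective (S : Finset V) : Function.Injective (extendZero S) := fun α β h => by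
  funext x
  rw [← extendZero_apply_mem α x.2, h, extendZero_apply_mem]

/-- The restriction to a finite set. -/
noncomputable def restrictL (m : V → {r : ℝ // 0 < r}) (S : Finset V) : L2 m →ₗ[ℂ] (S → ℂ) :=
  LinearMap.pi fun x => (evalCLM m (x : V)).toLinearMap

end TestSpaces

/-! ### The combinatorial Laplacian -/

section Combinatorial

variable {V : Type u} {G : SimpleGraph V} [G.LocallyFinite] {η : ℕ → ℕ} {v : V}

local notation "⟪" x ", " y "⟫" => inner ℂ x y

/-- The sphere as a finset. -/
noncomputable def sphereFinset (hG : G.IsTree) (v : V) (n : ℕ) : Finset V :=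
  (sphere_finite hG v n).toFinset

theorem mem_sphereFinset {hG : G.IsTree} {n : ℕ} {x : V} :
    x ∈ sphereFinset hG v n ↔ G.dist v x = n := (sphere_finite hG v n).mem_toFinset

/-- The ball as a finset. -/
noncomputable def ballFinset (hG : G.IsTree) (v : V) (n : ℕ) : Finset V :=
  (ballBefore_finite hG v n).toFinset

theorem mem_ballFinset {hG : G.IsTree} {n : ℕ} {x : V} :
    x ∈ ballFinset hG v n ↔ G.dist v x < n := (ballBefore_finite hG v n).mem_toFinset

theorem finrank_sphereFinset (hG : G.IsTree) (v : V) (n : ℕ) :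
    Module.finrank ℂ (sphereFinset hG v n → ℂ) = (sphere G v n).ncard := by
  rw [Module.finrank_fintype_fun_eq_card, Fintype.card_coe, sphereFinset,
    Set.ncard_eq_toFinset_card _ (sphere_finite hG v n)]

theorem finrank_ballFinset (hG : G.IsTree) (v : V) (n : ℕ) :
    Module.finrank ℂ (ballFinset hG v n → ℂ) = (ballBefore G v n).ncard := by
  rw [Module.finrank_fintype_fun_eq_card, Fintype.card_coe, ballFinset,
    Set.ncard_eq_toFinset_card _ (ballBefore_finite hG v n)]

/-- Adjacent vertices lie on different spheres, so no neighbour contributes and only the degree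
remains. -/
theorem algLaplacian_extendZero_sphere (hG : G.IsTree) (hη : ∀ x, G.degree x = η (G.dist v x))
    {n : ℕ} (α : sphereFinset hG v n → ℂ) {x : V} (hx : extendZero _ α x ≠ 0) :
    algLaplacian G oneWeight (extendZero _ α) x = ((η n : ℝ) : ℂ) * extendZero _ α x := by
  have hxn : G.dist v x = n := by
    by_contra h
    exact hx (extendZero_apply_notMem α fun h' => h (mem_sphereFinset.1 h'))
  simp only [algLaplacian, LinearMap.coe_mk, AddHom.coe_mk, oneWeight]
  rw [Finset.sum_congr rfl (g := fun _ => extendZero _ α x)]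
  · rw [Finset.sum_const, G.card_neighborFinset_eq_degree, hη, hxn]
    simp
  · intro y hy
    have hy' : G.dist v y ≠ n := by
      rw [← hxn]
      rcases dist_eq_of_adj hG v ((G.mem_neighborFinset x y).1 hy) with h | h <;> omega
    rw [extendZero_apply_notMem α fun h' => hy' (mem_sphereFinset.1 h'), sub_zero]

theorem le_ncard_ballBefore [Infinite V] (hG : G.IsTree) (v : V) (n : ℕ) :
    n ≤ (ballBefore G v n).ncard := by
  induction n with
  | zero => exact Nat.zero_le _
  | succ n ih =>
    have := (Set.ncard_pos (sphere_finite hG v n)).2 (sphere_nonempty hG v n)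
    rw [ncard_ballBefore_succ hG]
    omega

/-- Completing the square exhibits the coefficient as increasing in √n ≥ 1, and as a non-negative
one after the shift by 1 of the form. -/
theorem coeff_eq {n : ℕ} (hn : 1 ≤ n) :
    (n : ℝ) * (1 - 2 * √(1 / (n : ℝ))) = (√(n : ℝ) - 1) ^ 2 - 1 := by
  have hn' : (0 : ℝ) < n := by exact_mod_cast hn
  have h1 : (n : ℝ) * √(1 / (n : ℝ)) = √n := by
    rw [Real.sqrt_div zero_le_one, Real.sqrt_one, mul_one_div, Real.div_sqrt]
  have h2 := Real.sq_sqrt hn'.le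
  linear_combination (-2) * h1 - h2

theorem one_le_sqrt_natCast {n : ℕ} (hn : 1 ≤ n) : 1 ≤ √(n : ℝ) := by
  rw [Real.one_le_sqrt]
  exact_mod_cast hn

theorem monotone_of_monotone_coeff (h1 : ∀ n, 1 ≤ η n)
    (h : Monotone fun n : ℕ => (η n : ℝ) * (1 - 2 * √(1 / (η n : ℝ)))) : Monotone η := by
  intro a c hac
  have h2 := h hac
  simp only [coeff_eq (h1 _)] at h2
  have ha := one_le_sqrt_natCast (h1 a)
  have hc := one_le_sqrt_natCast (h1 c)
  have h3 : √(η a : ℝ) ≤ √(η c : ℝ) := by nlinarith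
  exact_mod_cast (Real.sqrt_le_sqrt_iff (Nat.cast_nonneg _)).1 h3

variable [Infinite V]

/-- The energy bound on the form domain, with the coefficient replaced by its least value outside
the ball. It serves twice: for compactness of the resolvent and for the lower eigenvalue bounds. -/
theorem sqrt_sub_one_sq_mul_tail_le (hG : G.IsTree) (hη : ∀ x, G.degree x = η (G.dist v x))
    (hmono : Monotone η) (n : ℕ) (f : (laplacian G (oneWeight : V → {r : ℝ // 0 < r})).domain) :
    (√(η n : ℝ) - 1) ^ 2 *
      ‖(f : L2 (oneWeight : V → {r : ℝ // 0 < r})) - truncCLM oneWeight (ballFinset hG v n) f‖ ^ 2 ≤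
      (⟪(f : L2 (oneWeight : V → {r : ℝ // 0 < r})), laplacian G oneWeight f⟫).re +
      ‖(f : L2 (oneWeight : V → {r : ℝ // 0 < r}))‖ ^ 2 := by
  classical
  have h := weighted_le_of_mem_formDomain (fun x => ENNReal.ofReal_ne_top)
    (fun φ hφ => tsum_sqrt_sub_one_sq_le hG hη hmono hφ) f.2.1
  rw [energy_eq_inner, normSq_coe, ← ENNReal.ofReal_add (inner_laplacian_nonneg f)
    (sq_nonneg _)] at h
  rw [← ENNReal.ofReal_le_ofReal_iff (add_nonneg (inner_laplacian_nonneg f) (sq_nonneg _))]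
  refine le_trans ?_ h
  rw [ENNReal.ofReal_mul (sq_nonneg _), ofReal_norm_sub_truncCLM_sq, ← ENNReal.tsum_mul_left]
  refine ENNReal.tsum_le_tsum fun x => ?_
  split_ifs with hx
  · simp
  · rw [mem_ballFinset, not_lt] at hx
    simp only [oneWeight, ENNReal.ofReal_one, one_mul]
    refine mul_le_mul_left (ENNReal.ofReal_le_ofReal ?_) _
    have h1 := one_le_sqrt_natCast (one_le_radialDegree hG hη n)
    have h2 : √(η n : ℝ) ≤ √(η (G.dist v x) : ℝ) :=
      Real.sqrt_le_sqrt (by exact_mod_cast hmono hx)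
    exact pow_le_pow_left₀ (by linarith) (by linarith) 2

theorem tendsto_sqrt_natCast (ht : Tendsto η atTop atTop) :
    Tendsto (fun n => √(η n : ℝ)) atTop atTop :=
  Real.tendsto_sqrt_atTop.comp (tendsto_natCast_atTop_atTop.comp ht)

omit [G.LocallyFinite] [Infinite V] in
theorem truncCLM_eq_zero {m : V → {r : ℝ // 0 < r}} {S : Finset V} {f : L2 m}
    (h : restrictL m S f = 0) : truncCLM m S f = 0 := by
  classical
  ext x
  rw [truncCLM_apply, zero_apply]
  split_ifs with hx
  · exact congrFun h ⟨x, hx⟩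
  · rfl

/-- The spectrum of the combinatorial Laplacian of a radial tree. -/
theorem combinatorial_spectrum (hG : G.IsTree) (hη : ∀ x, G.degree x = η (G.dist v x))
    (hm : Monotone (fun n : ℕ => (η n : ℝ) * (1 - 2 * √(1 / (η n : ℝ)))))
    (ht : Tendsto η atTop atTop) :
    essSpectrum (laplacian G (oneWeight : V → {r : ℝ // 0 < r})) = ∅ ∧
      ∃ lam : ℕ → ℝ,
        IsEigenvalueList (laplacian G (oneWeight : V → {r : ℝ // 0 < r})) lam ∧
        Tendsto lam atTop atTop ∧
        spectrum (laplacian G (oneWeight : V → {r : ℝ // 0 < r})) =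
          {z : ℂ | ∃ i : ℕ, z = ((lam i : ℝ) : ℂ)} ∧
        (∀ n : ℕ, (η n : ℝ) * (1 - 2 * √(1 / (η n : ℝ))) ≤ lam (ballBefore G v n).ncard) ∧
        (∀ n : ℕ, (ballBefore G v n).ncard + 1 ≤ (sphere G v n).ncard →
          lam (ballBefore G v n).ncard ≤ η n) ∧
        (∃ n₀ : ℕ, ∀ n : ℕ, n₀ ≤ n → lam (ballBefore G v n).ncard ≤ η n) := by
  have h1 : ∀ n, 1 ≤ η n := one_le_radialDegree hG hη
  have hmono := monotone_of_monotone_coeff h1 hm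
  obtain ⟨ι, b, μ, hT, hμ, hfin⟩ := exists_isDiagonalizedBy (G := G)
    (m := (oneWeight : V → {r : ℝ // 0 < r})) 0 (fun ε hε => by
      -- Then (√η(n) - 1)² ≥ ε⁻², so the squared tail is at most ε² times the squared form norm.
      obtain ⟨n, hn⟩ := ((tendsto_sqrt_natCast ht).eventually_ge_atTop (ε⁻¹ + 1)).exists
      refine ⟨ballFinset hG v n, fun f => ?_⟩
      have h2 := sqrt_sub_one_sq_mul_tail_le hG hη hmono n f
      have h3 := norm_le_norm_laplacian_add f
      rw [Complex.ofReal_zero, zero_smul, sub_zero]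
      rw [← sq_le_sq₀ (norm_nonneg _) (by positivity), mul_pow]
      have h4 : (ε⁻¹) ^ 2 ≤ (√(η n : ℝ) - 1) ^ 2 :=
        pow_le_pow_left₀ (by positivity) (by linarith) 2
      have h5 := (mul_le_mul_of_nonneg_right h4 (sq_nonneg _)).trans (h2.trans
        ((add_comm _ _).trans_le h3))
      rw [inv_pow, inv_mul_le_iff₀ (by positivity)] at h5
      exact h5)
  have hfinc : ∀ c : ℝ, {i | μ i ≤ c}.Finite := fun c => by
    refine (hfin (|c| + 1)⁻¹ (by positivity)).subset fun i hi => ?_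
    have hi' : μ i ≤ c := hi
    have hp : 0 < μ i + 1 := by linarith [hμ i]
    rw [Set.mem_ofPred_eq, sub_zero, abs_of_pos (inv_pos.2 hp)]
    exact inv_anti₀ hp (by linarith [le_abs_self c])
  -- The entries accumulate nowhere, so every spectral point is discrete.
  have hball : ∀ z : ℂ, {i | ‖(μ i : ℂ) - z‖ < 1}.Finite := fun z => by
    refine (hfinc (‖z‖ + 1)).subset fun i hi => ?_
    have hi' : ‖(μ i : ℂ) - z‖ < 1 := hi
    have h2 := norm_sub_norm_le (μ i : ℂ) z
    rw [Complex.norm_real, Real.norm_of_nonneg (hμ i)] at h2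
    change μ i ≤ ‖z‖ + 1
    linarith
  have hess : essSpectrum (laplacian G (oneWeight : V → {r : ℝ // 0 < r})) = ∅ := by
    rw [essSpectrum, Set.sdiff_eq_empty]
    exact fun z hz => hT.mem_discreteSpectrum hz one_pos (hball z)
  have hinfE : infEssSpectrum (laplacian G (oneWeight : V → {r : ℝ // 0 < r})) = ⊤ := by
    rw [infEssSpectrum, hess, Set.image_empty, sInf_empty]
  have hext : ∀ n (α : sphereFinset hG v n → ℂ), (Function.support (extendZero _ α)).Finite :=
    fun n α => support_extendZero_finite α
  have hinf : {i | (μ i : EReal) <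
      infEssSpectrum (laplacian G (oneWeight : V → {r : ℝ // 0 < r}))}.Infinite := by
    refine hT.infinite_setOf_lt fun k => ?_
    obtain ⟨n, hn, hkn⟩ :=
      ((eventually_ncard_ballBefore_lt hG hη ht).and (eventually_ge_atTop k)).exists
    refine ⟨sphereFinset hG v n → ℂ, inferInstance, inferInstance, toL2 _ _ (hext n), η n, ?_,
      toL2_injective (extendZero_injective _), ?_, inner_laplacian_toL2_le (hext n)
        fun α x => algLaplacian_extendZero_sphere hG hη α⟩
    · rw [finrank_sphereFinset]
      have := le_ncard_ballBefore hG v n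
      omega
    · rw [hinfE]
      exact EReal.coe_lt_top _
  obtain ⟨e, he⟩ := hT.exists_isEigenvalueList (fun c _ => hfinc c) hinf
  have hupper : ∀ n : ℕ, (ballBefore G v n).ncard + 1 ≤ (sphere G v n).ncard →
      μ (e (ballBefore G v n).ncard) ≤ η n := fun n hn => by
    refine hT.enumeration_le he.mono (toL2 _ _ (hext n))
      (toL2_injective (extendZero_injective _)) ?_ ?_ (inner_laplacian_toL2_le (hext n)
        fun α x => algLaplacian_extendZero_sphere hG hη α)
    · rw [finrank_sphereFinset]
      omega
    · rw [hinfE]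
      exact EReal.coe_lt_top _
  refine ⟨hess, fun n => μ (e n), he, ?_, ?_, fun n => ?_, hupper, ?_⟩
  · refine tendsto_atTop.2 fun c => ?_
    filter_upwards [IsDiagonalizedBy.eventually_lt_enumeration (e := e) (hfinc c)] with n hn
    exact hn.le
  · ext z
    constructor
    · intro hz
      obtain ⟨i, hi⟩ := hT.exists_eq_of_mem_spectrum hz one_pos (hball z)
      refine ⟨e.symm ⟨i, ?_⟩, ?_⟩
      · change (μ i : EReal) < _
        rw [hinfE]
        exact EReal.coe_lt_top _
      · simp [hi]
    · rintro ⟨n, rfl⟩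
      exact hT.mem_spectrum _
  -- On the kernel of the restriction to the ball the truncation vanishes, and the -1 of `coeff_eq`
  -- absorbs the term ‖f‖².
  · refine hT.le_enumeration he.mono (restrictL _ (ballFinset hG v n))
      (finrank_ballFinset hG v n).le fun f hf => ?_
    have h2 := sqrt_sub_one_sq_mul_tail_le hG hη hmono n f
    rw [truncCLM_eq_zero hf, sub_zero] at h2
    rw [coeff_eq (h1 n)]
    linarith
  · obtain ⟨n₀, hn₀⟩ := eventually_atTop.1 (eventually_ncard_ballBefore_lt hG hη ht)
    exact ⟨n₀, fun n hn => hupper n (hn₀ n hn)⟩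

end Combinatorial
end RadialTree

namespace RadialTree

/-! ### The normalized Laplacian: symmetry, tails, lower bound and test functions -/

section Normalized

variable {V : Type u} {G : SimpleGraph V} [G.LocallyFinite] [Infinite V] {η : ℕ → ℕ} {v : V}

local notation "⟪" x ", " y "⟫" => inner ℂ x y

theorem degree_ne_zero (hG : G.IsTree) (x : V) : (G.degree x : ℂ) ≠ 0 :=
  Nat.cast_ne_zero.2 (hG.connected.preconnected.degree_pos_of_nontrivial x).ne'

theorem algLaplacian_degreeWeight (hG : G.IsTree) (f : V → ℂ) (x : V) :
    algLaplacian G (degreeWeight G hG) f x =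
      f x - (G.degree x : ℂ)⁻¹ * ∑ y ∈ G.neighborFinset x, f y := by
  have h := degree_ne_zero hG x
  simp only [algLaplacian, LinearMap.coe_mk, AddHom.coe_mk, degreeWeight, Finset.sum_sub_distrib,
    Finset.sum_const, G.card_neighborFinset_eq_degree, nsmul_eq_mul, Complex.ofReal_natCast]
  field_simp

theorem mem_domain_degreeWeight_iff (hG : G.IsTree) {f : L2 (degreeWeight G hG)} :
    f ∈ (laplacian G (degreeWeight G hG)).domain ↔
      algLaplacian G (degreeWeight G hG) f ∈ l2Submodule (degreeWeight G hG) :=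
  ⟨fun h => h.2, fun h => ⟨by
    rw [formDomain_eq_top fun x => le_rfl]
    exact Submodule.mem_top, h⟩⟩

/-- The spectrum of the normalized Laplacian is symmetric, as a tree is bipartite. -/
theorem exists_reflected_eigenvector (hG : G.IsTree) (v : V) {z : ℂ}
    (f : (laplacian G (degreeWeight G hG)).domain)
    (hf : (f : L2 (degreeWeight G hG)) ≠ 0)
    (h : laplacian G (degreeWeight G hG) f = z • (f : L2 (degreeWeight G hG))) :
    ∃ g : (laplacian G (degreeWeight G hG)).domain, (g : L2 (degreeWeight G hG)) ≠ 0 ∧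
      laplacian G (degreeWeight G hG) g = (2 - z) • (g : L2 (degreeWeight G hG)) := by
  let u : V → ℂ := fun x => (-1) ^ G.dist v x * (f : L2 (degreeWeight G hG)) x
  have hu : u ∈ l2Submodule (degreeWeight G hG) := by
    refine Summable.congr (f : L2 (degreeWeight G hG)).2 fun x => ?_
    simp [u]
  have hlap : algLaplacian G (degreeWeight G hG) u = (2 - z) • u := by
    funext x
    have h1 : algLaplacian G (degreeWeight G hG) (f : L2 (degreeWeight G hG)) x =
        z * (f : L2 (degreeWeight G hG)) x := congrArg (fun g : L2 (degreeWeight G hG) => g x) h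
    rw [algLaplacian_degreeWeight] at h1 ⊢
    -- Every neighbour carries the opposite sign, so the averaging operator changes sign under the
    -- reflection.
    have h2 : ∑ y ∈ G.neighborFinset x, u y =
        -((-1) ^ G.dist v x * ∑ y ∈ G.neighborFinset x, (f : L2 (degreeWeight G hG)) y) := by
      rw [Finset.mul_sum, ← Finset.sum_neg_distrib]
      refine Finset.sum_congr rfl fun y hy => ?_
      rcases dist_eq_of_adj hG v ((G.mem_neighborFinset x y).1 hy) with hd | hd <;>
      · simp only [u, hd, pow_succ]
        ring
    rw [h2]
    simp only [u, Pi.smul_apply, smul_eq_mul]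
    linear_combination (-(-1) ^ G.dist v x) * h1
  have hd : (⟨u, hu⟩ : L2 (degreeWeight G hG)) ∈ (laplacian G (degreeWeight G hG)).domain := by
    refine (mem_domain_degreeWeight_iff hG).2 ?_
    change algLaplacian G (degreeWeight G hG) u ∈ _
    rw [hlap]
    exact Submodule.smul_mem _ _ hu
  refine ⟨⟨⟨u, hu⟩, hd⟩, fun h0 => hf (L2.ext fun x => ?_), Subtype.ext hlap⟩
  have h1 : u x = 0 := congrArg (fun g : L2 (degreeWeight G hG) => g x) h0
  exact (mul_eq_zero.1 h1).resolve_left (pow_ne_zero _ (by norm_num))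

/-- The weighted Cauchy-Schwarz inequality for the sum over the neighbours of a vertex. -/
theorem norm_sum_neighborFinset_sq_le (hG : G.IsTree) (v x : V) (f : V → ℂ) :
    (G.degree x : ℝ) * ‖(G.degree x : ℂ)⁻¹ * ∑ y ∈ G.neighborFinset x, f y‖ ^ 2 ≤
      ∑ y ∈ G.neighborFinset x,
        (if G.dist v y = G.dist v x + 1 then 2 else 2 * (G.degree x : ℝ)⁻¹) * ‖f y‖ ^ 2 := by
  have hd : (0 : ℝ) < G.degree x :=
    Nat.cast_pos.2 (hG.connected.preconnected.degree_pos_of_nontrivial x)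
  -- The parent gets the weight of all children together. The total at most doubles, while the
  -- parent's value enters with the small coefficient 2 / deg x, needed because it is shared by all
  -- its children.
  let w : V → ℝ := fun y => if G.dist v y = G.dist v x + 1 then 1 else (G.degree x : ℝ)
  have hw : ∀ y, 0 < w y := fun y => by
    simp only [w]
    split_ifs
    · exact one_pos
    · exact hd
  have h1 : ∑ y ∈ G.neighborFinset x, w y ≤ 2 * G.degree x := by
    refine (sum_neighborFinset_le hG v x zero_le_one hd.le (fun y _ hy => ?_)
      fun y _ hy => ?_).trans (le_of_eq ?_)
    · simp only [w, if_pos hy, le_refl]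
    · simp only [w]
      rw [if_neg (by omega)]
    · ring
  have h2 := Finset.sum_sq_le_sum_mul_sum_of_sq_le_mul (G.neighborFinset x) (r := fun y => ‖f y‖)
    (f := w) (g := fun y => (w y)⁻¹ * ‖f y‖ ^ 2) (fun y _ => (hw y).le)
    (fun y _ => mul_nonneg (inv_pos.2 (hw y)).le (sq_nonneg _))
    (fun y _ => (mul_inv_cancel_left₀ (hw y).ne' _).ge)
  have h3 : ‖∑ y ∈ G.neighborFinset x, f y‖ ^ 2 ≤ (∑ y ∈ G.neighborFinset x, ‖f y‖) ^ 2 :=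
    pow_le_pow_left₀ (norm_nonneg _) (norm_sum_le _ _) 2
  have h4 : 0 ≤ ∑ y ∈ G.neighborFinset x, (w y)⁻¹ * ‖f y‖ ^ 2 :=
    Finset.sum_nonneg fun y _ => mul_nonneg (inv_pos.2 (hw y)).le (sq_nonneg _)
  have h5 := h3.trans (h2.trans (mul_le_mul_of_nonneg_right h1 h4))
  have h6 : ∑ y ∈ G.neighborFinset x,
      (if G.dist v y = G.dist v x + 1 then 2 else 2 * (G.degree x : ℝ)⁻¹) * ‖f y‖ ^ 2 =
      2 * ∑ y ∈ G.neighborFinset x, (w y)⁻¹ * ‖f y‖ ^ 2 := by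
    rw [Finset.mul_sum]
    refine Finset.sum_congr rfl fun y _ => ?_
    simp only [w]
    split_ifs <;> ring
  rw [h6, norm_mul, mul_pow, norm_inv, Complex.norm_natCast]
  calc (G.degree x : ℝ) * ((G.degree x : ℝ)⁻¹ ^ 2 * ‖∑ y ∈ G.neighborFinset x, f y‖ ^ 2)
      = (G.degree x : ℝ)⁻¹ * ‖∑ y ∈ G.neighborFinset x, f y‖ ^ 2 := by
        field_simp
    _ ≤ (G.degree x : ℝ)⁻¹ * (2 * G.degree x * ∑ y ∈ G.neighborFinset x, (w y)⁻¹ * ‖f y‖ ^ 2) :=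
        mul_le_mul_of_nonneg_left h5 (inv_pos.2 hd).le
    _ = _ := by field_simp

/-- The averaging operator has uniformly small tails. -/
theorem tail_average_le (hG : G.IsTree) (hη : ∀ x, G.degree x = η (G.dist v x))
    (hmono : Monotone η) (n : ℕ) (f : (laplacian G (degreeWeight G hG)).domain) :
    ‖((f : L2 (degreeWeight G hG)) - laplacian G (degreeWeight G hG) f) -
      truncCLM _ (ballFinset hG v (n + 1))
        ((f : L2 (degreeWeight G hG)) - laplacian G (degreeWeight G hG) f)‖ ^ 2 ≤
      4 / η n * ‖(f : L2 (degreeWeight G hG))‖ ^ 2 := by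
  classical
  set u := (f : L2 (degreeWeight G hG)) with hu
  have h1 : ∀ n, (1 : ℝ) ≤ η n := fun n => by exact_mod_cast one_le_radialDegree hG hη n
  have hn0 : (0 : ℝ) < η n := by linarith [h1 n]
  have happ : ∀ x, (u - laplacian G (degreeWeight G hG) f) x =
      (G.degree x : ℂ)⁻¹ * ∑ y ∈ G.neighborFinset x, u y := fun x => by
    rw [sub_apply]
    change u x - algLaplacian G (degreeWeight G hG) u x = _
    rw [algLaplacian_degreeWeight]
    ring
  -- c x y is the coefficient of |u(y)|² in the contribution of x to the tail.
  let c : V → V → ℝ := fun x y => if n + 1 ≤ G.dist v x then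
    (if G.dist v y = G.dist v x + 1 then 2 else 2 * (G.degree x : ℝ)⁻¹) else 0
  have hc : ∀ x y, 0 ≤ c x y := fun x y => by
    simp only [c]
    split_ifs <;> positivity
  -- Schur-type estimate: the children of y give at most deg y · 2 / deg y and its parent at most 2.
  -- Only y with |y| ≥ n occur, as x lies beyond radius n, and for these 4 ≤ (4 / η(n)) deg y.
  have hsum : ∀ y, ∑ x ∈ G.neighborFinset y, c x y ≤ 4 / η n * G.degree y := fun y => by
    by_cases hy : n ≤ G.dist v y
    · have hle : (η n : ℝ) ≤ G.degree y := by
        rw [hη]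
        exact_mod_cast hmono hy
      have hd : (0 : ℝ) < G.degree y := hn0.trans_le hle
      refine (sum_neighborFinset_le hG v y (a := 2 * (G.degree y : ℝ)⁻¹) (c := 2)
        (by positivity) zero_le_two (fun x _ hx => ?_) fun x _ hx => ?_).trans ?_
      · simp only [c]
        rw [if_pos (by omega), if_neg (by omega)]
        refine mul_le_mul_of_nonneg_left (inv_anti₀ hd ?_) zero_le_two
        rw [hη, hη]
        exact_mod_cast hmono (by omega)
      · simp only [c]
        split_ifs with h2
        · exact le_rfl
        · exact zero_le_two
      · rw [div_mul_eq_mul_div, le_div_iff₀ hn0]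
        have : (G.degree y : ℝ) * (2 * (G.degree y : ℝ)⁻¹) + 2 = 4 := by
          field_simp
          norm_num
        rw [this]
        linarith
    · rw [Finset.sum_eq_zero]
      · positivity
      · intro x hx
        simp only [c]
        rw [if_neg]
        rcases dist_eq_of_adj hG v ((G.mem_neighborFinset y x).1 hx) with h | h <;> omega
  rw [← ENNReal.ofReal_le_ofReal_iff (by positivity), ofReal_norm_sub_truncCLM_sq,
    ENNReal.ofReal_mul (by positivity), ← normSq_coe, normSq]
  calc _ ≤ ∑' x, ∑ y ∈ G.neighborFinset x, ENNReal.ofReal (c x y) * ‖u y‖ₑ ^ 2 := by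
        refine ENNReal.tsum_le_tsum fun x => ?_
        split_ifs with hx
        · exact zero_le
        · rw [mem_ballFinset, not_lt] at hx
          rw [← ofReal_mul_norm_sq _ (degreeWeight G hG x).2.le, happ]
          refine (ENNReal.ofReal_le_ofReal (norm_sum_neighborFinset_sq_le hG v x u)).trans
            (le_of_eq ?_)
          rw [ENNReal.ofReal_sum_of_nonneg]
          · refine Finset.sum_congr rfl fun y _ => ?_
            rw [← ofReal_mul_norm_sq _ (hc x y)]
            simp only [c, if_pos hx]
          · intro y _
            split_ifs <;> positivity
    _ = ∑' x, (∑ y ∈ G.neighborFinset x, ENNReal.ofReal (c y x)) * ‖u x‖ₑ ^ 2 := by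
        rw [tsum_sum_neighborFinset_comm G fun x y => ENNReal.ofReal (c x y) * ‖u y‖ₑ ^ 2]
        simp only [Finset.sum_mul]
    _ ≤ ∑' x, ENNReal.ofReal (4 / η n) *
          (ENNReal.ofReal (degreeWeight G hG x) * ‖u x‖ₑ ^ 2) := by
        refine ENNReal.tsum_le_tsum fun x => ?_
        rw [← mul_assoc, ← ENNReal.ofReal_mul (by positivity),
          ← ENNReal.ofReal_sum_of_nonneg fun y _ => hc y x]
        exact mul_le_mul_left (ENNReal.ofReal_le_ofReal (hsum x)) _
    _ = _ := ENNReal.tsum_mul_left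

/-- The lower bound for the form of the normalized Laplacian outside of a ball. -/
theorem le_inner_laplacian_degreeWeight (hG : G.IsTree)
    (hη : ∀ x, G.degree x = η (G.dist v x)) (hmono : Monotone η) (n : ℕ)
    (f : (laplacian G (degreeWeight G hG)).domain)
    (hf : restrictL _ (ballFinset hG v n) (f : L2 (degreeWeight G hG)) = 0) :
    (1 - 2 * √(1 / (η n : ℝ))) * ‖(f : L2 (degreeWeight G hG))‖ ^ 2 ≤
      (⟪(f : L2 (degreeWeight G hG)), laplacian G (degreeWeight G hG) f⟫).re := by
  set u := (f : L2 (degreeWeight G hG)) with hu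
  have h1 : (0 : ℝ) < η n := by exact_mod_cast one_le_radialDegree hG hη n
  have h := tsum_degree_le_energy_add hG hη hmono u
  have hnorm : ∑' x, (η (G.dist v x) : ℝ≥0∞) * ‖u x‖ₑ ^ 2 = ENNReal.ofReal (‖u‖ ^ 2) := by
    rw [← normSq_coe]
    refine tsum_congr fun x => ?_
    rw [degreeWeight, ENNReal.ofReal_natCast, hη]
  have hle : ∑' x, ENNReal.ofReal (2 * √(η (G.dist v x) : ℝ)) * ‖u x‖ₑ ^ 2 ≤
      ENNReal.ofReal (2 * √(1 / (η n : ℝ))) * ENNReal.ofReal (‖u‖ ^ 2) := by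
    rw [← hnorm, ← ENNReal.tsum_mul_left]
    refine ENNReal.tsum_le_tsum fun x => ?_
    by_cases hx : G.dist v x < n
    · have : u x = 0 := congrFun hf ⟨x, mem_ballFinset.2 hx⟩
      simp [this]
    · rw [← mul_assoc, ← ENNReal.ofReal_natCast, ← ENNReal.ofReal_mul (by positivity)]
      refine mul_le_mul_left (ENNReal.ofReal_le_ofReal ?_) _
      -- Outside the ball √η = η / √η ≤ η / √η(n), which compares the error term with the weighted
      -- norm.
      rw [mul_assoc]
      refine mul_le_mul_of_nonneg_left ?_ zero_le_two
      have h2 : (η n : ℝ) ≤ η (G.dist v x) := by exact_mod_cast hmono (not_lt.1 hx)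
      rw [Real.sqrt_div zero_le_one, Real.sqrt_one, div_mul_eq_mul_div, one_mul,
        le_div_iff₀ (Real.sqrt_pos.2 h1)]
      calc √(η (G.dist v x) : ℝ) * √(η n : ℝ) ≤
            √(η (G.dist v x) : ℝ) * √(η (G.dist v x) : ℝ) :=
            mul_le_mul_of_nonneg_left (Real.sqrt_le_sqrt h2) (Real.sqrt_nonneg _)
        _ = _ := Real.mul_self_sqrt (Nat.cast_nonneg _)
  rw [hnorm, energy_eq_inner] at h
  have h2 := h.trans (add_le_add_right hle _)
  rw [← ENNReal.ofReal_mul (by positivity), ← ENNReal.ofReal_add (inner_laplacian_nonneg f)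
    (by positivity), ENNReal.ofReal_le_ofReal_iff
      (add_nonneg (inner_laplacian_nonneg f) (by positivity))] at h2
  linarith

/-! ### The test space for the upper bound -/

/-- The ratio of the upper bound. -/
noncomputable def testRatio (η : ℕ → ℕ) (n : ℕ) : ℝ :=
  √(((η n : ℝ) - 1) / (η n * η (n + 1)))

open Classical in
/-- The functions living on two consecutive spheres which are, on their support, eigenfunctions of
the averaging operator for the eigenvalue `testRatio η n`. -/
noncomputable def twoSpheres (hG : G.IsTree) (v : V) (η : ℕ → ℕ) (n : ℕ) :
    (sphereFinset hG v n → ℂ) →ₗ[ℂ] V → ℂ where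
  toFun α x := if G.dist v x = n then ((testRatio η n * η (n + 1) : ℝ) : ℂ) * extendZero _ α x
    -- The sum retains only the value at the parent, the other neighbours being outside S_n.
    else if G.dist v x = n + 1 then ∑ y ∈ G.neighborFinset x, extendZero _ α y else 0
  map_add' α β := by
    funext x
    simp only [map_add, Pi.add_apply, Finset.sum_add_distrib]
    split_ifs
    · ring
    · rfl
    · simp
  map_smul' c α := by
    funext x
    simp only [map_smul, Pi.smul_apply, smul_eq_mul, RingHom.id_apply, ← Finset.mul_sum]
    split_ifs
    · ring
    · rfl
    · simp

omit [Infinite V] in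
theorem twoSpheres_finite (hG : G.IsTree) (v : V) (η : ℕ → ℕ) (n : ℕ)
    (α : sphereFinset hG v n → ℂ) : (Function.support (twoSpheres hG v η n α)).Finite := by
  refine (ballFinset hG v (n + 2)).finite_toSet.subset fun x hx => ?_
  rw [SetLike.mem_coe, mem_ballFinset]
  by_contra h
  refine hx ?_
  simp only [twoSpheres, LinearMap.coe_mk, AddHom.coe_mk]
  rw [if_neg (by omega), if_neg (by omega)]

theorem testRatio_pos {n : ℕ} (h2 : 2 ≤ η n) (h1 : 1 ≤ η (n + 1)) : 0 < testRatio η n := by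
  have h2' : (2 : ℝ) ≤ η n := by exact_mod_cast h2
  have h1' : (1 : ℝ) ≤ η (n + 1) := by exact_mod_cast h1
  exact Real.sqrt_pos.2 (div_pos (by linarith) (by positivity))

omit [Infinite V] in
theorem twoSpheres_injective (hG : G.IsTree) (v : V) {n : ℕ} (h2 : 2 ≤ η n)
    (h1 : 1 ≤ η (n + 1)) : Function.Injective (twoSpheres hG v η n) := fun α β h => by
  funext x
  have hx := mem_sphereFinset.1 x.2
  have h3 := congrFun h x
  have h4 : ((testRatio η n * η (n + 1) : ℝ) : ℂ) ≠ 0 :=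
    Complex.ofReal_ne_zero.2 (mul_pos (testRatio_pos h2 h1) (by exact_mod_cast h1)).ne'
  simp only [twoSpheres, LinearMap.coe_mk, AddHom.coe_mk, if_pos hx] at h3
  rw [extendZero_apply_mem α x.2, extendZero_apply_mem β x.2] at h3
  exact mul_left_cancel₀ h4 h3

/-- With ratio r and amplitude c on S_n, averaging at S_{n+1} requires c = r·η(n+1), and averaging
over the η(n) - 1 children at S_n requires r·c = (η(n) - 1)/η(n); this determines `testRatio`. The
root is excluded because all its neighbours are children. -/
theorem algLaplacian_twoSpheres (hG : G.IsTree) (hη : ∀ x, G.degree x = η (G.dist v x)) {n : ℕ}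
    (hn : n ≠ 0) (h2 : 2 ≤ η n) (h1 : 1 ≤ η (n + 1)) (α : sphereFinset hG v n → ℂ) (x : V)
    (hx : twoSpheres hG v η n α x ≠ 0) :
    algLaplacian G (degreeWeight G hG) (twoSpheres hG v η n α) x =
      ((1 - testRatio η n : ℝ) : ℂ) * twoSpheres hG v η n α x := by
  classical
  have hsq : testRatio η n * (testRatio η n * η (n + 1)) * η n = η n - 1 := by
    have h2' : (2 : ℝ) ≤ η n := by exact_mod_cast h2
    have h1' : (1 : ℝ) ≤ η (n + 1) := by exact_mod_cast h1
    have : testRatio η n ^ 2 = ((η n : ℝ) - 1) / (η n * η (n + 1)) :=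
      Real.sq_sqrt (div_nonneg (by linarith) (by positivity))
    rw [show testRatio η n * (testRatio η n * η (n + 1)) * η n =
      testRatio η n ^ 2 * (η n * η (n + 1)) by ring, this]
    field_simp
  have happ : ∀ y, twoSpheres hG v η n α y =
      if G.dist v y = n then ((testRatio η n * η (n + 1) : ℝ) : ℂ) * extendZero _ α y
      else if G.dist v y = n + 1 then ∑ z ∈ G.neighborFinset y, extendZero _ α z else 0 :=
    fun y => rfl
  have hext : ∀ y, G.dist v y ≠ n → extendZero _ α y = 0 := fun y hy =>
    extendZero_apply_notMem α fun h => hy (mem_sphereFinset.1 h)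
  rw [algLaplacian_degreeWeight]
  suffices hs : (G.degree x : ℂ)⁻¹ * ∑ y ∈ G.neighborFinset x, twoSpheres hG v η n α y =
      (testRatio η n : ℂ) * twoSpheres hG v η n α x by
    rw [hs]
    push_cast
    ring
  rw [inv_mul_eq_iff_eq_mul₀ (degree_ne_zero hG x), hη]
  by_cases hxn : G.dist v x = n
  · have hterm : ∀ y ∈ G.neighborFinset x, twoSpheres hG v η n α y =
        if G.dist v y = G.dist v x + 1 then extendZero _ α x else 0 := fun y hy => by
      rw [SimpleGraph.mem_neighborFinset] at hy
      rcases dist_eq_of_adj hG v hy with hd | hd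
      · rw [happ, if_neg (by omega), if_pos (by omega), if_pos hd, Finset.sum_eq_single x]
        · intro z hz hzx
          rw [SimpleGraph.mem_neighborFinset] at hz
          refine hext z fun hzn => hzx ?_
          exact eq_of_adj_of_dist_lt hG hz hy.symm (v := v) (by omega) (by omega)
        · intro h
          exact absurd ((G.mem_neighborFinset y x).2 hy.symm) h
      · rw [happ, if_neg (by omega), if_neg (by omega), if_neg (by omega)]
    rw [Finset.sum_congr rfl hterm, ← Finset.sum_filter, Finset.sum_const, nsmul_eq_mul]
    have hcard := card_children_add_one hG (v := v) (x := x) (by omega)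
    rw [hη, hxn] at hcard
    rw [hxn]
    have hcard' : ((((G.neighborFinset x).filter
        fun y => G.dist v y = n + 1).card : ℕ) : ℂ) = η n - 1 := by
      rw [← hcard]
      push_cast
      ring
    have hsq' := congrArg (fun r : ℝ => (r : ℂ)) hsq
    push_cast at hsq'
    rw [hcard', happ, if_pos hxn]
    push_cast
    linear_combination (-extendZero _ α x) * hsq'
  · have hxn' : G.dist v x = n + 1 := by
      by_contra h
      rw [happ, if_neg hxn, if_neg h] at hx
      exact hx rfl
    have hterm : ∀ y ∈ G.neighborFinset x, twoSpheres hG v η n α y =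
        ((testRatio η n * η (n + 1) : ℝ) : ℂ) * extendZero _ α y := fun y hy => by
      rw [SimpleGraph.mem_neighborFinset] at hy
      rcases dist_eq_of_adj hG v hy with hd | hd
      · rw [happ, if_neg (by omega), if_neg (by omega), hext y (by omega), mul_zero]
      · rw [happ, if_pos (by omega)]
    rw [Finset.sum_congr rfl hterm, ← Finset.mul_sum, happ, if_neg hxn, if_pos hxn', hxn']
    push_cast
    ring

theorem le_testRatio {n : ℕ} (h2 : 2 ≤ η n) (h1 : 1 ≤ η (n + 1)) {ε : ℝ}
    (hε : ε⁻¹ ≤ η n) (hε0 : 0 < ε) : (1 - ε) / √(η (n + 1) : ℝ) ≤ testRatio η n := by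
  have h2' : (2 : ℝ) ≤ η n := by exact_mod_cast h2
  have h1' : (1 : ℝ) ≤ η (n + 1) := by exact_mod_cast h1
  have h3 : testRatio η n = √(1 - (η n : ℝ)⁻¹) / √(η (n + 1) : ℝ) := by
    rw [testRatio, ← Real.sqrt_div' _ (by linarith)]
    congr 1
    field_simp
  have h4 : (η n : ℝ)⁻¹ ≤ ε := inv_le_of_inv_le₀ hε0 hε
  have h5 : (η n : ℝ)⁻¹ ≤ 1 := inv_le_one_of_one_le₀ (by linarith)
  have h6 : (0 : ℝ) < (η n : ℝ)⁻¹ := by positivity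
  rw [h3]
  refine div_le_div_of_nonneg_right ?_ (Real.sqrt_nonneg _)
  -- For t = 1/η(n) in [0, 1] one has √(1 - t) ≥ 1 - t ≥ 1 - ε.
  refine le_trans (by linarith) (Real.le_sqrt_of_sq_le (x := 1 - (η n : ℝ)⁻¹) ?_)
  nlinarith

end Normalized
end RadialTree

namespace RadialTree

/-! ### Spectrum and eigenvalue bounds of the normalized Laplacian -/

section NormalizedSpectrum

variable {V : Type u} {G : SimpleGraph V} [G.LocallyFinite] [Infinite V] {η : ℕ → ℕ} {v : V}

/-- The normalized Laplacian is diagonal in a Hilbert basis, and the eigenvalues accumulate only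
at one. -/
theorem exists_isDiagonalizedBy_degreeWeight (hG : G.IsTree)
    (hη : ∀ x, G.degree x = η (G.dist v x)) (hmono : Monotone η) (ht : Tendsto η atTop atTop) :
    ∃ (ι : Type u) (b : HilbertBasis ι ℂ (L2 (degreeWeight G hG))) (μ : ι → ℝ),
      IsDiagonalizedBy (laplacian G (degreeWeight G hG)) b μ ∧
      ∀ δ : ℝ, 0 < δ → {i | δ ≤ |μ i - 1|}.Finite := by
  obtain ⟨ι, b, μ, hT, hμ, hfin⟩ := exists_isDiagonalizedBy (G := G)
    (m := degreeWeight G hG) (1 / 2) (fun ε hε => by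
      obtain ⟨n, hn⟩ := ((tendsto_natCast_atTop_atTop.comp ht).eventually_ge_atTop
        ((ε ^ 2)⁻¹)).exists
      refine ⟨ballFinset hG v (n + 1), fun f => ?_⟩
      have h1 := tail_average_le hG hη hmono n f
      have h2 := norm_le_norm_laplacian_add f
      have h3 := inner_laplacian_nonneg f
      -- With s = 1/2 the perturbation is half the averaging operator composed with the resolvent;
      -- the squared factor 1/4 cancels the constant 4 of `tail_average_le`.
      have h4 : (f : L2 (degreeWeight G hG)) -
          ((1 / 2 : ℝ) : ℂ) • (laplacian G (degreeWeight G hG) f + f) =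
          ((1 / 2 : ℝ) : ℂ) • ((f : L2 (degreeWeight G hG)) -
            laplacian G (degreeWeight G hG) f) := by
        ext x
        simp only [sub_apply, smul_apply, add_apply]
        push_cast
        ring
      rw [h4, map_smul, ← smul_sub, norm_smul, ← sq_le_sq₀ (by positivity) (by positivity),
        mul_pow, mul_pow, Complex.norm_real]
      have hn0 : (0 : ℝ) < η n := by exact_mod_cast one_le_radialDegree hG hη n
      have h5 : 4 / (η n : ℝ) ≤ 4 * ε ^ 2 := by
        rw [div_le_iff₀ hn0, mul_assoc]
        have : (ε ^ 2)⁻¹ ≤ η n := hn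
        rw [inv_le_iff_one_le_mul₀' (by positivity)] at this
        linarith
      have h6 : ‖(f : L2 (degreeWeight G hG))‖ ^ 2 ≤
          ‖laplacian G (degreeWeight G hG) f + f‖ ^ 2 := by linarith
      have h7 := h1.trans (mul_le_mul h5 h6 (sq_nonneg _) (by positivity))
      rw [Real.norm_of_nonneg (by norm_num)]
      linarith)
  -- Here |1/(μ+1) - 1/2| = |μ-1| / (2(μ+1)) with μ+1 ≤ |μ-1| + 2, and t/(2(t+2)) increases with t;
  -- the threshold is its value at δ.
  refine ⟨ι, b, μ, hT, fun δ hδ => (hfin (δ / (2 * (δ + 2))) (by positivity)).subset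
    fun i hi => ?_⟩
  have hi' : δ ≤ |μ i - 1| := hi
  have hp : 0 < μ i + 1 := by linarith [hμ i]
  have h1 : (μ i + 1)⁻¹ - 1 / 2 = -(μ i - 1) / (2 * (μ i + 1)) := by
    field_simp
    ring
  have h2 : μ i + 1 ≤ |μ i - 1| + 2 := by linarith [le_abs_self (μ i - 1)]
  rw [Set.mem_ofPred_eq, h1, abs_div, abs_neg, abs_of_pos (show 0 < 2 * (μ i + 1) by linarith),
    div_le_div_iff₀ (by positivity) (by linarith)]
  have h3 : δ * (μ i + 1) ≤ |μ i - 1| * (δ + 2) := by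
    have := mul_le_mul_of_nonneg_left h2 hδ.le
    nlinarith
  linarith

/-- The spectrum of the normalized Laplacian of a radial tree. -/
theorem normalized_spectrum (hG : G.IsTree) (hη : ∀ x, G.degree x = η (G.dist v x))
    (hmono : Monotone η) (ht : Tendsto η atTop atTop) :
    essSpectrum (laplacian G (degreeWeight G hG)) = {1} ∧
      ∃ lam : ℕ → ℝ,
        IsEigenvalueList (laplacian G (degreeWeight G hG)) lam ∧
        Tendsto lam atTop (𝓝 1) ∧
        spectrum (laplacian G (degreeWeight G hG)) =
          {1} ∪ {z : ℂ | ∃ i : ℕ, z = ((lam i : ℝ) : ℂ) ∨ z = ((2 - lam i : ℝ) : ℂ)} ∧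
        ∀ ε : ℝ, 0 < ε → ∃ n₀ : ℕ, ∀ n : ℕ, n₀ ≤ n →
          1 - 2 * √(1 / (η n : ℝ)) ≤ lam (ballBefore G v n).ncard ∧
          lam (ballBefore G v n).ncard ≤ lam ((sphere G v n).ncard - 1) ∧
          lam ((sphere G v n).ncard - 1) ≤ 1 - (1 - ε) / √(η (n + 1) : ℝ) := by
  have h1 : ∀ n, 1 ≤ η n := one_le_radialDegree hG hη
  obtain ⟨ι, b, μ, hT, hfin⟩ := exists_isDiagonalizedBy_degreeWeight hG hη hmono ht
  have hfinc : ∀ c : ℝ, c < 1 → {i | μ i ≤ c}.Finite := fun c hc => by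
    refine (hfin (1 - c) (by linarith)).subset fun i hi => ?_
    have hi' : μ i ≤ c := hi
    rw [Set.mem_ofPred_eq, abs_sub_comm]
    exact le_trans (by linarith) (le_abs_self _)
  have hball : ∀ z : ℂ, z ≠ 1 → {i | ‖(μ i : ℂ) - z‖ < ‖z - 1‖ / 2}.Finite := fun z hz => by
    have hz' : 0 < ‖z - 1‖ := norm_pos_iff.2 (sub_ne_zero.2 hz)
    refine (hfin (‖z - 1‖ / 2) (half_pos hz')).subset fun i hi => ?_
    have hi' : ‖(μ i : ℂ) - z‖ < ‖z - 1‖ / 2 := hi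
    have h2 := norm_sub_le_norm_sub_add_norm_sub z (μ i : ℂ) 1
    rw [norm_sub_rev z (μ i : ℂ)] at h2
    have h3 : ‖(μ i : ℂ) - 1‖ = |μ i - 1| := by
      rw [← Complex.ofReal_one, ← Complex.ofReal_sub, Complex.norm_real, Real.norm_eq_abs]
    rw [Set.mem_ofPred_eq, ← h3]
    linarith
  have hz' : ∀ z : ℂ, z ≠ 1 → 0 < ‖z - 1‖ / 2 := fun z hz =>
    half_pos (norm_pos_iff.2 (sub_ne_zero.2 hz))
  have htest : ∀ n, n ≠ 0 → 2 ≤ η n → ∀ α, _ := fun n hn h2 =>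
    inner_laplacian_toL2_le (m := degreeWeight G hG) (twoSpheres_finite hG v η n)
      (algLaplacian_twoSpheres hG hη hn h2 (h1 (n + 1)))
  have hlt1 : ∀ n, 2 ≤ η n → ((1 - testRatio η n : ℝ) : EReal) < 1 := fun n h2 => by
    have := testRatio_pos h2 (h1 (n + 1))
    exact_mod_cast show 1 - testRatio η n < 1 by linarith
  have hinf1 : {i | (μ i : EReal) < 1}.Infinite := by
    refine hT.infinite_setOf_lt fun k => ?_
    obtain ⟨n, hn, hkn, h2, hn0⟩ := ((eventually_ncard_ballBefore_lt hG hη ht).and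
      ((eventually_ge_atTop k).and ((ht.eventually_ge_atTop 2).and
        (eventually_ne_atTop 0)))).exists
    refine ⟨sphereFinset hG v n → ℂ, inferInstance, inferInstance, toL2 _ _ _, _, ?_,
      toL2_injective (twoSpheres_injective hG v h2 (h1 (n + 1))), hlt1 n h2, htest n hn0 h2⟩
    rw [finrank_sphereFinset]
    have := le_ncard_ballBefore hG v n
    omega
  -- Infinitely many entries lie below 1, and only finitely many at distance at least δ from 1.
  have hnear : ∀ δ : ℝ, 0 < δ → ∃ i, μ i < 1 ∧ ‖(μ i : ℂ) - 1‖ < δ := fun δ hδ => by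
    obtain ⟨i, hi, hiδ⟩ := (hinf1.sdiff (hfin δ hδ)).nonempty
    have hi' : (μ i : EReal) < 1 := hi
    refine ⟨i, by exact_mod_cast hi', ?_⟩
    rw [← Complex.ofReal_one, ← Complex.ofReal_sub, Complex.norm_real, Real.norm_eq_abs]
    exact not_le.1 hiδ
  have h1s : (1 : ℂ) ∈ spectrum (laplacian G (degreeWeight G hG)) :=
    hT.mem_spectrum_iff.2 fun δ hδ => (hnear δ hδ).imp fun i hi => hi.2
  have hess : essSpectrum (laplacian G (degreeWeight G hG)) = {1} := by
    ext z
    rw [Set.mem_singleton_iff]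
    constructor
    · rintro ⟨hz, hd⟩
      by_contra hz1
      exact hd (hT.mem_discreteSpectrum hz (hz' z hz1) (hball z hz1))
    -- Entries below 1 accumulate at 1, so 1 is not isolated in the spectrum.
    · rintro rfl
      refine ⟨h1s, fun hd => ?_⟩
      obtain ⟨δ, hδ, hsub⟩ := Metric.mem_nhdsWithin_iff.1 hd.2.1
      obtain ⟨i, hi, hiδ⟩ := hnear δ hδ
      refine hsub ⟨?_, ?_⟩ (hT.mem_spectrum i)
      · rwa [Metric.mem_ball, dist_eq_norm]
      · intro h
        exact hi.ne (Complex.ofReal_eq_one.1 h)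
  have hinfE : infEssSpectrum (laplacian G (degreeWeight G hG)) = 1 := by
    rw [infEssSpectrum, hess, Set.image_singleton, sInf_singleton]
    simp
  obtain ⟨e, he⟩ := hT.exists_isEigenvalueList (fun c hc => hfinc c (by
    rw [hinfE] at hc
    exact_mod_cast hc)) (by rwa [hinfE])
  have hlam1 : ∀ n, μ (e n) < 1 := fun n => by
    have := (he.below n).trans_eq hinfE
    exact_mod_cast this
  have hsymm : ∀ i, ∃ j, μ j = 2 - μ i := fun i => by
    obtain ⟨hd, hi⟩ := hT.apply_basis i
    obtain ⟨g, hg0, hg⟩ := exists_reflected_eigenvector hG v ⟨b i, hd⟩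
      (b.orthonormal.ne_zero i) hi
    obtain ⟨j, hj⟩ := hT.exists_eq_of_apply_eq_smul hg0 hg
    exact ⟨j, by exact_mod_cast hj⟩
  have hmem : ∀ i, μ i < 1 → ∃ n, μ (e n) = μ i := fun i hi =>
    ⟨e.symm ⟨i, by
      change (μ i : EReal) < _
      rw [hinfE]
      exact_mod_cast hi⟩, by simp⟩
  refine ⟨hess, fun n => μ (e n), he, ?_, ?_, fun ε hε => ?_⟩
  · refine tendsto_order.2 ⟨fun c hc => ?_, fun c hc =>
      Eventually.of_forall fun n => (hlam1 n).trans hc⟩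
    exact IsDiagonalizedBy.eventually_lt_enumeration (e := e) (hfinc c hc)
  · ext z
    constructor
    · intro hz
      by_cases hz1 : z = 1
      · exact Or.inl hz1
      right
      obtain ⟨i, rfl⟩ := hT.exists_eq_of_mem_spectrum hz (hz' z hz1) (hball z hz1)
      rcases lt_trichotomy (μ i) 1 with h | h | h
      · obtain ⟨n, hn⟩ := hmem i h
        exact ⟨n, Or.inl (congrArg _ hn.symm)⟩
      · exact absurd (by rw [h]; simp) hz1
      -- An entry above 1 is the reflection of one below 1, which is in the list.
      · obtain ⟨j, hj⟩ := hsymm i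
        obtain ⟨n, hn⟩ := hmem j (by linarith)
        refine ⟨n, Or.inr (congrArg _ ?_)⟩
        linarith
    · rintro (rfl | ⟨n, rfl | rfl⟩)
      · exact h1s
      · exact hT.mem_spectrum _
      · obtain ⟨j, hj⟩ := hsymm (e n)
        rw [← hj]
        exact hT.mem_spectrum _
  · obtain ⟨n₀, hn₀⟩ := eventually_atTop.1 ((eventually_ncard_ballBefore_lt hG hη ht).and
      ((ht.eventually_ge_atTop 2).and ((eventually_ne_atTop 0).and
        ((tendsto_natCast_atTop_atTop.comp ht).eventually_ge_atTop ε⁻¹))))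
    refine ⟨n₀, fun n hn => ?_⟩
    obtain ⟨hcard, h2, hn0, hnε⟩ := hn₀ n hn
    -- In zero-based numbering the claim compares positions #B_{n-1} and #S_n - 1, ordered correctly
    -- because #B_{n-1} + 1 ≤ #S_n.
    refine ⟨?_, he.mono (by omega), ?_⟩
    · exact hT.le_enumeration he.mono (restrictL _ (ballFinset hG v n))
        (finrank_ballFinset hG v n).le fun f hf =>
          le_inner_laplacian_degreeWeight hG hη hmono n f hf
    · refine (hT.enumeration_le he.mono _
        (toL2_injective (twoSpheres_injective hG v h2 (h1 (n + 1)))) ?_ ?_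
        (htest n hn0 h2)).trans ?_
      · rw [finrank_sphereFinset]
        omega
      · rw [hinfE]
        exact hlt1 n h2
      · have := le_testRatio h2 (h1 (n + 1)) hnε hε
        linarith

end NormalizedSpectrum
end RadialTree

/-- Spectrum of the normalized and of the combinatorial Laplacian of an infinite simple radial
tree with root `v`, where `η n` is the common degree of the vertices at distance `n` from `v`.
The list `lam` starts at index `0`, so that `λ_k` is `lam (k - 1)`. -/
theorem theoremt {V : Type*} [Infinite V] (G : SimpleGraph V) [G.LocallyFinite]
    (hG : G.IsTree) (v : V) (η : ℕ → ℕ) (hη : ∀ x, G.degree x = η (G.dist v x)) :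
    (Monotone η → Tendsto η atTop atTop →
      RadialTree.essSpectrum (RadialTree.laplacian G (RadialTree.degreeWeight G hG)) = {1} ∧
      ∃ lam : ℕ → ℝ,
        RadialTree.IsEigenvalueList
          (RadialTree.laplacian G (RadialTree.degreeWeight G hG)) lam ∧
        Tendsto lam atTop (𝓝 1) ∧
        RadialTree.spectrum (RadialTree.laplacian G (RadialTree.degreeWeight G hG)) =
          {1} ∪ {z : ℂ | ∃ i : ℕ, z = ((lam i : ℝ) : ℂ) ∨ z = ((2 - lam i : ℝ) : ℂ)} ∧
        ∀ ε : ℝ, 0 < ε → ∃ n₀ : ℕ, ∀ n : ℕ, n₀ ≤ n →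
          1 - 2 * √(1 / (η n : ℝ)) ≤ lam (RadialTree.ballBefore G v n).ncard ∧
          lam (RadialTree.ballBefore G v n).ncard ≤ lam ((RadialTree.sphere G v n).ncard - 1) ∧
          lam ((RadialTree.sphere G v n).ncard - 1) ≤ 1 - (1 - ε) / √(η (n + 1) : ℝ)) ∧
    (Monotone (fun n : ℕ => (η n : ℝ) * (1 - 2 * √(1 / (η n : ℝ)))) → Tendsto η atTop atTop →
      RadialTree.essSpectrum
        (RadialTree.laplacian G (RadialTree.oneWeight : V → {r : ℝ // 0 < r})) = ∅ ∧
      ∃ lam : ℕ → ℝ,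
        RadialTree.IsEigenvalueList
          (RadialTree.laplacian G (RadialTree.oneWeight : V → {r : ℝ // 0 < r})) lam ∧
        Tendsto lam atTop atTop ∧
        RadialTree.spectrum
            (RadialTree.laplacian G (RadialTree.oneWeight : V → {r : ℝ // 0 < r})) =
          {z : ℂ | ∃ i : ℕ, z = ((lam i : ℝ) : ℂ)} ∧
        (∀ n : ℕ, (η n : ℝ) * (1 - 2 * √(1 / (η n : ℝ))) ≤
          lam (RadialTree.ballBefore G v n).ncard) ∧
        (∀ n : ℕ, (RadialTree.ballBefore G v n).ncard + 1 ≤ (RadialTree.sphere G v n).ncard →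
          lam (RadialTree.ballBefore G v n).ncard ≤ η n) ∧
        (∃ n₀ : ℕ, ∀ n : ℕ, n₀ ≤ n → lam (RadialTree.ballBefore G v n).ncard ≤ η n)) := by
  exact ⟨RadialTree.normalized_spectrum hG hη, RadialTree.combinatorial_spectrum hG hη⟩
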